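/- Let $n,N\ge 1$. Consider functions $u(t,x)$ of $t$ and $x=(x^1,\dots,x^n)$, and write $u_{a,\alpha}=\partial_t^a\partial_x^\alpha u$ for $a\ge 0$ and a multi-index $\alpha$ in $x^1,\dots,x^n$, and $|\alpha|$ for its length. Let $\mathcal D$ be a nonempty domain in the jet space, given by open conditions on $(t,x)$ and on finitely many $u_{a,\alpha}$ with $a<N$, such that the set of admissible $(t,x)$ is star-shaped and such that for some smooth function $\tilde u(t,x)$ the jet of $\lambda u+(1-\lambda)\tilde u$ lies in $\mathcal D$ whenever the jet of $u$ does and $0\le\lambda\le 1$ (for example, $\mathcal D$ is the whole jet space). A *normal* function of order at most $k$ is a smooth function on $\mathcal D$ of $t,x$ and of those $u_{a,\alpha}$ with $a<N$ and $a+|\alpha|\le k$ only. Let $D_t$, $D_i$ be the total derivatives and $D^\alpha=D_1^{\alpha_1}\cdots D_n^{\alpha_n}$. Let $g$ be normal of order at most $m$, and consider the Cauchy–Kovalevskaya scalar PDE $$G=\partial_t^N u+g=0 .\tag{1}$$ "For all solutions of (1)" means: at all jets in $\mathcal D$ at which $G$ and all its differential consequences $D_t^aD^\alpha G$ vanish.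 Let $\mathcal D_t$ be the total $t$-derivative on the solution space, acting on normal functions (that is, $D_t$ with $u_{N,\alpha}$ replaced by $-D^\alpha g$). A *conservation law* of (1) consists of normal functions $\Phi^t,\Phi^1,\dots,\Phi^n$ (of some finite order) with $D_t\Phi^t+D_i\Phi^i=0$ for all solutions of (1). It is *trivial* if there are normal $\theta^i$ and $\psi^{ij}=-\psi^{ji}$ with $\Phi^t=D_i\theta^i$ and $\Phi^i=-D_t\theta^i+D_j\psi^{ij}$ for all solutions of (1). A normal function $\Lambda$ is the *multiplier* of the conservation law if $$\Lambda=\sum_\alpha(-1)^{|\alpha|}D^\alpha\frac{\partial\Phi^t}{\partial u_{N-1,\alpha}}$$ and $$(\partial_t^Nu+g)\,\Lambda=D_t\Phi^t+D_i(\Phi^i-\Gamma^i)$$ holds identically on $\mathcal D$ (not only for solutions), where each $\Gamma^i$ is a finite linear combination of $G$ and its differential consequences, with smooth functions of finitely many jet variables as coefficients. For a normal function $\Lambda$ put $\Omega_0=\Lambda$ and, for $q=1,\dots,N$, $$\Omega_q=(-1)^q\mathcal D_t^q\Lambda+\sum_{k=1}^q(-1)^{q-k}\mathcal D_t^{q-k}\Big(\sum_{|\alpha|\le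 m}(-1)^{|\alpha|}D^\alpha\Big(\frac{\partial g}{\partial u_{N-k,\alpha}}\Lambda\Big)\Big).$$ **Theorem.** Let $p\ge 0$ and let $\Lambda$ be normal of order at most $p$. Then $\Lambda$ is the multiplier of some conservation law of (1) if and only if it satisfies the determining system consisting of the adjoint-symmetry equation $$\Omega_N=0\tag{2}$$ and, for all $j,k\in\{0,\dots,N-1\}$ and all $\alpha$ with $|\alpha|\le p'$, where $p'=\max(p,m)+mk$, the extra equations $$\frac{\partial\Omega_k}{\partial u_{N-1-j,\alpha}}-(-1)^{|\alpha|}\frac{\partial\Omega_j}{\partial u_{N-1-k,\alpha}}=\sum_{\beta\ne 0,\ |\alpha|+|\beta|\le p'}(-1)^{|\beta|+1}\frac{(\alpha+\beta)!}{\alpha!\,\beta!}\,D^\beta\frac{\partial\Omega_k}{\partial u_{N-1-j,\alpha+\beta}} ,\tag{3}$$ where (2) and (3) are required to hold identically on $\mathcal D$. Moreover, $\Lambda$ is the multiplier of some nontrivial conservation law of (1) if and only if it satisfies (2) and (3) and is not identically zero on $\mathcal D$. -/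

import Mathlib

open scoped ContDiff

noncomputable section

namespace CK

/-- Labels of the derivatives of `u`: the pair `(a, α)` labels `∂_t^a ∂_x^α u`, where `α` is a
multi-index in the variables `x¹, …, xⁿ`. -/
abbrev Coord (n : ℕ) : Type := ℕ × (Fin n → ℕ)

/-- The length `|α|` of a multi-index. -/
def len {n : ℕ} (α : Fin n → ℕ) : ℕ := ∑ i, α i

/-- The multi-indices of length at most `r`. -/
def multiIndices (n r : ℕ) : Finset (Fin n → ℕ) :=
  (Fintype.piFinset fun _ => Finset.range (r + 1)).filter fun α => len α ≤ r

/-- The multi-index binomial coefficient `α! / (β! (α - β)!)`. -/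
def multiChoose {n : ℕ} (α β : Fin n → ℕ) : ℕ := ∏ i, (α i).choose (β i)

/-- A point of the infinite jet space of functions `u(t, x¹, …, xⁿ)`. -/
structure Jet (n : ℕ) where
  t : ℝ
  x : Fin n → ℝ
  u : Coord n → ℝ

/-- The point `(t, x)` under a jet. -/
def Jet.base {n : ℕ} (z : Jet n) : ℝ × (Fin n → ℝ) := (z.t, z.x)

/-- The projection of the jet space that keeps `(t, x)` and the finitely many derivatives of `u`
with label in `S`. -/
def Jet.proj {n : ℕ} (S : Finset (Coord n)) (z : Jet n) : ℝ × (Fin n → ℝ) × (S → ℝ) :=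
  (z.t, z.x, fun c => z.u c)

/-- On `D`, the function `f` is a smooth function of `(t, x)` and of the derivatives of `u` with
label in `S` only. -/
def SmoothIn {n : ℕ} (D : Set (Jet n)) (S : Finset (Coord n)) (f : Jet n → ℝ) : Prop :=
  ∃ F : ℝ × (Fin n → ℝ) × (S → ℝ) → ℝ,
    ContDiffOn ℝ ∞ F (Jet.proj S '' D) ∧ ∀ z ∈ D, f z = F (Jet.proj S z)

/-- A differential function on `D`: a smooth function of `(t, x)` and of finitely many
derivatives of `u`. -/
def IsDiffFun {n : ℕ} (D : Set (Jet n)) (f : Jet n → ℝ) : Prop := ∃ S, SmoothIn D S f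

/-- The labels of the derivatives of `u` of order at most `k`, without `∂_t^N u` and its
differential consequences. -/
def normalCoords (n N k : ℕ) : Finset (Coord n) :=
  (Finset.range N ×ˢ multiIndices n k).filter fun c => c.1 + len c.2 ≤ k

/-- `f` is a differential function `f(t, x, u, ∂u, …, ∂^k u)` on `D` which does not depend on
`∂_t^N u` and its differential consequences. -/
def IsNormal {n : ℕ} (N k : ℕ) (D : Set (Jet n)) (f : Jet n → ℝ) : Prop :=
  SmoothIn D (normalCoords n N k) f

/-! Partial derivatives on the jet space. -/

def pdT {n : ℕ} (f : Jet n → ℝ) (z : Jet n) : ℝ :=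
  deriv (fun s => f { z with t := s }) z.t

def pdX {n : ℕ} (i : Fin n) (f : Jet n → ℝ) (z : Jet n) : ℝ :=
  deriv (fun s => f { z with x := Function.update z.x i s }) (z.x i)

def pdU {n : ℕ} (c : Coord n) (f : Jet n → ℝ) (z : Jet n) : ℝ :=
  deriv (fun s => f { z with u := Function.update z.u c s }) (z.u c)

/-! Total derivatives. For a differential function only finitely many terms of the sums are
nonzero. -/

/-- The total derivative `D_t`. -/
def Dt {n : ℕ} (f : Jet n → ℝ) (z : Jet n) : ℝ :=
  pdT f z + ∑ᶠ c : Coord n, z.u (c.1 + 1, c.2) * pdU c f z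

/-- The total derivative `D_i`. -/
def Dx {n : ℕ} (i : Fin n) (f : Jet n → ℝ) (z : Jet n) : ℝ :=
  pdX i f z + ∑ᶠ c : Coord n, z.u (c.1, c.2 + Pi.single i 1) * pdU c f z

/-- The iterated total derivative `D^α = D_1^{α_1} ⋯ D_n^{α_n}`. -/
def DxPow {n : ℕ} (α : Fin n → ℕ) (f : Jet n → ℝ) : Jet n → ℝ :=
  (List.finRange n).foldr (fun i h => (Dx i)^[α i] h) f

/-- The expression `G = ∂_t^N u + g`. -/
def eqn {n : ℕ} (N : ℕ) (g : Jet n → ℝ) (z : Jet n) : ℝ := z.u (N, 0) + g z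

/-- The solution space in `D` of the PDE `∂_t^N u + g = 0`: the jets in `D` at which the PDE and
all its differential consequences hold. -/
def solutionJets {n : ℕ} (N : ℕ) (g : Jet n → ℝ) (D : Set (Jet n)) : Set (Jet n) :=
  {z | z ∈ D ∧ ∀ (a : ℕ) (α : Fin n → ℕ), Dt^[a] (DxPow α (eqn N g)) z = 0}

/-- The total derivative with respect to `t` on the solution space, acting on functions without
dependence on `∂_t^N u` and its differential consequences: `∂_t^N u` is replaced by `-g`, and
`∂_t^N ∂_x^α u` by `-D^α g`. -/
def solDt {n : ℕ} (N : ℕ) (g : Jet n → ℝ) (f : Jet n → ℝ) (z : Jet n) : ℝ :=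
  pdT f z + ∑ᶠ c : Coord n,
    (if c.1 + 1 < N then z.u (c.1 + 1, c.2)
      else if c.1 + 1 = N then -(DxPow c.2 g z) else 0) * pdU c f z

/-- `∑_α (-1)^|α| D^α (∂g/∂(∂_t^b ∂_x^α u) W)`, the adjoint of the linearization of `g` with
respect to `∂_t^b u`, where `g` has order at most `m`. -/
def adjLin {n : ℕ} (m : ℕ) (g : Jet n → ℝ) (b : ℕ) (W : Jet n → ℝ) (z : Jet n) : ℝ :=
  ∑ α ∈ multiIndices n m, (-1 : ℝ) ^ len α * DxPow α (fun y => pdU (b, α) g y * W y) z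

/-- The expressions `Ω_q`. -/
def Omega {n : ℕ} (N m : ℕ) (g Λ : Jet n → ℝ) (q : ℕ) (z : Jet n) : ℝ :=
  (-1 : ℝ) ^ q * (solDt N g)^[q] Λ z +
    ∑ k ∈ Finset.Icc 1 q,
      (-1 : ℝ) ^ (q - k) * (solDt N g)^[q - k] (adjLin m g (N - k) Λ) z

/-- The restricted Euler operator `∑_α (-1)^|α| D^α ∂/∂(∂_t^{N-1} ∂_x^α u)`. -/
def restrictedEuler {n : ℕ} (N : ℕ) (f : Jet n → ℝ) (z : Jet n) : ℝ :=
  ∑ᶠ α : Fin n → ℕ, (-1 : ℝ) ^ len α * DxPow α (pdU (N - 1, α) f) z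

/-- `D_t Φ^t + D_i Φ^i = 0` is a local conservation law in normal form of `∂_t^N u + g = 0`. -/
def IsConservationLaw {n : ℕ} (N : ℕ) (g : Jet n → ℝ) (D : Set (Jet n))
    (Φt : Jet n → ℝ) (Φ : Fin n → Jet n → ℝ) : Prop :=
  (∃ k, IsNormal N k D Φt ∧ ∀ i, IsNormal N k D (Φ i)) ∧
  ∀ z ∈ solutionJets N g D, Dt Φt z + ∑ i, Dx i (Φ i) z = 0

/-- On all solutions, `Φ^t = D_i θ^i` and `Φ^i = -D_t θ^i + D_j ψ^{ij}` with `ψ^{ij} = -ψ^{ji}`. -/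
def IsTrivial {n : ℕ} (N : ℕ) (g : Jet n → ℝ) (D : Set (Jet n))
    (Φt : Jet n → ℝ) (Φ : Fin n → Jet n → ℝ) : Prop :=
  ∃ (k : ℕ) (θ : Fin n → Jet n → ℝ) (ψ : Fin n → Fin n → Jet n → ℝ),
    (∀ i, IsNormal N k D (θ i)) ∧ (∀ i j, IsNormal N k D (ψ i j)) ∧
    (∀ i j, ∀ z ∈ D, ψ i j z = -ψ j i z) ∧
    ∀ z ∈ solutionJets N g D,
      Φt z = ∑ i, Dx i (θ i) z ∧
      ∀ i, Φ i z = -Dt (θ i) z + ∑ j, Dx j (ψ i j) z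

/-- `f` is a linear combination, with differential functions as coefficients, of
`G = ∂_t^N u + g` and finitely many of its differential consequences. -/
def IsProportional {n : ℕ} (N : ℕ) (g : Jet n → ℝ) (D : Set (Jet n)) (f : Jet n → ℝ) : Prop :=
  ∃ (S : Finset (Coord n)) (A : Coord n → Jet n → ℝ), (∀ c, IsDiffFun D (A c)) ∧
    ∀ z ∈ D, f z = ∑ c ∈ S, A c z * Dt^[c.1] (DxPow c.2 (eqn N g)) z

/-- `Λ` is the multiplier of the conservation law with densities `Φ^t, Φ^i`: it is the image of
`Φ^t` under the restricted Euler operator, and `(∂_t^N u + g) Λ = D_t Φ^t + D_i (Φ^i - Γ^i)` for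
all functions `u`, where `Γ^i` is proportional to `∂_t^N u + g` and its differential
consequences. -/
def IsMultiplierOf {n : ℕ} (N : ℕ) (g : Jet n → ℝ) (D : Set (Jet n)) (Λ : Jet n → ℝ)
    (Φt : Jet n → ℝ) (Φ : Fin n → Jet n → ℝ) : Prop :=
  (∀ z ∈ D, Λ z = restrictedEuler N Φt z) ∧
  ∃ Γ : Fin n → Jet n → ℝ, (∀ i, IsProportional N g D (Γ i)) ∧
    ∀ z ∈ D, eqn N g z * Λ z = Dt Φt z + ∑ i, Dx i (fun y => Φ i y - Γ i y) z

/-- The domains on which the expressions live (for example the whole jet space): nonempty open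
conditions on `(t, x)` and on finitely many derivatives of `u` other than `∂_t^N u` and its
differential consequences, such that the set of admissible `(t, x)` is star-shaped, and such that
there is a smooth function `w(t, x)` (here: a differential function that depends on no derivative
of `u`) with the jet of `l u + (1 - l) w` in the domain for all `0 ≤ l ≤ 1` and all `u` with jet
in the domain. -/
structure IsJetDomain {n : ℕ} (N : ℕ) (D : Set (Jet n)) : Prop where
  nonempty : D.Nonempty
  isOpen : ∃ (k : ℕ) (O : Set (ℝ × (Fin n → ℝ) × (normalCoords n N k → ℝ))),
    IsOpen O ∧ D = Jet.proj (normalCoords n N k) ⁻¹' O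
  base_star : ∃ b ∈ Jet.base '' D, StarConvex ℝ b (Jet.base '' D)
  fiber_star : ∃ w : Jet n → ℝ, SmoothIn D ∅ w ∧
    ∀ z ∈ D, ∀ l ∈ Set.Icc (0 : ℝ) 1,
      { z with u := fun c => l * z.u c + (1 - l) * Dt^[c.1] (DxPow c.2 w) z } ∈ D

/-- The linear determining system for `Λ`: the adjoint symmetry equation `Ω_N = 0` and, for all
`j, k` in `{0, …, N-1}` and all multi-indices `α` with `|α| ≤ p' = max(p, m) + m k`, the equation
`∂Ω_k/∂(∂_t^{N-1-j} u_α) - (-1)^|α| ∂Ω_j/∂(∂_t^{N-1-k} u_α)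
  = ∑_{β ≠ 0, |α| + |β| ≤ p'} (-1)^{|β|+1} (α+β)!/(α! β!) D^β ∂Ω_k/∂(∂_t^{N-1-j} u_{α+β})`. -/
def DeterminingSystem {n : ℕ} (N m p : ℕ) (g : Jet n → ℝ) (D : Set (Jet n))
    (Λ : Jet n → ℝ) : Prop :=
  (∀ z ∈ D, Omega N m g Λ N z = 0) ∧
  ∀ j < N, ∀ k < N, ∀ α ∈ multiIndices n (max p m + m * k), ∀ z ∈ D,
    pdU (N - 1 - j, α) (Omega N m g Λ k) z
        - (-1 : ℝ) ^ len α * pdU (N - 1 - k, α) (Omega N m g Λ j) z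
      = ∑ β ∈ (multiIndices n (max p m + m * k - len α)).erase 0,
          (-1 : ℝ) ^ (len β + 1) * (multiChoose (α + β) β : ℝ) *
            DxPow β (pdU (N - 1 - j, α + β) (Omega N m g Λ k)) z

end CK

end

/-! ### Multi-indices and monomials in commuting operators -/

open scoped ContDiff

noncomputable section

namespace CK

section MultiIndex

variable {n : ℕ}

/-! Normal functions are functions of t, x and the x-derivatives of the N dependent variables u_b =
∂_t^b u with b < N, and (1) becomes the evolution system ∂_t u_b = u_{b+1}, ∂_t u_{N-1} = -g. Its
time derivative 𝒟_t (`sT`) is a derivation of the algebra of normal functions that commutes with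
every D_i. Each point of the normal jet space extends to a solution jet (`exists_solutionJet`), so a
relation between normal functions that holds on solutions holds identically, and a conservation law
is the identity 𝒟_tΦ^t + D_iΦ^i = 0.

Let E_b = Σ (-D)^α ∂/∂u_{b,α}. It kills divergences, and `euler_sT` computes its commutator with
𝒟_t. Applying E_{N-1}, E_{N-2}, …, E_0 to the conservation law shows that the functions E_{N-1-q}Φ^t
obey the recursion of the Ω_q, starting from Λ = E_{N-1}Φ^t; at the last step no further variable is
left, and the relation reads Ω_N = 0. The linearizations of the variational derivatives of a single
density are adjoint to each other (`star_symb_euler`). These Helmholtz conditions for the Ω_q,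
written in components (`star_apply_eq_iff`), are (3).

Conversely, the Helmholtz conditions give, by a homotopy to the jet of a section, a density Φ with
E_{N-1-q}Φ = Ω_q (`exists_euler_eq`). The recursion and Ω_N = 0 then say that every E_b(𝒟_tΦ)
vanishes, so 𝒟_tΦ is a divergence up to a function of (t, x) (`exists_eq_base_add_div`). The
Poincaré lemma on the star-shaped base absorbs that function. The multiplier identity is an
integration by parts: D_tΦ^t - 𝒟_tΦ^t = Σ (∂Φ^t/∂u_{N-1,α}) D^αG equals ΛG plus a divergence, which
gives Γ.

If Λ = 0, all Ω_q vanish, hence all variational derivatives of Φ^t do, and Φ^t is a divergence up to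
a function of (t, x). Exactness of a Koszul complex in the D_i and the Poincaré lemma on the base
then produce θ and ψ (`exists_trivial`). In the other direction, a trivial law has Φ^t = D_iθ^i and
so Λ = 0.

The work takes place in the algebra `CylFun` of smooth functions of finitely many coordinates.
Linear differential operators are formal symbols `Sym`, which makes adjoints and integration by
parts purely algebraic. -/

lemma len_zero : len (0 : Fin n → ℕ) = 0 := by simp [len]

lemma len_add (α β : Fin n → ℕ) : len (α + β) = len α + len β := by
  simp [len, Finset.sum_add_distrib]

lemma len_single (i : Fin n) (k : ℕ) : len (Pi.single i k : Fin n → ℕ) = k := by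
  simp [len]

lemma len_eq_zero {α : Fin n → ℕ} : len α = 0 ↔ α = 0 := by
  simp [len, funext_iff]

lemma exists_eq_add_single {α : Fin n → ℕ} {i : Fin n} (h : α i ≠ 0) :
    ∃ β : Fin n → ℕ, α = β + Pi.single i 1 := by
  refine ⟨α - Pi.single i 1, funext fun j => ?_⟩
  by_cases hj : j = i
  · subst hj; simp; omega
  · simp [hj]

lemma multiIndex_induction {P : (Fin n → ℕ) → Prop} (h0 : P 0)
    (hs : ∀ α i, P α → P (α + Pi.single i 1)) (α : Fin n → ℕ) : P α := by
  induction h : len α generalizing α with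
  | zero => rw [len_eq_zero.1 h]; exact h0
  | succ k ih =>
    have : ∃ i, α i ≠ 0 := by
      by_contra! hc
      have : α = 0 := funext hc
      rw [this, len_zero] at h
      omega
    obtain ⟨i, hi⟩ := this
    obtain ⟨β, rfl⟩ := exists_eq_add_single hi
    refine hs β i (ih β ?_)
    rw [len_add, len_single] at h
    omega

lemma mem_multiIndices {r : ℕ} {α : Fin n → ℕ} : α ∈ multiIndices n r ↔ len α ≤ r := by
  simp only [multiIndices, Finset.mem_filter, Fintype.mem_piFinset, Finset.mem_range,
    and_iff_right_iff_imp]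
  intro h i
  have : α i ≤ len α := Finset.single_le_sum (f := α) (fun _ _ => Nat.zero_le _) (Finset.mem_univ i)
  omega

/-- Pascal's rule for multi-indices. -/
lemma multiChoose_add_single (γ α : Fin n → ℕ) (i : Fin n) :
    multiChoose (γ + Pi.single i 1) (α + Pi.single i 1) =
      multiChoose γ α + multiChoose γ (α + Pi.single i 1) := by
  have key : ∀ a b : Fin n → ℕ, multiChoose a b =
      (a i).choose (b i) * ∏ j ∈ Finset.univ.erase i, (a j).choose (b j) := fun a b =>
    (Finset.mul_prod_erase _ (fun j => (a j).choose (b j)) (Finset.mem_univ i)).symm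
  rw [key, key γ α, key γ (α + Pi.single i 1)]
  have e1 : ∏ j ∈ Finset.univ.erase i, ((γ + Pi.single i 1 : Fin n → ℕ) j).choose ((α + Pi.single i 1 : Fin n → ℕ) j) =
      ∏ j ∈ Finset.univ.erase i, (γ j).choose (α j) :=
    Finset.prod_congr rfl fun j hj => by
      simp [Pi.single_eq_of_ne (Finset.ne_of_mem_erase hj)]
  have e2 : ∏ j ∈ Finset.univ.erase i, (γ j).choose ((α + Pi.single i 1 : Fin n → ℕ) j) =
      ∏ j ∈ Finset.univ.erase i, (γ j).choose (α j) :=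
    Finset.prod_congr rfl fun j hj => by
      simp [Pi.single_eq_of_ne (Finset.ne_of_mem_erase hj)]
  rw [e1, e2, ← add_mul]
  simp [Nat.choose_succ_succ]

lemma multiChoose_add_single_of_eq_zero (γ α : Fin n → ℕ) (i : Fin n) (h : α i = 0) :
    multiChoose (γ + Pi.single i 1) α = multiChoose γ α := by
  refine Finset.prod_congr rfl fun j _ => ?_
  by_cases hj : j = i
  · subst hj; simp [h]
  · simp [hj]

lemma multiChoose_eq_zero {γ α : Fin n → ℕ} (h : ¬ α ≤ γ) : multiChoose γ α = 0 := by
  simp only [Pi.le_def, not_forall, not_le] at h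
  obtain ⟨i, hi⟩ := h
  exact Finset.prod_eq_zero (Finset.mem_univ i) (Nat.choose_eq_zero_of_lt hi)

lemma multiChoose_symm_add (α β : Fin n → ℕ) : multiChoose (α + β) α = multiChoose (α + β) β :=
  Finset.prod_congr rfl fun i _ => by simpa using Nat.choose_symm_add

lemma multiChoose_zero_right (α : Fin n → ℕ) : multiChoose α 0 = 1 := by
  simp [multiChoose]

end MultiIndex

section Powers

variable {n : ℕ} {P Q : Type*} [AddCommMonoid P] [Module ℝ P] [AddCommMonoid Q] [Module ℝ Q]

/-- The power `T^α = T_1^{α_1} ⋯ T_n^{α_n}` of a family of endomorphisms. -/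
def npow (T : Fin n → Module.End ℝ P) (α : Fin n → ℕ) : Module.End ℝ P :=
  ((List.finRange n).map fun i => T i ^ α i).prod

lemma npow_zero (T : Fin n → Module.End ℝ P) : npow T 0 = 1 := by
  simp [npow]

lemma npow_add_single {T : Fin n → Module.End ℝ P} (hT : ∀ i j, Commute (T i) (T j))
    (α : Fin n → ℕ) (i : Fin n) : npow T (α + Pi.single i 1) = T i * npow T α := by
  have off : ∀ l : List (Fin n), i ∉ l →
      (l.map fun j => T j ^ (α + Pi.single i 1 : Fin n → ℕ) j) = l.map fun j => T j ^ α j := by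
    intro l hl
    refine List.map_congr_left fun j hj => ?_
    have : j ≠ i := fun h => hl (h ▸ hj)
    simp [this]
  have : ∀ l : List (Fin n), l.Nodup → i ∈ l →
      (l.map fun j => T j ^ (α + Pi.single i 1 : Fin n → ℕ) j).prod =
        T i * (l.map fun j => T j ^ α j).prod := by
    intro l
    induction l with
    | nil => simp
    | cons h l ih =>
      intro hn hi
      rw [List.nodup_cons] at hn
      rw [List.map_cons, List.map_cons, List.prod_cons, List.prod_cons]
      by_cases hh : h = i
      · subst hh
        rw [off l hn.1]
        simp [pow_succ', mul_assoc]
      · have hi' : i ∈ l := by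
          rcases List.mem_cons.1 hi with h' | h'
          · exact absurd h'.symm hh
          · exact h'
        rw [ih hn.2 hi', ← mul_assoc, ← mul_assoc]
        congr 1
        simp only [Pi.add_apply, Pi.single_apply, hh, if_false, add_zero]
        exact ((hT h i).pow_left _).eq
  exact this _ (List.nodup_finRange n) (List.mem_finRange i)

/-- Intertwining passes from the generators to monomials. Applied to pullbacks, to the linearization
map and to commuting operators, it transports D^α through all of them. -/
lemma map_npow {T : Fin n → Module.End ℝ P} {T' : Fin n → Module.End ℝ Q} (f : P →ₗ[ℝ] Q)
    (h : ∀ i x, f (T i x) = T' i (f x)) (α : Fin n → ℕ) (x : P) :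
    f (npow T α x) = npow T' α (f x) := by
  have hp : ∀ i k x, f ((T i ^ k) x) = (T' i ^ k) (f x) := by
    intro i k
    induction k with
    | zero => simp
    | succ k ih => intro x; rw [pow_succ', pow_succ', Module.End.mul_apply, h, ih]; rfl
  have : ∀ l : List (Fin n), f ((l.map fun i => T i ^ α i).prod x) =
      (l.map fun i => T' i ^ α i).prod (f x) := by
    intro l
    induction l with
    | nil => simp
    | cons i l ih => simp [hp, ih]
  exact this _

lemma commute_npow {T : Fin n → Module.End ℝ P} {S : Module.End ℝ P}
    (h : ∀ i, Commute S (T i)) (α : Fin n → ℕ) : Commute S (npow T α) :=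
  LinearMap.ext fun x => map_npow S (fun i x => LinearMap.congr_fun (h i) x) α x

lemma commute_neg {S T : Module.End ℝ P} (h : Commute S T) : Commute ((-1 : ℝ) • S) T :=
  h.smul_left _

lemma npow_neg {T : Fin n → Module.End ℝ P} (hT : ∀ i j, Commute (T i) (T j)) (α : Fin n → ℕ) :
    npow (fun i => (-1 : ℝ) • T i) α = (-1 : ℝ) ^ len α • npow T α := by
  induction α using multiIndex_induction with
  | h0 => simp [npow_zero, len_zero]
  | hs α i ih =>
    rw [npow_add_single hT, npow_add_single (fun i j => commute_neg (commute_neg (hT i j).symm).symm),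
      ih, len_add, len_single, pow_succ', smul_mul_assoc, mul_smul_comm, smul_smul]

end Powers

end CK

end

/-! ### Symbols of linear differential operators and their adjoints -/

open scoped ContDiff

noncomputable section

namespace CK

/-- Symbols of linear differential operators with coefficients in `A`: the family `B` stands for
the operator `∑ B_α D^α`. -/
abbrev Sym (n : ℕ) (A : Type*) [Zero A] : Type _ := (Fin n → ℕ) →₀ A

namespace Sym

section Lift

variable {n : ℕ} {A : Type*} [CommRing A] [Algebra ℝ A]
  {P : Type*} [AddCommMonoid P] [Module ℝ P]

/-- The linear map `single α a ↦ T^α (j a)`. -/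
def lift (T : Fin n → Module.End ℝ P) (j : A →ₗ[ℝ] P) : Sym n A →ₗ[ℝ] P :=
  Finsupp.lsum ℝ fun α => (npow T α).comp j

lemma lift_single (T : Fin n → Module.End ℝ P) (j : A →ₗ[ℝ] P) (α : Fin n → ℕ) (a : A) :
    lift T j (Finsupp.single α a) = npow T α (j a) := by
  simp [lift]

/-- Composition of a symbol with `D_i`, without differentiating the coefficients. -/
def shift (i : Fin n) : Module.End ℝ (Sym n A) :=
  Finsupp.lmapDomain A ℝ (· + Pi.single i 1)

lemma shift_single (i : Fin n) (α : Fin n → ℕ) (a : A) :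
    shift i (Finsupp.single α a) = Finsupp.single (α + Pi.single i 1) a := by
  simp [shift]

/-- Coefficientwise application of a linear map. -/
def coef (S : Module.End ℝ A) : Module.End ℝ (Sym n A) := Finsupp.mapRange.linearMap S

lemma coef_single (S : Module.End ℝ A) (α : Fin n → ℕ) (a : A) :
    coef S (Finsupp.single α a) = Finsupp.single α (S a) := by
  simp [coef]

lemma coef_apply (S : Module.End ℝ A) (B : Sym n A) (α : Fin n → ℕ) :
    coef S B α = S (B α) := by
  simp [coef]

lemma shift_apply_add (i : Fin n) (B : Sym n A) (α : Fin n → ℕ) :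
    shift i B (α + Pi.single i 1) = B α :=
  Finsupp.mapDomain_apply (add_left_injective _) B α

lemma shift_apply_of_eq_zero (i : Fin n) (B : Sym n A) (α : Fin n → ℕ) (h : α i = 0) :
    shift i B α = 0 := by
  refine Finsupp.mapDomain_of_notMem_range _ _ ?_
  rintro ⟨β, rfl⟩
  simp at h

lemma commute_shift (i j : Fin n) : Commute (shift i : Module.End ℝ (Sym n A)) (shift j) :=
  Finsupp.lhom_ext fun α a => by
    simp only [Module.End.mul_apply, shift_single]
    rw [add_right_comm]

lemma commute_shift_coef (i : Fin n) (S : Module.End ℝ A) :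
    Commute (shift i : Module.End ℝ (Sym n A)) (coef S) :=
  Finsupp.lhom_ext fun α a => by
    simp only [Module.End.mul_apply, shift_single, coef_single]

lemma commute_coef {S S' : Module.End ℝ A} (h : Commute S S') :
    Commute (coef S : Module.End ℝ (Sym n A)) (coef S') :=
  Finsupp.lhom_ext fun α a => by
    simp only [Module.End.mul_apply, coef_single]
    rw [← Module.End.mul_apply, h.eq, Module.End.mul_apply]

/-- `lift` substitutes commuting operators for the formal D_i. Adjoint, `eps`, `toDiv` and `coact`
are all such substitutions, so their calculus follows from this rule and `lift_coef`. -/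
lemma lift_shift {T : Fin n → Module.End ℝ P} (hT : ∀ i j, Commute (T i) (T j))
    (j : A →ₗ[ℝ] P) (i : Fin n) (B : Sym n A) : lift T j (shift i B) = T i (lift T j B) := by
  have : (lift T j).comp (shift i) = (T i).comp (lift T j) :=
    Finsupp.lhom_ext fun α a => by
      simp [shift_single, lift_single, npow_add_single hT]
  exact LinearMap.congr_fun this B

lemma lift_coef {T : Fin n → Module.End ℝ P} {S' : Module.End ℝ P}
    (hS : ∀ i, Commute S' (T i)) {j : A →ₗ[ℝ] P} {S : Module.End ℝ A}
    (h : ∀ a, j (S a) = S' (j a)) (B : Sym n A) : lift T j (coef S B) = S' (lift T j B) := by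
  have : (lift T j).comp (coef S) = S'.comp (lift T j) :=
    Finsupp.lhom_ext fun α a => by
      simp only [LinearMap.comp_apply, coef_single, lift_single, h]
      exact (LinearMap.congr_fun (commute_npow hS α) (j a)).symm
  exact LinearMap.congr_fun this B

end Lift

section Operators

variable {n : ℕ} {A : Type*} [CommRing A] [Algebra ℝ A] (D : Fin n → Derivation ℝ A A)

/-- The derivations as endomorphisms. -/
abbrev dEnd (i : Fin n) : Module.End ℝ A := (D i : A →ₗ[ℝ] A)

/-- `D^α`. -/
abbrev tpow (α : Fin n → ℕ) : Module.End ℝ A := npow (dEnd D) α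

/-- Composition of a symbol with `D_i` from the left. -/
def comp (i : Fin n) : Module.End ℝ (Sym n A) := shift i + coef (dEnd D i)

/-- The formal adjoint. -/
def star : Module.End ℝ (Sym n A) := lift (fun i => (-1 : ℝ) • comp D i) (Finsupp.lsingle 0)

/-- The map `B ↦ ∑ (-D)^α B_α`. -/
def eps : Sym n A →ₗ[ℝ] A := lift (fun i => (-1 : ℝ) • dEnd D i) LinearMap.id

/-- The operator `a D^α ↦ D^{α+e_i} ∘ a - D^α ∘ D_i a` on symbols in divergence form. -/
def divShift (i : Fin n) : Module.End ℝ (Sym n A) := shift i + (-1 : ℝ) • coef (dEnd D i)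

/-- Rewriting `∑ B_α D^α` as `∑ D^α ∘ b_α`. -/
def toDiv : Module.End ℝ (Sym n A) :=
  lift (fun i => divShift D i) (Finsupp.lsingle 0)

/-- The expression `∑ D^α (B_α v)`. -/
def coact (v : A) : Sym n A →ₗ[ℝ] A := lift (dEnd D) (LinearMap.mulRight ℝ v)

/-- The expression `∑ B_α D^α v`. -/
def act (v : A) : Sym n A →ₗ[A] A := Finsupp.linearCombination A fun α => tpow D α v

lemma act_single (v : A) (α : Fin n → ℕ) (a : A) :
    act D v (Finsupp.single α a) = a * tpow D α v := by
  simp [act]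

variable {D}

lemma comp_smul (i : Fin n) (a : A) (B : Sym n A) :
    comp D i (a • B) = D i a • B + a • comp D i B := by
  induction B using Finsupp.induction_linear with
  | zero => simp
  | add B C hB hC => simp only [smul_add, map_add, hB, hC]; abel
  | single γ b =>
    simp only [comp, LinearMap.add_apply, Finsupp.smul_single, shift_single, coef_single,
      smul_add, smul_eq_mul, Derivation.coeFn_coe, Derivation.leibniz, Finsupp.single_add]
    rw [mul_comm b]
    abel

variable (hD : ∀ i j, Commute (dEnd D i) (dEnd D j))

lemma tpow_add_single (hD : ∀ i j, Commute (dEnd D i) (dEnd D j)) (α : Fin n → ℕ) (i : Fin n)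
    (a : A) : tpow D (α + Pi.single i 1) a = D i (tpow D α a) := by
  rw [tpow, npow_add_single hD]
  rfl

lemma commute_comp_shift (i j : Fin n) : Commute (comp D i) (shift j) :=
  (commute_shift i j).add_left (commute_shift_coef j _).symm

include hD

lemma commute_comp_coef (i j : Fin n) : Commute (comp D i) (coef (dEnd D j)) :=
  (commute_shift_coef i _).add_left (commute_coef (hD i j))

lemma commute_comp (i j : Fin n) : Commute (comp D i) (comp D j) :=
  (commute_comp_shift i j).add_right (commute_comp_coef hD i j)

lemma star_shift (i : Fin n) (B : Sym n A) : star D (shift i B) = -comp D i (star D B) :=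
  (lift_shift (fun i j => commute_neg (commute_neg (commute_comp hD i j).symm).symm) _ i B).trans
    (by simp [star])

lemma star_coef (i : Fin n) (B : Sym n A) :
    star D (coef (dEnd D i) B) = coef (dEnd D i) (star D B) :=
  lift_coef (fun j => (commute_neg (commute_comp_coef hD j i)).symm)
    (fun a => by simp [coef_single]) B

/-- (D_i ∘ B)* = -B* ∘ D_i, and composition with D_i on the right only shifts exponents: the
derivatives of the coefficients cancel. -/
lemma star_comp (i : Fin n) (B : Sym n A) : star D (comp D i B) = -shift i (star D B) := by
  conv_lhs => rw [comp]
  rw [LinearMap.add_apply, map_add, star_shift hD, star_coef hD, comp, LinearMap.add_apply]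
  abel

lemma eps_shift (i : Fin n) (B : Sym n A) : eps D (shift i B) = -D i (eps D B) :=
  (lift_shift (fun i j => commute_neg (commute_neg (hD i j).symm).symm) _ i B).trans (by simp [eps])

omit hD in
lemma eps_coef {S : Module.End ℝ A} (hS : ∀ i, Commute S (dEnd D i)) (B : Sym n A) :
    eps D (coef S B) = S (eps D B) :=
  lift_coef (fun j => (commute_neg (hS j).symm).symm) (j := LinearMap.id) (fun _ => rfl) B

/-- `eps B` is B* applied to 1, and (D_i ∘ B)* = -B* ∘ D_i kills 1. This is why variational
derivatives annihilate divergences. -/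
lemma eps_comp (i : Fin n) (B : Sym n A) : eps D (comp D i B) = 0 := by
  rw [comp, LinearMap.add_apply, map_add, eps_shift hD, eps_coef (hD i)]
  simp

lemma eps_smul_comp (i : Fin n) (a : A) (B : Sym n A) :
    eps D (a • comp D i B) = -eps D (D i a • B) := by
  have := eps_comp hD i (a • B)
  rw [comp_smul, map_add] at this
  linear_combination this

lemma eps_single (α : Fin n → ℕ) (a : A) :
    eps D (Finsupp.single α a) = (-1 : ℝ) ^ len α • tpow D α a := by
  rw [eps, lift_single, npow_neg hD]
  simp

/-- Modulo operators D_i ∘ C, which `eps` kills, the operator a D^γ ∘ B equals ((-D)^γ a) B. -/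
lemma eps_smul_npow_comp (a : A) (γ : Fin n → ℕ) (B : Sym n A) :
    eps D (a • npow (comp D) γ B) = eps D (eps D (Finsupp.single γ a) • B) := by
  induction γ using multiIndex_induction generalizing a with
  | h0 => simp [npow_zero, eps, lift_single]
  | hs γ i ih =>
    rw [npow_add_single (commute_comp hD), Module.End.mul_apply, eps_smul_comp hD, ih,
      ← shift_single, eps_shift hD]
    have := eps_coef (hD i) (Finsupp.single γ a)
    rw [coef_single] at this
    simp only [Derivation.coeFn_coe] at this
    rw [this, neg_smul, map_neg]

omit hD in
lemma npow_shift_single (α γ : Fin n → ℕ) (a : A) :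
    npow shift γ (Finsupp.single α a) = Finsupp.single (α + γ) a := by
  induction γ using multiIndex_induction with
  | h0 => simp [npow_zero]
  | hs γ i ih =>
    rw [npow_add_single commute_shift, Module.End.mul_apply, ih, shift_single, add_assoc]

/-- The linearizations of a variational derivative are adjoint to each other. -/
lemma star_sum (S T : Finset (Fin n → ℕ)) (H : (Fin n → ℕ) → (Fin n → ℕ) → A) :
    star D (∑ γ ∈ S, npow (fun i => (-1 : ℝ) • comp D i) γ (∑ α ∈ T, Finsupp.single α (H γ α))) =
      ∑ α ∈ T, npow (fun i => (-1 : ℝ) • comp D i) α (∑ γ ∈ S, Finsupp.single γ (H γ α)) := by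
  have hc : ∀ γ i, Commute ((-1 : ℝ) • comp D i) (npow shift γ) := fun γ i =>
    commute_npow (fun j => commute_neg (commute_comp_shift i j)) γ
  simp only [map_sum]
  rw [Finset.sum_comm]
  refine Finset.sum_congr rfl fun α _ => Finset.sum_congr rfl fun γ _ => ?_
  -- `star` turns left composition with -D_i into a shift, and left composition commutes with
  -- shifts; both sides are therefore (-D)^α ∘ H ∘ D^γ.
  rw [map_npow (T' := shift) (star D) (fun i x => by simp [star_comp hD]), star, lift_single]
  rw [← Module.End.mul_apply, (commute_npow (fun i => (hc γ i).symm) α).eq, Module.End.mul_apply]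
  rw [Finsupp.lsingle_apply, npow_shift_single, zero_add]

/-- The Leibniz rule for D^γ ∘ a, by Pascal's rule. The truncated difference γ - α does no harm,
because the binomial coefficient vanishes unless α ≤ γ. -/
lemma npow_comp_single_apply (γ α : Fin n → ℕ) (a : A) :
    npow (comp D) γ (Finsupp.single 0 a) α = (multiChoose γ α : ℝ) • tpow D (γ - α) a := by
  induction γ using multiIndex_induction generalizing α with
  | h0 =>
    rw [npow_zero]
    by_cases h : α = 0
    · subst h; simp [npow_zero, multiChoose_zero_right]
    · rw [multiChoose_eq_zero (by rwa [nonpos_iff_eq_zero])]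
      simp [Ne.symm h]
  | hs γ i ih =>
    have step : ∀ β, β ≤ γ → D i (tpow D (γ - β) a) = tpow D (γ + Pi.single i 1 - β) a := by
      intro β hβ
      rw [← tsub_add_eq_add_tsub hβ, tpow_add_single hD]
    have step' : ∀ β, D i ((multiChoose γ β : ℝ) • tpow D (γ - β) a) =
        (multiChoose γ β : ℝ) • tpow D (γ + Pi.single i 1 - β) a := by
      intro β
      by_cases hβ : β ≤ γ
      · rw [Derivation.map_smul, step β hβ]
      · simp [multiChoose_eq_zero hβ]
    rw [npow_add_single (commute_comp hD), Module.End.mul_apply]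
    change shift i (npow (comp D) γ _) α + D i (npow (comp D) γ _ α) = _
    rw [ih, step']
    by_cases hα : α i = 0
    · rw [shift_apply_of_eq_zero _ _ _ hα, multiChoose_add_single_of_eq_zero _ _ _ hα, zero_add]
    · obtain ⟨β, rfl⟩ := exists_eq_add_single hα
      rw [shift_apply_add, ih, multiChoose_add_single, Nat.cast_add, add_smul,
        add_tsub_add_eq_tsub_right]

lemma star_apply (B : Sym n A) (α : Fin n → ℕ) :
    star D B α = B.sum fun γ a => (-1 : ℝ) ^ len γ • (multiChoose γ α : ℝ) • tpow D (γ - α) a := by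
  rw [star, lift, Finsupp.lsum_apply, Finsupp.sum, Finsupp.sum, Finsupp.finsetSum_apply]
  refine Finset.sum_congr rfl fun γ _ => ?_
  rw [LinearMap.comp_apply, npow_neg (commute_comp hD), LinearMap.smul_apply, Finsupp.smul_apply,
    Finsupp.lsingle_apply, npow_comp_single_apply hD]

/-- Substitute γ = α + β; exponents γ that are not above α have a zero binomial coefficient. The
bound `r` frees the range of β from the support of `B`, which is the shape of (3). -/
lemma star_apply_of_bounded {B : Sym n A} {r : ℕ} (hB : ∀ γ, r < len γ → B γ = 0)
    {α : Fin n → ℕ} (hα : len α ≤ r) :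
    star D B α = ∑ β ∈ multiIndices n (r - len α),
      (-1 : ℝ) ^ (len α + len β) • (multiChoose (α + β) β : ℝ) • tpow D β (B (α + β)) := by
  rw [star_apply hD]
  symm
  have hinj : Function.Injective (fun β : Fin n → ℕ => α + β) := add_right_injective α
  rw [Finsupp.sum_of_support_subset (s := multiIndices n r) _ _ _ (by simp)]
  · symm
    rw [← Finset.sum_subset (s₁ := (multiIndices n (r - len α)).map ⟨_, hinj⟩)]
    · rw [Finset.sum_map]
      refine Finset.sum_congr rfl fun β _ => ?_
      simp only [Function.Embedding.coeFn_mk]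
      rw [len_add, multiChoose_symm_add, add_tsub_cancel_left]
    · intro γ hγ
      obtain ⟨β, hβ, rfl⟩ := Finset.mem_map.1 hγ
      rw [mem_multiIndices] at hβ ⊢
      simp only [Function.Embedding.coeFn_mk, len_add]
      omega
    · intro γ hγ hγ'
      rw [mem_multiIndices] at hγ
      have : ¬ α ≤ γ := by
        intro hle
        refine hγ' (Finset.mem_map.2 ⟨γ - α, ?_, add_tsub_cancel_of_le hle⟩)
        have : len γ = len α + len (γ - α) := by
          rw [← len_add, add_tsub_cancel_of_le hle]
        rw [mem_multiIndices]
        omega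
      rw [multiChoose_eq_zero this]
      simp
  · intro γ hγ
    rw [mem_multiIndices]
    by_contra h
    exact (Finsupp.mem_support_iff.1 hγ) (hB γ (by omega))

lemma coact_shift (v : A) (i : Fin n) (B : Sym n A) :
    coact D v (shift i B) = D i (coact D v B) :=
  lift_shift hD _ i B

lemma act_comp (v : A) (i : Fin n) (B : Sym n A) : act D v (comp D i B) = D i (act D v B) := by
  induction B using Finsupp.induction_linear with
  | zero => simp
  | add B C hB hC => simp only [map_add, hB, hC]
  | single γ b =>
    simp only [comp, LinearMap.add_apply, shift_single, coef_single, map_add, act_single,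
      Derivation.coeFn_coe, Derivation.leibniz, smul_eq_mul]
    rw [tpow_add_single hD]
    ring

lemma coact_eq_act (v : A) (B : Sym n A) :
    coact D v B = act D v (lift (comp D) (Finsupp.lsingle 0) B) := by
  induction B using Finsupp.induction_linear with
  | zero => simp
  | add B C hB hC => simp only [map_add, hB, hC]
  | single γ b =>
    rw [coact, lift_single, lift_single]
    have := map_npow (T' := dEnd D) ((act D v).restrictScalars ℝ : Sym n A →ₗ[ℝ] A)
      (T := comp D) (fun i x => act_comp hD v i x) γ (Finsupp.single 0 b)
    simp only [LinearMap.restrictScalars_apply] at this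
    rw [Finsupp.lsingle_apply, this, act_single, tpow, npow_zero]
    rfl

lemma coact_divShift (v : A) (i : Fin n) (B : Sym n A) :
    coact D v ((divShift D i) B) = coact D (D i v) B := by
  induction B using Finsupp.induction_linear with
  | zero => simp
  | add B C hB hC => simp only [map_add, hB, hC]
  | single γ b =>
    simp only [divShift, LinearMap.add_apply, LinearMap.smul_apply, map_add, map_smul, shift_single,
      coef_single, coact, lift_single, LinearMap.mulRight_apply, Derivation.coeFn_coe]
    rw [npow_add_single hD, (commute_npow (hD i) γ).eq, Module.End.mul_apply, ← map_smul, ← map_add,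
      Derivation.coeFn_coe, Derivation.leibniz]
    congr 1
    simp only [smul_eq_mul, neg_smul, one_smul]
    ring

omit hD in
lemma divShift_apply (i : Fin n) (B : Sym n A) :
    divShift D i B = shift i B - coef (dEnd D i) B := by
  rw [divShift, LinearMap.add_apply, LinearMap.smul_apply, neg_one_smul, sub_eq_add_neg]

lemma commute_divShift_coef (i j : Fin n) : Commute (divShift D i) (coef (dEnd D j)) :=
  (commute_shift_coef i _).add_left (commute_neg (commute_coef (hD i j)))

lemma commute_divShift (i j : Fin n) : Commute (divShift D i) (divShift D j) :=
  ((commute_shift i j).add_left (commute_neg (commute_shift_coef j _).symm)).add_right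
    (commute_neg (commute_divShift_coef hD i j).symm).symm

/-- All coefficients are moved to the right of the derivatives with a D_i = D_i ∘ a - (D_i a), which
is the rule behind `divShift`. -/
lemma act_eq_coact (v : A) (B : Sym n A) : act D v B = coact D v (toDiv D B) := by
  induction B using Finsupp.induction_linear with
  | zero => simp
  | add B C hB hC => simp only [map_add, hB, hC]
  | single γ b =>
    rw [toDiv, lift_single, act_single, Finsupp.lsingle_apply]
    induction γ using multiIndex_induction generalizing v with
    | h0 => simp [npow_zero, coact, lift_single]
    | hs γ i ih =>
      rw [npow_add_single (commute_divShift hD), Module.End.mul_apply,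
        coact_divShift hD, ← ih, tpow, npow_add_single hD, (commute_npow (hD i) γ).eq]
      rfl

/-- With the coefficients on the right, composing with D_i on the left is multiplication of
polynomials in the D_i. This is what makes the Koszul complex applicable. -/
lemma toDiv_comp (i : Fin n) (B : Sym n A) : toDiv D (comp D i B) = shift i (toDiv D B) := by
  have h1 : toDiv D (shift i B) = (divShift D i) (toDiv D B) :=
    lift_shift (commute_divShift hD) _ i B
  have h2 : toDiv D (coef (dEnd D i) B) = coef (dEnd D i) (toDiv D B) :=
    lift_coef (fun j => (commute_divShift_coef hD j i).symm) (fun a => by simp [coef_single]) B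
  rw [comp, LinearMap.add_apply, map_add, h1, h2, divShift_apply, sub_add_cancel]

omit hD in
-- A shift has no constant term, so on constant terms `divShift` acts as -D_i, the operator from
-- which `eps` is built.
lemma toDiv_apply_zero (B : Sym n A) : toDiv D B 0 = eps D B := by
  induction B using Finsupp.induction_linear with
  | zero => simp
  | add B C hB hC => simp only [map_add, Finsupp.add_apply, hB, hC]
  | single γ b =>
    rw [toDiv, lift_single, eps, lift_single]
    have := map_npow (T' := fun i => (-1 : ℝ) • dEnd D i)
      (T := divShift D) (Finsupp.lapply 0 : Sym n A →ₗ[ℝ] A)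
      (fun i x => by
        simp only [Finsupp.lapply_apply, divShift_apply, Finsupp.sub_apply, coef_apply]
        rw [shift_apply_of_eq_zero i x 0 rfl]
        simp) γ (Finsupp.single 0 b)
    rw [Finsupp.lapply_apply] at this
    rw [Finsupp.lsingle_apply, this]
    simp

end Operators

/-! ### Splitting off divergences; the Koszul complex -/

section Divergence

variable {n : ℕ} {A : Type*} [CommRing A] [Algebra ℝ A]

/-- The weighted division of a symbol without constant term by `D_i`. -/
def divPart (i : Fin n) : Module.End ℝ (Sym n A) :=
  Finsupp.lsum ℝ fun γ => ((γ i : ℝ) / len γ) • Finsupp.lsingle (γ - Pi.single i 1)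

lemma divPart_single (i : Fin n) (γ : Fin n → ℕ) (a : A) :
    divPart i (Finsupp.single γ a) =
      ((γ i : ℝ) / len γ) • Finsupp.single (γ - Pi.single i 1) a := by
  simp [divPart]

/-- The formal partial derivative with respect to `D_i`. -/
def dsym (i : Fin n) : Module.End ℝ (Sym n A) :=
  Finsupp.lsum ℝ fun γ => (γ i : ℝ) • Finsupp.lsingle (γ - Pi.single i 1)

lemma dsym_single (i : Fin n) (γ : Fin n → ℕ) (a : A) :
    dsym i (Finsupp.single γ a) = (γ i : ℝ) • Finsupp.single (γ - Pi.single i 1) a := by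
  simp [dsym]

/-- Division of the component of degree `d` by `d + k`. -/
def degInv (k : ℕ) : Module.End ℝ (Sym n A) :=
  Finsupp.lsum ℝ fun γ => ((len γ + k : ℝ)⁻¹) • Finsupp.lsingle γ

lemma degInv_single (k : ℕ) (γ : Fin n → ℕ) (a : A) :
    degInv k (Finsupp.single γ a) = ((len γ + k : ℝ)⁻¹) • Finsupp.single γ a := by
  simp [degInv]

lemma smul_single_sub_add (i : Fin n) (γ : Fin n → ℕ) (a : A) :
    (γ i : ℝ) • Finsupp.single (γ - Pi.single i 1 + Pi.single i 1) a =
      (γ i : ℝ) • Finsupp.single γ a := by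
  by_cases h : γ i = 0
  · simp [h]
  · rw [tsub_add_cancel_of_le]
    intro j
    by_cases hj : j = i
    · subst hj; simp; omega
    · simp [hj]

/-- The weights γ_i/|γ| add up to one for γ ≠ 0. For γ = 0 they are 0/0 = 0, and the constant term
is left over. -/
lemma sum_shift_divPart (B : Sym n A) :
    ∑ i, shift i (divPart i B) = B - Finsupp.single 0 (B 0) := by
  induction B using Finsupp.induction_linear with
  | zero => simp
  | add B C hB hC =>
    simp only [map_add, Finset.sum_add_distrib, hB, hC, Finsupp.add_apply, Finsupp.single_add]
    abel
  | single γ a =>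
    have : ∀ i, shift i (divPart i (Finsupp.single γ a)) =
        ((γ i : ℝ) / len γ) • Finsupp.single γ a := by
      intro i
      rw [divPart_single, map_smul, shift_single, div_eq_inv_mul, mul_smul, mul_smul,
        smul_single_sub_add]
    rw [Finset.sum_congr rfl fun i _ => this i, ← Finset.sum_smul, ← Finset.sum_div]
    have hl : (∑ i, (γ i : ℝ)) = len γ := by simp [len]
    rw [hl]
    by_cases h : γ = 0
    · subst h; simp [len_zero]
    · have : (len γ : ℝ) ≠ 0 := by exact_mod_cast fun h' => h (len_eq_zero.1 h')
      rw [div_self this, one_smul, Finsupp.single_eq_of_ne' h]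
      simp

lemma shift_degInv (k : ℕ) (i : Fin n) (B : Sym n A) :
    shift i (degInv (k + 1) B) = degInv k (shift i B) := by
  induction B using Finsupp.induction_linear with
  | zero => simp
  | add B C hB hC => simp only [map_add, hB, hC]
  | single γ a =>
    rw [degInv_single, map_smul, shift_single, degInv_single, len_add, len_single]
    congr 2
    push_cast
    ring

/-- Euler's identity: Σ D_i ∂/∂D_i multiplies the component of degree d by d. -/
lemma degInv_sum (B : Sym n A) : degInv 1 (∑ i, shift i (dsym i B) + B) = B := by
  induction B using Finsupp.induction_linear with
  | zero => simp
  | add B C hB hC =>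
    simp only [map_add, Finset.sum_add_distrib] at hB hC ⊢
    rw [add_add_add_comm, hB, hC]
  | single γ a =>
    have : ∀ i, shift i (dsym i (Finsupp.single γ a)) = (γ i : ℝ) • Finsupp.single γ a := by
      intro i
      rw [dsym_single, map_smul, shift_single, smul_single_sub_add]
    rw [Finset.sum_congr rfl fun i _ => this i, ← Finset.sum_smul]
    have hl : (∑ i, (γ i : ℝ)) = len γ := by simp [len]
    have hp : (len γ + 1 : ℝ) ≠ 0 := by positivity
    rw [hl, ← one_smul ℝ (Finsupp.single γ a), smul_smul, ← add_smul, map_smul, degInv_single,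
      Nat.cast_one, mul_one, smul_smul,
      mul_inv_cancel₀ hp, one_smul]

lemma dsym_shift (i j : Fin n) (B : Sym n A) :
    dsym i (shift j B) = shift j (dsym i B) + if i = j then B else 0 := by
  induction B using Finsupp.induction_linear with
  | zero => simp
  | add B C hB hC =>
    simp only [map_add, hB, hC]
    split_ifs <;> abel
  | single γ a =>
    rw [shift_single, dsym_single, dsym_single, map_smul, shift_single]
    by_cases h : i = j
    · subst h
      rw [smul_single_sub_add]
      simp [add_smul]
    · have e : γ + Pi.single j 1 - Pi.single i 1 = γ - Pi.single i 1 + Pi.single j 1 := by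
        ext l
        simp only [Pi.add_apply, Pi.sub_apply]
        by_cases hi : l = i
        · subst hi; simp [h]
        · simp [hi]
      simp [h, e]

/-- Exactness of the Koszul complex in degree one. -/
lemma exists_antisymm_of_sum_shift_eq_zero (P : Fin n → Sym n A)
    (hP : ∑ i, shift i (P i) = 0) :
    ∃ S : Fin n → Fin n → Sym n A, (∀ i j, S i j = -S j i) ∧
      ∀ i, P i = ∑ j, shift j (S i j) := by
  -- The contracting homotopy of the Koszul complex. A shift turns `degInv 2` into `degInv 1`, and
  -- ∂/∂D_i of the relation `hP` evaluates the second term to the extra P_i that Euler's identity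
  -- needs.
  refine ⟨fun i j => degInv 2 (dsym j (P i) - dsym i (P j)), fun i j => ?_, fun i => ?_⟩
  · rw [← map_neg, neg_sub]
  · have h := congrArg (dsym i) hP
    simp only [map_sum, map_zero, dsym_shift, Finset.sum_add_distrib, Finset.sum_ite_eq,
      Finset.mem_univ, if_true] at h
    simp only [shift_degInv 1, map_sub]
    rw [Finset.sum_sub_distrib, ← map_sum, ← map_sum, ← map_sub]
    rw [eq_neg_of_add_eq_zero_left h, sub_neg_eq_add, degInv_sum]

variable {D : Fin n → Derivation ℝ A A} (hD : ∀ i j, Commute (dEnd D i) (dEnd D j))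
include hD

/-- Integration by parts. -/
lemma act_eq_eps_mul_add (v : A) (B : Sym n A) :
    act D v B = eps D B * v + ∑ i, D i (coact D v (divPart i (toDiv D B))) := by
  have h := sum_shift_divPart (toDiv D B)
  rw [eq_sub_iff_add_eq, toDiv_apply_zero] at h
  rw [act_eq_coact hD]
  conv_lhs => rw [← h]
  rw [map_add, map_sum, add_comm]
  congr 1
  · simp [coact, lift_single, npow_zero]
  · exact Finset.sum_congr rfl fun i _ => coact_shift hD v i _

end Divergence

end Sym

end CK

end

/-! ### Smooth dependence of integrals on parameters -/

open scoped ContDiff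

noncomputable section

namespace CK

section ParametricIntegral

open Topology Set MeasureTheory Interval

variable {E : Type} [NormedAddCommGroup E] [NormedSpace ℝ E]
  {G : Type} [NormedAddCommGroup G] [NormedSpace ℝ G]

/-- The parameters whose whole segment lies in `V`. -/
def tube (V : Set (E × ℝ)) : Set E := {y | ∀ l ∈ Icc (0 : ℝ) 1, (y, l) ∈ V}

omit [NormedSpace ℝ E] in
lemma isOpen_tube {V : Set (E × ℝ)} (hV : IsOpen V) : IsOpen (tube V) :=
  isOpen_iff_mem_nhds.2 fun _ hy =>
    isCompact_Icc.eventually_forall_of_forall_eventually fun l hl => hV.mem_nhds (hy l hl)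

omit [NormedSpace ℝ E] [NormedSpace ℝ G] in
lemma continuousOn_slice {V : Set (E × ℝ)} {H : E × ℝ → G} (hH : ContinuousOn H V) {y : E}
    (hy : y ∈ tube V) : ContinuousOn (fun l => H (y, l)) (Icc 0 1) :=
  hH.comp (by fun_prop) fun l hl => hy l hl

omit [NormedSpace ℝ E] [NormedSpace ℝ G] in
lemma intervalIntegrable_slice {V : Set (E × ℝ)} {H : E × ℝ → G} (hH : ContinuousOn H V) {y : E}
    (hy : y ∈ tube V) : IntervalIntegrable (fun l => H (y, l)) volume 0 1 := by
  refine ContinuousOn.intervalIntegrable ?_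
  rw [uIcc_of_le zero_le_one]
  exact continuousOn_slice hH hy

omit [NormedSpace ℝ E] [NormedSpace ℝ G] in
lemma aestronglyMeasurable_slice {V : Set (E × ℝ)} {H : E × ℝ → G} (hH : ContinuousOn H V) {y : E}
    (hy : y ∈ tube V) :
    AEStronglyMeasurable (fun l => H (y, l)) (volume.restrict (Ι (0 : ℝ) 1)) :=
  (intervalIntegrable_iff.1 (intervalIntegrable_slice hH hy)).aestronglyMeasurable

omit [NormedSpace ℝ E] [NormedSpace ℝ G] in
-- Compactness of the interval gives a bound uniform in l near y; it is the dominating constant for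
-- continuity of, and differentiation under, the integral.
lemma exists_bound_slice {V : Set (E × ℝ)} (hV : IsOpen V) {H : E × ℝ → G}
    (hH : ContinuousOn H V) {y : E} (hy : y ∈ tube V) :
    ∃ C : ℝ, ∀ᶠ x in 𝓝 y, ∀ l ∈ Icc (0 : ℝ) 1, ‖H (x, l)‖ ≤ C := by
  obtain ⟨C, hC⟩ := isCompact_Icc.exists_bound_of_continuousOn (continuousOn_slice hH hy)
  refine ⟨C + 1, isCompact_Icc.eventually_forall_of_forall_eventually fun l hl => ?_⟩
  have hc : ContinuousAt (fun p => ‖H p‖) (y, l) :=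
    (hH.continuousAt (hV.mem_nhds (hy l hl))).norm
  filter_upwards [hc.eventually_lt_const (lt_of_le_of_lt (hC l hl) (lt_add_one C))] with p hp
  exact hp.le

lemma continuousOn_integral_slice {V : Set (E × ℝ)} (hV : IsOpen V) {H : E × ℝ → G}
    (hH : ContinuousOn H V) : ContinuousOn (fun y => ∫ l in (0 : ℝ)..1, H (y, l)) (tube V) := by
  intro y hy
  refine ContinuousAt.continuousWithinAt ?_
  obtain ⟨C, hC⟩ := exists_bound_slice hV hH hy
  refine intervalIntegral.continuousAt_of_dominated_interval (bound := fun _ => C) ?_ ?_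
    intervalIntegrable_const ?_
  · filter_upwards [(isOpen_tube hV).mem_nhds hy] with x hx using aestronglyMeasurable_slice hH hx
  · filter_upwards [hC] with x hx
    refine Filter.Eventually.of_forall fun l hl => hx l ?_
    rw [uIoc_of_le zero_le_one] at hl
    exact Ioc_subset_Icc_self hl
  · refine Filter.Eventually.of_forall fun l hl => ?_
    rw [uIoc_of_le zero_le_one] at hl
    exact (hH.continuousAt (hV.mem_nhds (hy l (Ioc_subset_Icc_self hl)))).comp
      (f := fun x => (x, l)) (by fun_prop)

lemma hasFDerivAt_integral_slice {V : Set (E × ℝ)} (hV : IsOpen V) {H : E × ℝ → G}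
    (hH : ContDiffOn ℝ 1 H V) {y : E} (hy : y ∈ tube V) :
    HasFDerivAt (fun y => ∫ l in (0 : ℝ)..1, H (y, l))
      (∫ l in (0 : ℝ)..1, (fderiv ℝ H (y, l)).comp (ContinuousLinearMap.inl ℝ E ℝ)) y := by
  have hH' : ContinuousOn (fun p => (fderiv ℝ H p).comp (ContinuousLinearMap.inl ℝ E ℝ)) V :=
    (hH.continuousOn_fderiv_of_isOpen hV le_rfl).clm_comp continuousOn_const
  obtain ⟨C, hC⟩ := exists_bound_slice hV hH' hy
  have hs : {x | x ∈ tube V ∧ ∀ l ∈ Icc (0 : ℝ) 1,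
      ‖(fderiv ℝ H (x, l)).comp (ContinuousLinearMap.inl ℝ E ℝ)‖ ≤ C} ∈ 𝓝 y :=
    Filter.inter_mem ((isOpen_tube hV).mem_nhds hy) hC
  refine intervalIntegral.hasFDerivAt_integral_of_dominated_of_fderiv_le
    (F := fun x l => H (x, l))
    (F' := fun x l => (fderiv ℝ H (x, l)).comp (ContinuousLinearMap.inl ℝ E ℝ))
    (bound := fun _ => C) hs ?_ (intervalIntegrable_slice hH.continuousOn hy)
    (aestronglyMeasurable_slice hH' hy) ?_ intervalIntegrable_const ?_
  · filter_upwards [hs] with x hx using aestronglyMeasurable_slice hH.continuousOn hx.1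
  · refine Filter.Eventually.of_forall fun l hl x hx => hx.2 l ?_
    rw [uIoc_of_le zero_le_one] at hl
    exact Ioc_subset_Icc_self hl
  · refine Filter.Eventually.of_forall fun l hl x hx => ?_
    rw [uIoc_of_le zero_le_one] at hl
    have h1 : HasFDerivAt H (fderiv ℝ H (x, l)) (x, l) :=
      ((hH.contDiffAt (hV.mem_nhds (hx.1 l (Ioc_subset_Icc_self hl)))).differentiableAt
        one_ne_zero).hasFDerivAt
    exact h1.comp x (hasFDerivAt_prodMk_left x l)

/-- Induction on the order of smoothness: the derivative is an integral of the same kind with values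
in `E →L[ℝ] G`, so `G` has to vary in the induction. -/
lemma contDiffOn_integral_slice_nat (n : ℕ) :
    ∀ {G : Type} [NormedAddCommGroup G] [NormedSpace ℝ G] {V : Set (E × ℝ)} (_ : IsOpen V)
      {H : E × ℝ → G} (_ : ContDiffOn ℝ n H V),
      ContDiffOn ℝ n (fun y => ∫ l in (0 : ℝ)..1, H (y, l)) (tube V) := by
  induction n with
  | zero =>
    intro G _ _ V hV H hH
    simp only [Nat.cast_zero, contDiffOn_zero] at hH ⊢
    exact continuousOn_integral_slice hV hH
  | succ n ih =>
    intro G _ _ V hV H hH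
    have h1 : ContDiffOn ℝ 1 H V := hH.of_le (by exact_mod_cast Nat.le_add_left 1 n)
    have hd := fun y hy => hasFDerivAt_integral_slice hV h1 (y := y) hy
    push_cast at hH ⊢
    rw [contDiffOn_succ_iff_fderiv_of_isOpen (isOpen_tube hV)]
    refine ⟨fun y hy => (hd y hy).differentiableAt.differentiableWithinAt, by simp, ?_⟩
    have h2 : ContDiffOn ℝ n
        (fun p => (fderiv ℝ H p).comp (ContinuousLinearMap.inl ℝ E ℝ)) V :=
      (((contDiffOn_succ_iff_fderiv_of_isOpen hV).1 hH).2.2).clm_comp contDiffOn_const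
    exact (ih hV h2).congr fun y hy => (hd y hy).fderiv

lemma contDiffOn_integral_slice {V : Set (E × ℝ)} (hV : IsOpen V) {H : E × ℝ → G}
    (hH : ContDiffOn ℝ ∞ H V) :
    ContDiffOn ℝ ∞ (fun y => ∫ l in (0 : ℝ)..1, H (y, l)) (tube V) :=
  contDiffOn_infty.2 fun n => contDiffOn_integral_slice_nat n hV (contDiffOn_infty.1 hH n)

end ParametricIntegral

end CK

end

/-! ### The algebra of smooth functions of finitely many coordinates -/

open scoped ContDiff

noncomputable section

namespace CK

open Topology TopologicalSpace

section Cyl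

variable {J : Type} {Ω : Opens (J → ℝ)}

/-- On `Ω`, the function `f` is given by the smooth function `F` of the coordinates in `S`. -/
def IsCyl (f : Ω → ℝ) (S : Finset J) (F : (S → ℝ) → ℝ) : Prop :=
  ∀ z : Ω, ContDiffAt ℝ ∞ F (S.restrict z.1) ∧ f z = F (S.restrict z.1)

lemma contDiff_restrict₂ {S T : Finset J} (h : S ⊆ T) :
    ContDiff ℝ ∞ (Finset.restrict₂ (π := fun _ : J => ℝ) h) :=
  contDiff_pi.2 fun i => contDiff_apply ℝ ℝ (⟨i.1, h i.2⟩ : T)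

lemma IsCyl.mono {f : Ω → ℝ} {S T : Finset J} {F : (S → ℝ) → ℝ} (hf : IsCyl f S F) (h : S ⊆ T) :
    IsCyl f T (F ∘ Finset.restrict₂ (π := fun _ => ℝ) h) := fun z =>
  ⟨ContDiffAt.comp _ (hf z).1 (contDiff_restrict₂ h).contDiffAt, (hf z).2⟩

variable (Ω) in
/-- The algebra of smooth functions of finitely many coordinates. -/
def cylAlg : Subalgebra ℝ (Ω → ℝ) where
  carrier := {f | ∃ S F, IsCyl f S F}
  mul_mem' := by
    classical
    rintro f g ⟨S, F, hF⟩ ⟨T, G, hG⟩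
    refine ⟨S ∪ T, _, fun z => ⟨((hF.mono Finset.subset_union_left z).1).mul
      ((hG.mono Finset.subset_union_right z).1), ?_⟩⟩
    rw [Pi.mul_apply, (hF z).2, (hG z).2]
    rfl
  add_mem' := by
    classical
    rintro f g ⟨S, F, hF⟩ ⟨T, G, hG⟩
    refine ⟨S ∪ T, _, fun z => ⟨((hF.mono Finset.subset_union_left z).1).add
      ((hG.mono Finset.subset_union_right z).1), ?_⟩⟩
    rw [Pi.add_apply, (hF z).2, (hG z).2]
    rfl
  algebraMap_mem' r := ⟨∅, fun _ => r, fun _ => ⟨contDiffAt_const, rfl⟩⟩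

variable (Ω) in
/-- Smooth functions of finitely many coordinates on `Ω`. -/
def CylFun : Type := cylAlg Ω

namespace CylFun

instance : CommRing (CylFun Ω) := inferInstanceAs (CommRing (cylAlg Ω))

instance : Algebra ℝ (CylFun Ω) := inferInstanceAs (Algebra ℝ (cylAlg Ω))

/-- The underlying function. -/
def val (f : CylFun Ω) : Ω → ℝ := Subtype.val (p := (· ∈ cylAlg Ω)) f

instance : CoeFun (CylFun Ω) fun _ => Ω → ℝ := ⟨val⟩

lemma add_apply (f g : CylFun Ω) (z : Ω) : (f + g) z = f z + g z := rfl

lemma mul_apply (f g : CylFun Ω) (z : Ω) : (f * g) z = f z * g z := rfl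

lemma neg_apply (f : CylFun Ω) (z : Ω) : (-f) z = -f z := rfl

lemma sub_apply (f g : CylFun Ω) (z : Ω) : (f - g) z = f z - g z := rfl

lemma smul_apply (c : ℝ) (f : CylFun Ω) (z : Ω) : (c • f) z = c * f z := rfl

lemma zero_apply (z : Ω) : (0 : CylFun Ω) z = 0 := rfl

lemma one_apply (z : Ω) : (1 : CylFun Ω) z = 1 := rfl

/-- Evaluation at a point. -/
def eval (z : Ω) : CylFun Ω →ₐ[ℝ] ℝ where
  toFun f := f z
  map_one' := rfl
  map_mul' _ _ := rfl
  map_zero' := rfl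
  map_add' _ _ := rfl
  commutes' _ := rfl

lemma sum_apply {ι : Type*} (s : Finset ι) (f : ι → CylFun Ω) (z : Ω) :
    (∑ i ∈ s, f i) z = ∑ i ∈ s, f i z := map_sum (eval z) f s

lemma ext {f g : CylFun Ω} (h : ∀ z, f z = g z) : f = g := Subtype.ext (funext h)

lemma isCyl (f : CylFun Ω) : ∃ S F, IsCyl f.val S F := f.2

/-- Extension by zero. -/
def toFun (f : CylFun Ω) (z : J → ℝ) : ℝ := by
  classical exact if h : z ∈ Ω then f ⟨z, h⟩ else 0

lemma toFun_apply (f : CylFun Ω) (z : Ω) : f.toFun z.1 = f z := by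
  simp [toFun]

lemma toFun_of_mem (f : CylFun Ω) {z : J → ℝ} (hz : z ∈ Ω) : f.toFun z = f ⟨z, hz⟩ := by
  simp [toFun, hz]

/-- The chain rule in the finitely many coordinates that matter: only those in `S` need to be
differentiable along the path. -/
lemma hasDerivAt_path {f : CylFun Ω} {S : Finset J} {F : (S → ℝ) → ℝ} (hf : IsCyl f.val S F)
    {γ : ℝ → J → ℝ} {s : ℝ} {z : Ω} (hs : γ s = z.1) (hΩ : ∀ᶠ r in 𝓝 s, γ r ∈ Ω) {ξ : J → ℝ}
    (hγ : ∀ k ∈ S, HasDerivAt (fun r => γ r k) (ξ k) s) :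
    HasDerivAt (fun r => f.toFun (γ r)) (fderiv ℝ F (S.restrict z.1) (S.restrict ξ)) s := by
  have h1 : HasDerivAt (fun r => S.restrict (γ r)) (S.restrict ξ) s :=
    hasDerivAt_pi.2 fun i => hγ i.1 i.2
  have h2 : HasFDerivAt F (fderiv ℝ F (S.restrict z.1)) (S.restrict (γ s)) := by
    rw [hs]
    exact ((hf z).1.differentiableAt (by simp)).hasFDerivAt
  refine (h2.comp_hasDerivAt s h1).congr_of_eventuallyEq ?_
  filter_upwards [hΩ] with r hr
  rw [toFun_of_mem f hr]
  exact (hf _).2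

variable [DecidableEq J]

lemma eventually_update_mem (z : Ω) (j : J) :
    ∀ᶠ r in 𝓝 (z.1 j), Function.update z.1 j r ∈ Ω := by
  have hc : ContinuousAt (fun r => Function.update z.1 j r) (z.1 j) :=
    (continuous_const.update j continuous_id).continuousAt
  refine hc.eventually_mem (Ω.isOpen.mem_nhds ?_)
  rw [Function.update_eq_self]
  exact z.2

/-- The partial derivative, as a function. -/
def pdVal (j : J) (f : CylFun Ω) (z : Ω) : ℝ :=
  deriv (fun s => f.toFun (Function.update z.1 j s)) (z.1 j)

lemma hasDerivAt_update {f : CylFun Ω} {S : Finset J} {F : (S → ℝ) → ℝ} (hf : IsCyl f.val S F)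
    (j : J) (z : Ω) :
    HasDerivAt (fun s => f.toFun (Function.update z.1 j s))
      (fderiv ℝ F (S.restrict z.1) (S.restrict (Pi.single j 1 : J → ℝ))) (z.1 j) := by
  refine hasDerivAt_path hf (by simp) (eventually_update_mem z j) fun k _ => ?_
  by_cases hk : k = j
  · subst hk
    simpa using hasDerivAt_id' (z.1 k)
  · simpa [hk] using hasDerivAt_const (z.1 j) (z.1 k)

lemma pdVal_eq {f : CylFun Ω} {S : Finset J} {F : (S → ℝ) → ℝ} (hf : IsCyl f.val S F)
    (j : J) (z : Ω) :
    pdVal j f z = fderiv ℝ F (S.restrict z.1) (S.restrict (Pi.single j 1 : J → ℝ)) :=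
  (hasDerivAt_update hf j z).deriv

lemma isCyl_pdVal {f : CylFun Ω} {S : Finset J} {F : (S → ℝ) → ℝ} (hf : IsCyl f.val S F) (j : J) :
    IsCyl (pdVal j f) S fun y => fderiv ℝ F y (S.restrict (Pi.single j 1 : J → ℝ)) := fun z =>
  ⟨((hf z).1.fderiv_right (m := ∞) (by simp)).clm_apply contDiffAt_const, pdVal_eq hf j z⟩

/-- The partial derivative with respect to the coordinate `j`. -/
def pd (j : J) (f : CylFun Ω) : CylFun Ω :=
  ⟨pdVal j f, by obtain ⟨S, F, hF⟩ := f.isCyl; exact ⟨S, _, isCyl_pdVal hF j⟩⟩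

lemma pd_apply {f : CylFun Ω} {S : Finset J} {F : (S → ℝ) → ℝ} (hf : IsCyl f.val S F)
    (j : J) (z : Ω) :
    pd j f z = fderiv ℝ F (S.restrict z.1) (S.restrict (Pi.single j 1 : J → ℝ)) :=
  pdVal_eq hf j z

lemma hasDerivAt_pd (f : CylFun Ω) (j : J) (z : Ω) :
    HasDerivAt (fun s => f.toFun (Function.update z.1 j s)) (pd j f z) (z.1 j) := by
  obtain ⟨S, F, hF⟩ := f.isCyl
  rw [pd_apply hF]
  exact hasDerivAt_update hF j z

lemma pd_eq_zero {f : CylFun Ω} {S : Finset J} {F : (S → ℝ) → ℝ} (hf : IsCyl f.val S F)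
    {j : J} (hj : j ∉ S) : pd j f = 0 := by
  refine ext fun z => ?_
  rw [pd_apply hf]
  have : S.restrict (Pi.single j 1 : J → ℝ) = 0 := by
    funext k
    have : k.1 ≠ j := fun h => hj (h ▸ k.2)
    simp [this]
  rw [this, map_zero]
  rfl

lemma fderiv_restrict {f : CylFun Ω} {S : Finset J} {F : (S → ℝ) → ℝ} (hf : IsCyl f.val S F)
    (z : Ω) (ξ : J → ℝ) :
    fderiv ℝ F (S.restrict z.1) (S.restrict ξ) = ∑ j ∈ S, pd j f z * ξ j := by
  have : S.restrict ξ = ∑ j ∈ S, ξ j • S.restrict (Pi.single j 1 : J → ℝ) := by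
    funext k
    simp [Finset.sum_apply, Pi.single_apply]
  rw [this, map_sum]
  refine Finset.sum_congr rfl fun j _ => ?_
  rw [map_smul, pd_apply hf, smul_eq_mul, mul_comm]

lemma pd_add (j : J) (f g : CylFun Ω) : pd j (f + g) = pd j f + pd j g := by
  refine ext fun z => (hasDerivAt_pd (f + g) j z).unique ?_
  refine ((hasDerivAt_pd f j z).add (hasDerivAt_pd g j z)).congr_of_eventuallyEq ?_
  filter_upwards [eventually_update_mem z j] with r hr
  simp only [Pi.add_apply, toFun_of_mem _ hr]
  rfl

lemma pd_mul (j : J) (f g : CylFun Ω) : pd j (f * g) = f * pd j g + g * pd j f := by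
  refine ext fun z => (hasDerivAt_pd (f * g) j z).unique ?_
  have := (hasDerivAt_pd f j z).mul (hasDerivAt_pd g j z)
  rw [Function.update_eq_self, toFun_apply, toFun_apply] at this
  have e : pd j f z * g z + f z * pd j g z = (f * pd j g + g * pd j f : CylFun Ω) z := by
    change _ = f z * pd j g z + g z * pd j f z
    ring
  rw [e] at this
  refine this.congr_of_eventuallyEq ?_
  filter_upwards [eventually_update_mem z j] with r hr
  simp only [Pi.mul_apply, toFun_of_mem _ hr]
  rfl

lemma pd_smul (j : J) (c : ℝ) (f : CylFun Ω) : pd j (c • f) = c • pd j f := by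
  refine ext fun z => (hasDerivAt_pd (c • f) j z).unique ?_
  refine ((hasDerivAt_pd f j z).const_mul c).congr_of_eventuallyEq ?_
  filter_upwards [eventually_update_mem z j] with r hr
  simp only [toFun_of_mem _ hr]
  rfl

lemma exists_finset_pd (f : CylFun Ω) : ∃ S : Finset J, ∀ j ∉ S, pd j f = 0 := by
  obtain ⟨S, F, hF⟩ := f.isCyl
  exact ⟨S, fun j hj => pd_eq_zero hF hj⟩

/-- The differential, as a linear map. -/
def gradLin : CylFun Ω →ₗ[ℝ] (J →₀ CylFun Ω) where
  toFun f := Finsupp.ofSupportFinite (fun j => pd j f) (by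
    obtain ⟨S, hS⟩ := f.exists_finset_pd
    refine S.finite_toSet.subset fun j hj => ?_
    by_contra h
    exact hj (hS j h))
  map_add' f g := Finsupp.ext fun j => by
    simp only [Finsupp.ofSupportFinite_coe, Finsupp.add_apply, pd_add]
  map_smul' c f := Finsupp.ext fun j => by
    simp only [Finsupp.ofSupportFinite_coe, Finsupp.smul_apply, pd_smul, RingHom.id_apply]

lemma gradLin_apply (f : CylFun Ω) (j : J) : gradLin f j = pd j f := rfl

/-- The differential. -/
def grad : Derivation ℝ (CylFun Ω) (J →₀ CylFun Ω) :=
  Derivation.mk' gradLin fun f g => Finsupp.ext fun j => by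
    simp only [gradLin_apply, Finsupp.add_apply, Finsupp.smul_apply, pd_mul, smul_eq_mul]

lemma grad_apply (f : CylFun Ω) (j : J) : grad f j = pd j f := rfl

/-- The derivation `∑ V_j ∂_j`. -/
def vf (V : J → CylFun Ω) : Derivation ℝ (CylFun Ω) (CylFun Ω) :=
  (Finsupp.linearCombination (CylFun Ω) V).compDer grad

lemma vf_apply (V : J → CylFun Ω) (f : CylFun Ω) :
    vf V f = (grad f).sum fun j a => a * V j := rfl

lemma vf_eq_sum (V : J → CylFun Ω) {f : CylFun Ω} {S : Finset J} (hS : ∀ j ∉ S, pd j f = 0) :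
    vf V f = ∑ j ∈ S, pd j f * V j := by
  rw [vf_apply]
  refine Finsupp.sum_of_support_subset _ (fun j hj => ?_) _ (by simp)
  by_contra h
  exact (Finsupp.mem_support_iff.1 hj) (hS j h)

variable (Ω) in
/-- The coordinate functions. -/
def coord (j : J) : CylFun Ω :=
  ⟨fun z => z.1 j, {j}, fun y => y ⟨j, Finset.mem_singleton_self j⟩, fun _ =>
    ⟨(contDiff_apply ℝ ℝ _).contDiffAt, rfl⟩⟩

lemma pd_coord (k j : J) : pd k (coord Ω j) = if k = j then 1 else 0 := by
  refine ext fun z => (hasDerivAt_pd (coord Ω j) k z).unique ?_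
  have : HasDerivAt (fun s => Function.update z.1 k s j) (if k = j then 1 else 0) (z.1 k) := by
    by_cases h : k = j
    · subst h
      simpa using hasDerivAt_id' (z.1 k)
    · simpa [h, Function.update_of_ne (Ne.symm h)] using hasDerivAt_const (z.1 k) (z.1 j)
  have e : ((if k = j then 1 else 0 : CylFun Ω) z) = if k = j then (1 : ℝ) else 0 := by
    split_ifs <;> rfl
  rw [e]
  refine this.congr_of_eventuallyEq ?_
  filter_upwards [eventually_update_mem z k] with r hr
  rw [toFun_of_mem _ hr]
  rfl

lemma vf_coord (V : J → CylFun Ω) (j : J) : vf V (coord Ω j) = V j := by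
  rw [vf_eq_sum V (S := {j}) fun k hk => by
    rw [pd_coord, if_neg (by simpa using hk)]]
  simp [pd_coord]

lemma vf_single (j : J) (f : CylFun Ω) : vf (Pi.single j 1) f = pd j f := by
  obtain ⟨S, hS⟩ := f.exists_finset_pd
  rw [vf_eq_sum _ (S := insert j S) fun k hk => hS k fun h => hk (Finset.mem_insert_of_mem h)]
  simp [Pi.single_apply]

lemma pd_comm (j k : J) (f : CylFun Ω) : pd j (pd k f) = pd k (pd j f) := by
  obtain ⟨S, F, hF⟩ := f.isCyl
  refine ext fun z => ?_
  rw [pd_apply (f := pd k f) (isCyl_pdVal hF k), pd_apply (f := pd j f) (isCyl_pdVal hF j)]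
  have hd : DifferentiableAt ℝ (fderiv ℝ F) (S.restrict z.1) :=
    ((hF z).1.fderiv_right (m := 1) (by norm_cast)).differentiableAt one_ne_zero
  have key : ∀ v w, fderiv ℝ (fun y => fderiv ℝ F y v) (S.restrict z.1) w =
      fderiv ℝ (fderiv ℝ F) (S.restrict z.1) w v := by
    intro v w
    rw [fderiv_clm_apply hd (differentiableAt_const v)]
    simp
  rw [key, key]
  exact ((hF z).1.isSymmSndFDerivAt (by
    have : ((2 : ℕ∞) : WithTop ℕ∞) ≤ ((⊤ : ℕ∞) : WithTop ℕ∞) := WithTop.coe_le_coe.2 le_top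
    simpa using this)).eq _ _

lemma pd_zero (j : J) : pd j (0 : CylFun Ω) = 0 := by
  rw [← grad_apply, map_zero]
  rfl

/-- The commutator of two derivations of the form `∑ V_j ∂_j`. -/
lemma vf_vf_sub (V W : J → CylFun Ω) (f : CylFun Ω) :
    vf V (vf W f) - vf W (vf V f) = vf (fun j => vf V (W j) - vf W (V j)) f := by
  obtain ⟨S, hS⟩ := f.exists_finset_pd
  have hS' : ∀ k, ∀ j ∉ S, pd j (pd k f) = 0 := fun k j hj => by
    rw [pd_comm, hS j hj, pd_zero]
  have key : ∀ V W : J → CylFun Ω, vf V (vf W f) =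
      ∑ k ∈ S, pd k f * vf V (W k) + ∑ k ∈ S, ∑ j ∈ S, pd j (pd k f) * V j * W k := by
    intro V W
    rw [vf_eq_sum W hS, map_sum, ← Finset.sum_add_distrib]
    refine Finset.sum_congr rfl fun k _ => ?_
    rw [Derivation.leibniz, vf_eq_sum V (hS' k), smul_eq_mul, smul_eq_mul, Finset.mul_sum]
    congr 1
    exact Finset.sum_congr rfl fun j _ => by ring
  rw [key V W, key W V, vf_eq_sum _ hS]
  rw [Finset.sum_comm (s := S) (t := S) (f := fun k j => pd j (pd k f) * W j * V k)]
  have : ∑ k ∈ S, ∑ j ∈ S, pd k (pd j f) * W k * V j =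
      ∑ k ∈ S, ∑ j ∈ S, pd j (pd k f) * V j * W k :=
    Finset.sum_congr rfl fun k _ => Finset.sum_congr rfl fun j _ => by rw [pd_comm]; ring
  rw [this, add_sub_add_right_eq_sub, ← Finset.sum_sub_distrib]
  exact Finset.sum_congr rfl fun k _ => by ring

/-- The commutator of two such derivations has the components V(W_j) - W(V_j), so it suffices to
commute on coordinates. This yields [D_i, D_j] = 0 and [𝒟_t, D_i] = 0. -/
lemma vf_comm {V W : J → CylFun Ω} (h : ∀ j, vf V (W j) = vf W (V j)) (f : CylFun Ω) :
    vf V (vf W f) = vf W (vf V f) := by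
  rw [← sub_eq_zero, vf_vf_sub, vf_apply]
  simp [h]

omit [DecidableEq J] in
lemma exists_finset_isCyl {ι : Type*} (s : Finset ι) (φ : ι → CylFun Ω) :
    ∃ T : Finset J, ∀ i ∈ s, ∃ G, IsCyl (φ i).val T G := by
  classical
  induction s using Finset.induction_on with
  | empty => exact ⟨∅, by simp⟩
  | insert a s _ ih =>
    obtain ⟨T, hT⟩ := ih
    obtain ⟨S, F, hF⟩ := (φ a).isCyl
    refine ⟨S ∪ T, fun i hi => ?_⟩
    rcases Finset.mem_insert.1 hi with rfl | hi
    · exact ⟨_, hF.mono Finset.subset_union_left⟩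
    · obtain ⟨G, hG⟩ := hT i hi
      exact ⟨_, hG.mono Finset.subset_union_right⟩

section Pull

variable {J' : Type} [DecidableEq J'] {Ω' : Opens (J' → ℝ)}
  (φ : J' → CylFun Ω) (hφ : ∀ z : Ω, (fun k => φ k z) ∈ Ω')

omit [DecidableEq J] [DecidableEq J'] in
-- Only finitely many of the components `φ k` enter `f`, and each depends on finitely many
-- coordinates.
lemma exists_isCyl_comp {S : Finset J'} {F : (S → ℝ) → ℝ} {f : CylFun Ω'}
    (hf : IsCyl f.val S F) :
    ∃ (T : Finset J) (G : S → (T → ℝ) → ℝ), (∀ k : S, IsCyl (φ k).val T (G k)) ∧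
      IsCyl (fun z => f ⟨fun k => φ k z, hφ z⟩) T (fun y => F fun k => G k y) := by
  obtain ⟨T, hT⟩ := exists_finset_isCyl S φ
  choose G hG using fun k : S => hT k.1 k.2
  refine ⟨T, G, hG, fun z => ?_⟩
  have e : (fun k => G k (T.restrict z.1)) = S.restrict fun k => φ k z :=
    funext fun k => ((hG k z).2).symm
  refine ⟨?_, ?_⟩
  · refine ContDiffAt.comp (T.restrict z.1) (g := F) (f := fun y k => G k y) ?_
      (contDiffAt_pi.2 fun k => (hG k z).1)
    rw [e]
    exact (hf ⟨_, hφ z⟩).1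
  · change f ⟨fun k => φ k z, hφ z⟩ = F fun k => G k (T.restrict z.1)
    rw [e]
    exact (hf ⟨_, hφ z⟩).2

/-- Pullback along a map with components `φ`. -/
def pull : CylFun Ω' →ₐ[ℝ] CylFun Ω where
  toFun f := ⟨fun z => f ⟨fun k => φ k z, hφ z⟩, by
    obtain ⟨S, F, hF⟩ := f.isCyl
    obtain ⟨T, G, -, h⟩ := exists_isCyl_comp φ hφ hF
    exact ⟨T, _, h⟩⟩
  map_one' := rfl
  map_mul' _ _ := rfl
  map_zero' := rfl
  map_add' _ _ := rfl
  commutes' _ := rfl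

omit [DecidableEq J] [DecidableEq J'] in
lemma pull_apply (f : CylFun Ω') (z : Ω) : pull φ hφ f z = f ⟨fun k => φ k z, hφ z⟩ := rfl

omit [DecidableEq J] [DecidableEq J'] in
lemma pull_coord (k : J') : pull φ hφ (coord Ω' k) = φ k := rfl

lemma pd_pull_eq_sum (j : J) {f : CylFun Ω'} {S : Finset J'} (hS : ∀ k ∉ S, pd k f = 0) :
    pd j (pull φ hφ f) = ∑ k ∈ S, pull φ hφ (pd k f) * pd j (φ k) := by
  obtain ⟨S', F, hF⟩ := f.isCyl
  have key : pd j (pull φ hφ f) = ∑ k ∈ S', pull φ hφ (pd k f) * pd j (φ k) := by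
    refine ext fun z => (hasDerivAt_pd (pull φ hφ f) j z).unique ?_
    have h := hasDerivAt_path hF (γ := fun r k => (φ k).toFun (Function.update z.1 j r))
      (s := z.1 j) (z := ⟨fun k => φ k z, hφ z⟩) (ξ := fun k => pd j (φ k) z)
      (by simp only [Function.update_eq_self, toFun_apply])
      (by
        filter_upwards [eventually_update_mem z j] with r hr
        have := hφ ⟨_, hr⟩
        simpa only [← toFun_of_mem _ hr] using this)
      (fun k _ => hasDerivAt_pd (φ k) j z)
    rw [fderiv_restrict hF] at h
    have e : (∑ k ∈ S', pull φ hφ (pd k f) * pd j (φ k) : CylFun Ω) z =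
        ∑ k ∈ S', pd k f ⟨fun k => φ k z, hφ z⟩ * pd j (φ k) z := by
      simp [sum_apply, mul_apply, pull_apply]
    rw [e]
    refine h.congr_of_eventuallyEq ?_
    filter_upwards [eventually_update_mem z j] with r hr
    have hm := hφ ⟨_, hr⟩
    rw [toFun_of_mem _ hr, pull_apply, ← toFun_of_mem f hm]
    simp only [← toFun_of_mem _ hr]
  rw [key]
  have h1 : ∀ k ∉ S', pd k f = 0 := fun k hk => pd_eq_zero hF hk
  -- The sum so far runs over the coordinates of one representative. Passing through the union
  -- allows any finite set outside which the partial derivatives vanish.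
  rw [Finset.sum_subset (Finset.subset_union_left (s₂ := S)) fun k _ hk => by simp [h1 k hk],
    ← Finset.sum_subset (Finset.subset_union_right (s₁ := S')) fun k _ hk => by simp [hS k hk]]

lemma vf_pull_eq_sum (V : J → CylFun Ω) {f : CylFun Ω'} {S : Finset J'}
    (hS : ∀ k ∉ S, pd k f = 0) :
    vf V (pull φ hφ f) = ∑ k ∈ S, pull φ hφ (pd k f) * vf V (φ k) := by
  have : ∃ T : Finset J, (∀ j ∉ T, pd j (pull φ hφ f) = 0) ∧
      ∀ k ∈ S, ∀ j ∉ T, pd j (φ k) = 0 := by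
    obtain ⟨T, hT⟩ := exists_finset_isCyl S φ
    have h2 : ∀ k ∈ S, ∀ j ∉ T, pd j (φ k) = 0 := fun k hk j hj => by
      obtain ⟨G, hG⟩ := hT k hk
      exact pd_eq_zero hG hj
    refine ⟨T, fun j hj => ?_, h2⟩
    rw [pd_pull_eq_sum φ hφ j hS]
    exact Finset.sum_eq_zero fun k hk => by rw [h2 k hk j hj, mul_zero]
  obtain ⟨T, h1, h2⟩ := this
  rw [vf_eq_sum V h1]
  simp only [pd_pull_eq_sum φ hφ _ hS, Finset.sum_mul]
  rw [Finset.sum_comm]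
  refine Finset.sum_congr rfl fun k hk => ?_
  rw [vf_eq_sum V (h2 k hk), Finset.mul_sum]
  exact Finset.sum_congr rfl fun j _ => by ring

/-- Related derivations. -/
lemma vf_pull {V : J → CylFun Ω} {W : J' → CylFun Ω'}
    (h : ∀ k, vf V (φ k) = pull φ hφ (W k)) (f : CylFun Ω') :
    vf V (pull φ hφ f) = pull φ hφ (vf W f) := by
  obtain ⟨S, hS⟩ := f.exists_finset_pd
  rw [vf_pull_eq_sum φ hφ V hS, vf_eq_sum W hS, map_sum]
  exact Finset.sum_congr rfl fun k _ => by rw [h, map_mul]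

end Pull

end CylFun

end Cyl

end CK

end

/-! ### Weighted homotopy operators -/

open scoped ContDiff

noncomputable section

namespace CK

open Topology TopologicalSpace Set MeasureTheory

section Homotopy

variable {J : Type} {Ω : Opens (J → ℝ)}

namespace CylFun

/-- Freezing the remaining coordinates at a given point shows that the restriction map is open;
representatives therefore live on open sets. -/
lemma isOpen_restrict_image (Ω : Opens (J → ℝ)) (S : Finset J) :
    IsOpen ((fun z : J → ℝ => S.restrict z) '' (Ω : Set (J → ℝ))) := by
  classical
  rw [isOpen_iff_mem_nhds]
  rintro _ ⟨z, hz, rfl⟩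
  let c : (S → ℝ) → J → ℝ := fun y j => if h : j ∈ S then y ⟨j, h⟩ else z j
  have hc : Continuous c := continuous_pi fun j => by
    by_cases h : j ∈ S
    · simpa [c, h] using continuous_apply (⟨j, h⟩ : S)
    · simpa [c, h] using continuous_const
  have hz' : c (S.restrict z) = z := by
    funext j
    by_cases h : j ∈ S <;> simp [c, h]
  have := hc.continuousAt.eventually_mem (x := S.restrict z)
    (Ω.isOpen.mem_nhds (by rw [hz']; exact hz))
  filter_upwards [this] with y hy
  refine ⟨c y, hy, ?_⟩
  funext j
  simp [c]

lemma continuousAt_toFun (f : CylFun Ω) (z : Ω) : ContinuousAt f.toFun z.1 := by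
  obtain ⟨S, F, hF⟩ := f.isCyl
  have h1 : ContinuousAt (fun y : J → ℝ => F (S.restrict y)) z.1 :=
    ((hF z).1.continuousAt).comp (f := fun y : J → ℝ => S.restrict y)
      (continuous_pi fun k => continuous_apply k.1).continuousAt
  refine h1.congr ?_
  filter_upwards [Ω.isOpen.mem_nhds z.2] with y hy
  rw [toFun_of_mem f hy]
  exact ((hF ⟨y, hy⟩).2).symm

/-- The point `z` with the additional coordinate `l`. -/
def consPt (l : ℝ) (z : J → ℝ) : Option J → ℝ := fun o => o.elim l z

/-- The coordinates of `consPt l z` in terms of those of `z` and `l`. -/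
def slot (S : Finset (Option J)) : (o : S) → ((S.eraseNone → ℝ) × ℝ) →L[ℝ] ℝ
  | ⟨none, _⟩ => ContinuousLinearMap.snd ℝ _ _
  | ⟨some j, h⟩ => (ContinuousLinearMap.proj (R := ℝ) (φ := fun _ : S.eraseNone => ℝ)
      ⟨j, Finset.mem_eraseNone.2 h⟩).comp (ContinuousLinearMap.fst ℝ _ _)

lemma pi_slot_apply (S : Finset (Option J)) (z : J → ℝ) (l : ℝ) :
    ContinuousLinearMap.pi (slot S) (S.eraseNone.restrict z, l) = S.restrict (consPt l z) := by
  funext o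
  rcases o with ⟨_ | j, h⟩ <;> rfl

variable {Ωh : Opens (Option J → ℝ)}
  (hI : ∀ z : Ω, ∀ l ∈ Icc (0 : ℝ) 1, consPt l z.1 ∈ Ωh)

/-- The integral over the additional coordinate, as a function. -/
def integVal (f : CylFun Ωh) (z : Ω) : ℝ := ∫ l in (0 : ℝ)..1, f.toFun (consPt l z.1)

/-- The set on which the integrand is smooth. -/
def integSet (Ωh : Opens (Option J → ℝ)) (S : Finset (Option J)) :
    Set ((S.eraseNone → ℝ) × ℝ) :=
  ContinuousLinearMap.pi (slot S) ⁻¹' ((fun z => S.restrict z) '' (Ωh : Set (Option J → ℝ)))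

lemma isOpen_integSet (S : Finset (Option J)) : IsOpen (integSet Ωh S) :=
  (isOpen_restrict_image Ωh S).preimage (ContinuousLinearMap.continuous _)

include hI in
lemma mem_tube (S : Finset (Option J)) (z : Ω) :
    S.eraseNone.restrict z.1 ∈ tube (integSet Ωh S) := fun l hl =>
  ⟨consPt l z.1, hI z l hl, (pi_slot_apply S z.1 l).symm⟩

lemma contDiffOn_integrand {f : CylFun Ωh} {S : Finset (Option J)} {F : (S → ℝ) → ℝ}
    (hf : IsCyl f.val S F) :
    ContDiffOn ℝ ∞ (fun p => F (ContinuousLinearMap.pi (slot S) p)) (integSet Ωh S) := by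
  intro p hp
  obtain ⟨y, hy, hyp⟩ := hp
  refine ContDiffAt.contDiffWithinAt ?_
  refine ContDiffAt.comp p (g := F) ?_ (ContinuousLinearMap.contDiff _).contDiffAt
  simp only at hyp
  rw [← hyp]
  exact (hf ⟨y, hy⟩).1

include hI in
lemma toFun_consPt {f : CylFun Ωh} {S : Finset (Option J)} {F : (S → ℝ) → ℝ}
    (hf : IsCyl f.val S F) (z : Ω) {l : ℝ} (hl : l ∈ Icc (0 : ℝ) 1) :
    f.toFun (consPt l z.1) =
      F (ContinuousLinearMap.pi (slot S) (S.eraseNone.restrict z.1, l)) := by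
  rw [pi_slot_apply, toFun_of_mem f (hI z l hl)]
  exact (hf _).2

include hI in
lemma isCyl_integVal {f : CylFun Ωh} {S : Finset (Option J)} {F : (S → ℝ) → ℝ}
    (hf : IsCyl f.val S F) :
    IsCyl (Ω := Ω) (integVal f) S.eraseNone
      (fun y => ∫ l in (0 : ℝ)..1, F (ContinuousLinearMap.pi (slot S) (y, l))) := by
  intro z
  refine ⟨?_, ?_⟩
  · exact (contDiffOn_integral_slice (isOpen_integSet S) (contDiffOn_integrand hf)).contDiffAt
      ((isOpen_tube (isOpen_integSet S)).mem_nhds (mem_tube hI S z))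
  · refine intervalIntegral.integral_congr fun l hl => ?_
    rw [uIcc_of_le zero_le_one] at hl
    exact toFun_consPt hI hf z hl

include hI in
lemma intervalIntegrable_consPt (f : CylFun Ωh) (z : Ω) :
    IntervalIntegrable (fun l => f.toFun (consPt l z.1)) volume 0 1 := by
  obtain ⟨S, F, hF⟩ := f.isCyl
  refine (intervalIntegrable_slice (contDiffOn_integrand hF).continuousOn
    (mem_tube hI S z)).congr fun l hl => ?_
  rw [uIoc_of_le zero_le_one] at hl
  exact (toFun_consPt hI hF z (Ioc_subset_Icc_self hl)).symm

/-- The integral over the additional coordinate. -/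
def integ : CylFun Ωh →ₗ[ℝ] CylFun Ω where
  toFun f := ⟨integVal f, by
    obtain ⟨S, F, hF⟩ := f.isCyl
    exact ⟨_, _, isCyl_integVal hI hF⟩⟩
  map_add' f g := ext fun z => by
    change integVal (f + g) z = integVal f z + integVal g z
    unfold integVal
    rw [← intervalIntegral.integral_add (intervalIntegrable_consPt hI f z)
      (intervalIntegrable_consPt hI g z)]
    refine intervalIntegral.integral_congr fun l hl => ?_
    rw [uIcc_of_le zero_le_one] at hl
    simp only [toFun_of_mem _ (hI z l hl), add_apply]
  map_smul' c f := ext fun z => by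
    change integVal (c • f) z = c * integVal f z
    unfold integVal
    rw [← intervalIntegral.integral_const_mul]
    refine intervalIntegral.integral_congr fun l hl => ?_
    rw [uIcc_of_le zero_le_one] at hl
    simp only [toFun_of_mem _ (hI z l hl), smul_apply]

lemma integ_apply (f : CylFun Ωh) (z : Ω) :
    integ hI f z = ∫ l in (0 : ℝ)..1, f.toFun (consPt l z.1) := rfl

variable [DecidableEq J]

lemma pd_integ (j : J) (f : CylFun Ωh) : pd j (integ hI f) = integ hI (pd (some j) f) := by
  obtain ⟨S, F, hF⟩ := f.isCyl
  refine ext fun z => ?_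
  have h1 : ContDiffOn ℝ 1 (fun p => F (ContinuousLinearMap.pi (slot S) p)) (integSet Ωh S) :=
    (contDiffOn_integrand hF).of_le (by exact_mod_cast le_top)
  have hH' : ContinuousOn (fun p => (fderiv ℝ (fun p => F (ContinuousLinearMap.pi (slot S) p)) p).comp
      (ContinuousLinearMap.inl ℝ (S.eraseNone → ℝ) ℝ)) (integSet Ωh S) :=
    (h1.continuousOn_fderiv_of_isOpen (isOpen_integSet S) le_rfl).clm_comp continuousOn_const
  rw [pd_apply (f := integ hI f) (isCyl_integVal hI hF),
    (hasFDerivAt_integral_slice (isOpen_integSet S) h1 (mem_tube hI S z)).fderiv,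
    ContinuousLinearMap.intervalIntegral_apply (intervalIntegrable_slice hH' (mem_tube hI S z)),
    integ_apply]
  refine intervalIntegral.integral_congr fun l hl => ?_
  rw [uIcc_of_le zero_le_one] at hl
  have hd : DifferentiableAt ℝ F (ContinuousLinearMap.pi (slot S) (S.eraseNone.restrict z.1, l)) := by
    rw [pi_slot_apply]
    exact (hF ⟨_, hI z l hl⟩).1.differentiableAt (by simp)
  have hc := hd.hasFDerivAt.comp (S.eraseNone.restrict z.1, l)
    (ContinuousLinearMap.hasFDerivAt (ContinuousLinearMap.pi (slot S)))
  simp only [ContinuousLinearMap.comp_apply, ContinuousLinearMap.inl_apply]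
  rw [toFun_of_mem _ (hI z l hl), pd_apply hF]
  have hc' : fderiv ℝ (fun p => F (ContinuousLinearMap.pi (slot S) p))
      (S.eraseNone.restrict z.1, l) = _ := hc.fderiv
  rw [hc', ContinuousLinearMap.comp_apply, pi_slot_apply, pi_slot_apply]
  congr 2
  funext o
  rcases o with ⟨_ | k, h⟩
  · simp [consPt]
  · simp [consPt, Pi.single_apply]

lemma integ_pd_none (f : CylFun Ωh) (z : Ω) :
    integ hI (pd none f) z = f.toFun (consPt 1 z.1) - f.toFun (consPt 0 z.1) := by
  rw [integ_apply]
  refine intervalIntegral.integral_eq_sub_of_hasDerivAt (f := fun l => f.toFun (consPt l z.1))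
    (fun l hl => ?_) (intervalIntegrable_consPt hI (pd none f) z)
  rw [uIcc_of_le zero_le_one] at hl
  have := hasDerivAt_pd f none ⟨_, hI z l hl⟩
  rw [toFun_of_mem _ (hI z l hl)]
  refine this.congr_of_eventuallyEq (Filter.Eventually.of_forall fun s => ?_)
  refine congrArg f.toFun (funext fun o => ?_)
  rcases o with _ | k <;> simp [consPt]

/-- A center for a linear homotopy on `Ω`. -/
structure Center (Ω : Opens (J → ℝ)) where
  /-- the coordinates of the center -/
  w : J → CylFun Ω
  /-- the segment to the center stays in the domain -/
  segment : ∀ z : Ω, ∀ l ∈ Icc (0 : ℝ) 1, (fun k => l * z.1 k + (1 - l) * w k z) ∈ Ω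

namespace Center

variable (C : Center Ω)

/-- The domain of the homotopy. -/
def dom : Opens (Option J → ℝ) where
  -- The parameter is not confined to [0, 1], since the set has to be open; the conditions are what
  -- the pullbacks `proj` and `hom` need to be defined.
  carrier := {y | (fun k => y (some k)) ∈ Ω ∧
    (fun k => y none * y (some k) + (1 - y none) * (C.w k).toFun fun k => y (some k)) ∈ Ω}
  is_open' := by
    rw [isOpen_iff_mem_nhds]
    rintro y ⟨h1, h2⟩
    have hc : Continuous fun y : Option J → ℝ => fun k => y (some k) :=
      continuous_pi fun k => continuous_apply _
    refine Filter.inter_mem (hc.continuousAt.eventually_mem (Ω.isOpen.mem_nhds h1)) ?_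
    refine ContinuousAt.eventually_mem (f := fun y : Option J → ℝ => fun k =>
      y none * y (some k) + (1 - y none) * (C.w k).toFun fun k => y (some k)) ?_
      (Ω.isOpen.mem_nhds h2)
    refine continuousAt_pi.2 fun k => ?_
    have hw : ContinuousAt (fun y : Option J → ℝ => (C.w k).toFun fun k => y (some k)) y :=
      ContinuousAt.comp (f := fun y : Option J → ℝ => fun k => y (some k)) (g := (C.w k).toFun)
        (continuousAt_toFun (C.w k) ⟨_, h1⟩) hc.continuousAt
    have h0 : ContinuousAt (fun y : Option J → ℝ => y none) y := (continuous_apply _).continuousAt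
    have hk : ContinuousAt (fun y : Option J → ℝ => y (some k)) y :=
      (continuous_apply _).continuousAt
    exact (h0.mul hk).add ((continuousAt_const.sub h0).mul hw)

omit [DecidableEq J] in
lemma consPt_mem (z : Ω) (l : ℝ) (hl : l ∈ Icc (0 : ℝ) 1) : consPt l z.1 ∈ C.dom := by
  refine ⟨z.2, ?_⟩
  have := C.segment z l hl
  simp only [← toFun_apply] at this
  exact this

omit [DecidableEq J] in
lemma proj_mem (z : C.dom) : (fun k => coord C.dom (some k) z) ∈ Ω := z.2.1

/-- Functions on `Ω` as functions on the domain of the homotopy. -/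
def proj : CylFun Ω →ₐ[ℝ] CylFun C.dom :=
  pull (fun k => coord C.dom (some k)) C.proj_mem

/-- The homotopy parameter. -/
def par : CylFun C.dom := coord C.dom none

/-- The components of the homotopy. -/
def comp (k : J) : CylFun C.dom := C.par * C.proj (coord Ω k) + (1 - C.par) * C.proj (C.w k)

omit [DecidableEq J] in
lemma comp_mem (z : C.dom) : (fun k => C.comp k z) ∈ Ω := by
  have := z.2.2
  simp only [toFun_of_mem _ z.2.1] at this
  exact this

/-- The pullback along the homotopy. -/
def hom : CylFun Ω →ₐ[ℝ] CylFun C.dom := pull C.comp C.comp_mem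

omit [DecidableEq J] in
lemma center_mem (z : Ω) : (fun k => C.w k z) ∈ Ω := by
  have := C.segment z 0 (by simp)
  simpa using this

/-- The integral over the additional coordinate. -/
abbrev int : CylFun C.dom →ₗ[ℝ] CylFun Ω := integ C.consPt_mem

/-- The weighted homotopy operator. -/
def hop (p : ℕ) : CylFun Ω →ₗ[ℝ] CylFun Ω :=
  C.int.comp ((LinearMap.mulLeft ℝ (C.par ^ p)).comp C.hom.toLinearMap)

omit [DecidableEq J] in
lemma hop_apply (p : ℕ) (f : CylFun Ω) : C.hop p f = C.int (C.par ^ p * C.hom f) := rfl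

omit [DecidableEq J] in
lemma int_proj_mul (a : CylFun Ω) (f : CylFun C.dom) : C.int (C.proj a * f) = a * C.int f := by
  refine ext fun z => ?_
  rw [mul_apply, integ_apply, integ_apply, ← intervalIntegral.integral_const_mul]
  refine intervalIntegral.integral_congr fun l hl => ?_
  rw [uIcc_of_le zero_le_one] at hl
  simp only [toFun_of_mem _ (C.consPt_mem z l hl), mul_apply]
  rfl

/-- The lift of a family of components to the domain of the homotopy. -/
def liftVf (V : J → CylFun Ω) : Option J → CylFun C.dom := fun o => o.elim 0 fun k => C.proj (V k)

lemma vf_liftVf_proj (V : J → CylFun Ω) (f : CylFun Ω) :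
    vf (C.liftVf V) (C.proj f) = C.proj (vf V f) :=
  vf_pull _ _ (fun k => by rw [vf_coord]; rfl) f

lemma vf_liftVf_par (V : J → CylFun Ω) : vf (C.liftVf V) C.par = 0 := by
  rw [par, vf_coord]
  rfl

lemma vf_liftVf_comp (V : J → CylFun Ω) (k : J) :
    vf (C.liftVf V) (C.comp k) = C.par * C.proj (V k) + (1 - C.par) * C.proj (vf V (C.w k)) := by
  rw [comp, map_add, Derivation.leibniz, Derivation.leibniz, map_sub, vf_liftVf_par,
    vf_liftVf_proj, vf_liftVf_proj, vf_coord, Derivation.map_one_eq_zero]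
  simp

lemma vf_int (V : J → CylFun Ω) (f : CylFun C.dom) :
    vf V (C.int f) = C.int (vf (C.liftVf V) f) := by
  obtain ⟨S, hS⟩ := f.exists_finset_pd
  have h1 : ∀ j ∉ S.eraseNone, pd j (C.int f) = 0 := fun j hj => by
    rw [pd_integ, hS _ (fun h => hj (Finset.mem_eraseNone.2 h)), map_zero]
  have h2 : ∀ o ∉ insert none (S.eraseNone.map Function.Embedding.some), pd o f = 0 := by
    intro o ho
    refine hS o fun h => ho ?_
    rcases o with _ | k
    · simp
    · simpa using h
  rw [vf_eq_sum V h1, vf_eq_sum _ h2, Finset.sum_insert (by simp), Finset.sum_map]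
  have : pd none f * C.liftVf V none = 0 := by simp [liftVf]
  rw [this, zero_add, map_sum]
  refine Finset.sum_congr rfl fun j _ => ?_
  rw [pd_integ, mul_comm, mul_comm (pd _ f)]
  exact (C.int_proj_mul _ _).symm

/-- `hV` says that the homotopy relates V to its lift, which leaves the parameter fixed. So V passes
through the integral, the weight and the pullback. -/
lemma vf_hop {V : J → CylFun Ω}
    (hV : ∀ k, C.par * C.proj (V k) + (1 - C.par) * C.proj (vf V (C.w k)) = C.hom (V k))
    (p : ℕ) (f : CylFun Ω) : vf V (C.hop p f) = C.hop p (vf V f) := by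
  rw [hop_apply, vf_int, Derivation.leibniz, Derivation.leibniz_pow, vf_liftVf_par]
  have : vf (C.liftVf V) (C.hom f) = C.hom (vf V f) :=
    vf_pull _ _ (fun k => by rw [vf_liftVf_comp]; exact hV k) f
  rw [this]
  simp [hop_apply]

/-- The center does not depend on the coordinate c, so the homotopy moves along c with factor l,
which raises the weight by one. -/
lemma pd_hop {c : J} (hc : ∀ k, pd c (C.w k) = 0) (p : ℕ) (f : CylFun Ω) :
    pd c (C.hop p f) = C.hop (p + 1) (pd c f) := by
  obtain ⟨S, hS⟩ := f.exists_finset_pd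
  rw [← vf_single, hop_apply, vf_int, Derivation.leibniz, Derivation.leibniz_pow, vf_liftVf_par]
  have : vf (C.liftVf (Pi.single c 1)) (C.hom f) = C.hom (pd c f) * C.par := by
    rw [hom, vf_pull_eq_sum _ _ _ (S := insert c S)
      fun k hk => hS k fun h => hk (Finset.mem_insert_of_mem h)]
    have h1 : ∀ k, vf (C.liftVf (Pi.single c 1)) (C.comp k) = if k = c then C.par else 0 := by
      intro k
      rw [vf_liftVf_comp, vf_single, hc, Pi.single_apply]
      split_ifs <;> simp
    simp [h1]
  rw [this, hop_apply, smul_zero, smul_zero, smul_zero, add_zero, pow_succ, smul_eq_mul]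
  congr 1
  ring

lemma pd_none_proj (f : CylFun Ω) : pd none (C.proj f) = 0 := by
  obtain ⟨S, hS⟩ := f.exists_finset_pd
  rw [proj, pd_pull_eq_sum _ _ _ hS]
  simp [pd_coord]

lemma pd_none_par : pd none C.par = 1 := by
  rw [par, pd_coord, if_pos rfl]

lemma pd_none_comp (k : J) : pd none (C.comp k) = C.proj (coord Ω k - C.w k) := by
  have h1 : pd none (1 - C.par) = -1 := by
    rw [← vf_single, map_sub, Derivation.map_one_eq_zero, vf_single, pd_none_par, zero_sub]
  rw [comp, pd_add, pd_mul, pd_mul, pd_none_proj, pd_none_proj, pd_none_par, h1, map_sub]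
  ring

lemma int_pd_none_hom {f : CylFun Ω} {S : Finset J} (hS : ∀ k ∉ S, pd k f = 0) (p : ℕ) :
    C.int (C.par ^ p * pd none (C.hom f)) = ∑ k ∈ S, (coord Ω k - C.w k) * C.hop p (pd k f) := by
  rw [hom, pd_pull_eq_sum _ _ _ hS, Finset.mul_sum, map_sum]
  refine Finset.sum_congr rfl fun k _ => ?_
  rw [pd_none_comp, hop_apply, ← int_proj_mul, hom]
  congr 1
  ring

omit [DecidableEq J] in
lemma toFun_hom_one (f : CylFun Ω) (z : Ω) : (C.hom f).toFun (consPt 1 z.1) = f z := by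
  have h := C.consPt_mem z 1 (by simp)
  rw [toFun_of_mem _ h, hom, pull_apply, ← toFun_apply f z, ← toFun_apply]
  congr 1
  funext k
  change 1 * z.1 k + (1 - 1) * _ = z.1 k
  ring

omit [DecidableEq J] in
lemma toFun_hom_zero (f : CylFun Ω) (z : Ω) :
    (C.hom f).toFun (consPt 0 z.1) = f ⟨_, C.center_mem z⟩ := by
  have h := C.consPt_mem z 0 (by simp)
  rw [toFun_of_mem _ h, hom, pull_apply, ← toFun_apply f, ← toFun_apply]
  congr 1
  funext k
  change 0 * z.1 k + (1 - 0) * C.w k z = C.w k z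
  ring

/-- The homotopy formula. -/
lemma sum_hop_zero {f : CylFun Ω} {S : Finset J} (hS : ∀ k ∉ S, pd k f = 0) :
    ∑ k ∈ S, (coord Ω k - C.w k) * C.hop 0 (pd k f) = f - pull C.w C.center_mem f := by
  rw [← C.int_pd_none_hom hS 0]
  refine ext fun z => ?_
  rw [pow_zero, one_mul, integ_pd_none, toFun_hom_one, toFun_hom_zero]
  rfl

/-- Integrate d/dl of l^{p+1} f(h_l) over [0, 1], where h_l is the homotopy. The weight kills the
end l = 0, so no value at the center remains, unlike in `sum_hop_zero`. -/
lemma sum_hop_succ {f : CylFun Ω} {S : Finset J} (hS : ∀ k ∉ S, pd k f = 0) (p : ℕ) :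
    (p + 1 : ℝ) • C.hop p f + ∑ k ∈ S, (coord Ω k - C.w k) * C.hop (p + 1) (pd k f) = f := by
  rw [← C.int_pd_none_hom hS (p + 1)]
  have h1 : pd none (C.par ^ (p + 1) * C.hom f) =
      C.par ^ (p + 1) * pd none (C.hom f) + (p + 1 : ℝ) • (C.par ^ p * C.hom f) := by
    have : pd none (C.par ^ (p + 1)) = (p + 1 : ℝ) • C.par ^ p := by
      rw [← vf_single, Derivation.leibniz_pow, vf_single, pd_none_par]
      simp only [add_tsub_cancel_right, smul_eq_mul, mul_one]
      rw [← Nat.cast_smul_eq_nsmul ℝ]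
      push_cast
      rfl
    rw [pd_mul, this, mul_smul_comm, mul_comm (C.hom f)]
  have h2 : C.int (pd none (C.par ^ (p + 1) * C.hom f)) = f := by
    refine ext fun z => ?_
    rw [integ_pd_none, toFun_of_mem _ (C.consPt_mem z 1 (by simp)),
      toFun_of_mem _ (C.consPt_mem z 0 (by simp)), mul_apply, mul_apply,
      ← toFun_of_mem (C.hom f), ← toFun_of_mem (C.hom f), toFun_hom_one]
    have e1 : (C.par ^ (p + 1)) ⟨_, C.consPt_mem z 1 (by simp)⟩ = 1 := by
      rw [show (C.par ^ (p + 1)) ⟨_, C.consPt_mem z 1 (by simp)⟩ = (1 : ℝ) ^ (p + 1) from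
        map_pow (eval _) C.par (p + 1), one_pow]
    have e0 : (C.par ^ (p + 1)) ⟨_, C.consPt_mem z 0 (by simp)⟩ = 0 := by
      rw [show (C.par ^ (p + 1)) ⟨_, C.consPt_mem z 0 (by simp)⟩ = (0 : ℝ) ^ (p + 1) from
        map_pow (eval _) C.par (p + 1), zero_pow (by omega)]
    rw [e1, e0]
    ring
  rw [h1, map_add, map_smul] at h2
  rw [hop_apply, add_comm]
  exact h2

end Center

end CylFun

end Homotopy

end CK

end

/-! ### Calculus of variations on jet spaces -/

open scoped ContDiff

noncomputable section

namespace CK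

open TopologicalSpace CylFun CK.Sym

/-- Labels of the coordinates `t`, `x^i` and `∂_x^α u_b` for a family of dependent variables. -/
abbrev JIdx (n : ℕ) (B : Type) : Type := Option (Fin n) ⊕ (B × (Fin n → ℕ))

section Jets

variable {n : ℕ} {B : Type} [DecidableEq B] {Ω : Opens (JIdx n B → ℝ)}

variable (Ω) in
/-- The components of the total derivative `D_i`. -/
def dxField (i : Fin n) : JIdx n B → CylFun Ω
  | .inl none => 0
  | .inl (some j) => if j = i then 1 else 0
  | .inr (b, α) => coord Ω (.inr (b, α + Pi.single i 1))

variable (Ω) in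
/-- The total derivative `D_i`. -/
def tD (i : Fin n) : Derivation ℝ (CylFun Ω) (CylFun Ω) := vf (dxField Ω i)

lemma tD_coord (i : Fin n) (b : B) (α : Fin n → ℕ) :
    tD Ω i (coord Ω (.inr (b, α))) = coord Ω (.inr (b, α + Pi.single i 1)) :=
  vf_coord _ _

lemma tD_comm (i j : Fin n) : Commute (dEnd (tD Ω) i) (dEnd (tD Ω) j) := by
  refine LinearMap.ext fun f => vf_comm (fun k => ?_) f
  rcases k with (_ | k) | ⟨b, α⟩
  · simp [dxField]
  · simp only [dxField]
    split_ifs <;> simp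
  · simp only [dxField]
    rw [vf_coord, vf_coord, dxField, dxField, add_right_comm]

lemma tpow_coord (b : B) (α : Fin n → ℕ) :
    tpow (tD Ω) α (coord Ω (.inr (b, 0))) = coord Ω (.inr (b, α)) := by
  induction α using multiIndex_induction with
  | h0 => rw [tpow, npow_zero]; rfl
  | hs α i ih => rw [tpow_add_single tD_comm, ih, tD_coord]

/-- The symbol of the linearization with respect to the dependent variable `b`. -/
def symb (b : B) : CylFun Ω →ₗ[ℝ] Sym n (CylFun Ω) :=
  (Finsupp.lcomapDomain (fun α : Fin n → ℕ => (Sum.inr (b, α) : JIdx n B))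
    fun _ _ h => (Prod.ext_iff.1 (Sum.inr_injective h)).2).comp gradLin

lemma symb_apply (b : B) (f : CylFun Ω) (α : Fin n → ℕ) :
    symb b f α = pd (.inr (b, α)) f := rfl

lemma pd_vf {J : Type} [DecidableEq J] {Ω : Opens (J → ℝ)} (c : J) (W : J → CylFun Ω)
    (f : CylFun Ω) : pd c (vf W f) = vf W (pd c f) + vf (fun j => pd c (W j)) f := by
  have h := vf_vf_sub (Pi.single c 1) W f
  have h1 : ∀ j, vf W ((Pi.single c 1 : J → CylFun Ω) j) = 0 := fun j => by
    rw [Pi.single_apply]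
    split_ifs <;> simp
  simp only [vf_single, h1, sub_zero] at h
  rw [← h]
  ring

lemma pd_inr_ite (c : B × (Fin n → ℕ)) (p : Prop) [Decidable p] :
    pd (.inr c) (if p then 1 else 0 : CylFun Ω) = 0 := by
  rw [← vf_single]
  split_ifs <;> simp

/-- [∂/∂u_{b,α}, D_i] = ∂/∂u_{b,α-e_i}, with zero on the right if α_i = 0. In operator terms,
linearization turns D_i into left composition with D_i. -/
lemma symb_tD (b : B) (i : Fin n) (f : CylFun Ω) :
    symb b (tD Ω i f) = comp (tD Ω) i (symb b f) := by
  refine Finsupp.ext fun α => ?_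
  rw [symb_apply, tD, pd_vf, ← tD, Sym.comp, LinearMap.add_apply, Finsupp.add_apply, coef_apply,
    symb_apply, add_comm]
  congr 1
  by_cases hα : α i = 0
  · rw [shift_apply_of_eq_zero _ _ _ hα]
    have : (fun j => pd (Sum.inr (b, α)) (dxField Ω i j)) = 0 := by
      funext k
      rcases k with (_ | k) | ⟨b', β⟩
      · exact pd_zero _
      · exact pd_inr_ite _ _
      · simp only [dxField, pd_coord, Pi.zero_apply]
        refine if_neg fun h => ?_
        simp only [Sum.inr.injEq, Prod.mk.injEq] at h
        rw [h.2] at hα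
        simp at hα
    rw [this, vf_apply]
    simp
  · obtain ⟨β, rfl⟩ := exists_eq_add_single hα
    rw [shift_apply_add, symb_apply, ← vf_single]
    congr 1
    refine congrArg vf (funext fun k => ?_)
    rcases k with (_ | k) | ⟨b', γ⟩
    · exact (pd_zero _).trans (by simp)
    · exact (pd_inr_ite _ _).trans (by simp)
    · simp only [dxField, pd_coord, Pi.single_apply]
      refine if_congr ?_ rfl rfl
      simp only [Sum.inr.injEq, Prod.mk.injEq, add_left_inj]
      exact ⟨fun h => ⟨h.1.symm, h.2.symm⟩, fun h => ⟨h.1.symm, h.2.symm⟩⟩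

lemma symb_tpow (b : B) (γ : Fin n → ℕ) (f : CylFun Ω) :
    symb b (tpow (tD Ω) γ f) = npow (comp (tD Ω)) γ (symb b f) :=
  map_npow (T := dEnd (tD Ω)) (symb b) (fun i f => symb_tD b i f) γ f

/-- The variational derivative with respect to the dependent variable `b`. -/
def euler (b : B) : CylFun Ω →ₗ[ℝ] CylFun Ω := (eps (tD Ω)).comp (symb b)

lemma euler_apply (b : B) (f : CylFun Ω) : euler b f = eps (tD Ω) (symb b f) := rfl

lemma euler_tD (b : B) (i : Fin n) (f : CylFun Ω) : euler b (tD Ω i f) = 0 := by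
  rw [euler_apply, symb_tD, eps_comp tD_comm]

lemma exists_multiIndices (f : CylFun Ω) :
    ∃ Γ : Finset (Fin n → ℕ), ∀ b : B, ∀ γ ∉ Γ, pd (.inr (b, γ)) f = 0 := by
  obtain ⟨S, hS⟩ := f.exists_finset_pd
  refine ⟨S.toRight.image Prod.snd, fun b γ hγ => hS _ fun h => hγ ?_⟩
  exact Finset.mem_image.2 ⟨(b, γ), by simpa using h, rfl⟩

lemma symb_eq_sum {f : CylFun Ω} {Γ : Finset (Fin n → ℕ)} {b : B}
    (h : ∀ γ ∉ Γ, pd (.inr (b, γ)) f = 0) :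
    symb b f = ∑ γ ∈ Γ, Finsupp.single γ (pd (.inr (b, γ)) f) := by
  refine Finsupp.ext fun α => ?_
  rw [Finsupp.finsetSum_apply, symb_apply]
  simp only [Finsupp.single_apply, Finset.sum_ite_eq']
  split_ifs with hα
  · rfl
  · exact h α hα

lemma euler_eq_sum {f : CylFun Ω} {Γ : Finset (Fin n → ℕ)} {b : B}
    (h : ∀ γ ∉ Γ, pd (.inr (b, γ)) f = 0) :
    euler b f = ∑ γ ∈ Γ, npow (fun i => (-1 : ℝ) • dEnd (tD Ω) i) γ (pd (.inr (b, γ)) f) := by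
  rw [euler_apply, symb_eq_sum h, map_sum]
  exact Finset.sum_congr rfl fun γ _ => lift_single _ _ _ _

/-- The linearization of a variational derivative is formally self-adjoint. -/
lemma star_symb_euler (b c : B) (f : CylFun Ω) :
    Sym.star (tD Ω) (symb c (euler b f)) = symb b (euler c f) := by
  obtain ⟨Γ, hΓ⟩ := exists_multiIndices f
  have key : ∀ b c : B, symb c (euler b f) =
      ∑ γ ∈ Γ, npow (fun i => (-1 : ℝ) • comp (tD Ω) i) γ
        (∑ α ∈ Γ, Finsupp.single α (pd (.inr (c, α)) (pd (.inr (b, γ)) f))) := by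
    intro b c
    rw [euler_eq_sum (hΓ b), map_sum]
    refine Finset.sum_congr rfl fun γ _ => ?_
    rw [map_npow (T' := fun i => (-1 : ℝ) • comp (tD Ω) i) (symb c)
      (fun i x => by
        rw [LinearMap.smul_apply, map_smul, LinearMap.smul_apply]
        exact congrArg _ (symb_tD c i x)),
      symb_eq_sum (Γ := Γ) fun α hα => by rw [pd_comm, hΓ c α hα, pd_zero]]
  rw [key b c, star_sum tD_comm, key c b]
  exact Finset.sum_congr rfl fun α _ => congrArg _ (Finset.sum_congr rfl fun γ _ => by rw [pd_comm])

/-! ### Evolution systems and variational derivatives of time derivatives -/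

section Evolution

variable (K : B → CylFun Ω)

/-- The components of the time derivative along `∂_t u_b = K_b`. -/
def evField : JIdx n B → CylFun Ω
  | .inl none => 1
  | .inl (some _) => 0
  | .inr (b, α) => tpow (tD Ω) α (K b)

/-- The time derivative along `∂_t u_b = K_b`. -/
def evT : Derivation ℝ (CylFun Ω) (CylFun Ω) := vf (evField K)

lemma evT_tD (i : Fin n) (f : CylFun Ω) : evT K (tD Ω i f) = tD Ω i (evT K f) := by
  refine vf_comm (fun k => ?_) f
  rcases k with (_ | k) | ⟨b, α⟩
  · simp [dxField, evField]
  · simp only [dxField, evField]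
    split_ifs <;> simp
  · simp only [dxField, evField]
    rw [vf_coord, evField, tpow_add_single tD_comm]
    rfl

lemma commute_evT (i : Fin n) : Commute (evT K : Module.End ℝ (CylFun Ω)) (dEnd (tD Ω) i) :=
  LinearMap.ext fun f => evT_tD K i f

variable [Fintype B]

lemma vf_eq_sum_sum (V : JIdx n B → CylFun Ω) {f : CylFun Ω} {Γ : Finset (Fin n → ℕ)}
    (hΓ : ∀ b : B, ∀ γ ∉ Γ, pd (.inr (b, γ)) f = 0) :
    vf V f = ∑ a, pd (.inl a) f * V (.inl a) +
      ∑ b, ∑ γ ∈ Γ, pd (.inr (b, γ)) f * V (.inr (b, γ)) := by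
  rw [vf_eq_sum V (S := Finset.univ.disjSum (Finset.univ ×ˢ Γ)), Finset.sum_disjSum,
    Finset.sum_product]
  rintro (a | ⟨b, γ⟩) h
  · simp at h
  · exact hΓ b γ fun hγ => h (by simpa using hγ)

/-- Varying 𝒟_t f either differentiates the coefficients of the linearization of f along the flow,
or varies the right-hand sides D^γ K_c; the latter composes the linearizations of f and K. -/
lemma symb_evT (b : B) (f : CylFun Ω) :
    symb b (evT K f) = coef (evT K : Module.End ℝ (CylFun Ω)) (symb b f) +
      ∑ c, (symb c f).sum fun γ a => a • npow (comp (tD Ω)) γ (symb b (K c)) := by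
  obtain ⟨Γ, hΓ⟩ := exists_multiIndices f
  refine Finsupp.ext fun α => ?_
  rw [symb_apply, evT, pd_vf, ← evT, Finsupp.add_apply, coef_apply, symb_apply]
  congr 1
  have h0 : ∀ a, pd (.inr (b, α)) (evField K (.inl a)) = 0 := by
    rintro (_ | a)
    · rw [evField, ← vf_single, Derivation.map_one_eq_zero]
    · exact pd_zero _
  rw [vf_eq_sum_sum _ hΓ]
  simp only [h0, mul_zero, Finset.sum_const_zero, zero_add]
  rw [Finsupp.finsetSum_apply]
  refine Finset.sum_congr rfl fun c _ => ?_
  rw [Finsupp.sum_of_support_subset (s := Γ) _ _ _ (by simp), Finsupp.finsetSum_apply]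
  · refine Finset.sum_congr rfl fun γ _ => ?_
    rw [Finsupp.smul_apply, ← symb_tpow, symb_apply, symb_apply, smul_eq_mul]
    rfl
  · intro γ hγ
    by_contra h
    exact (Finsupp.mem_support_iff.1 hγ) ((symb_apply c f γ).trans (hΓ c γ h))

omit [Fintype B] in
-- (S ∘ C)* 1 = C* (S* 1).
lemma eps_sum_smul_npow (S C : Sym n (CylFun Ω)) :
    eps (tD Ω) (S.sum fun γ a => a • npow (comp (tD Ω)) γ C) =
      eps (tD Ω) (eps (tD Ω) S • C) := by
  induction S using Finsupp.induction_linear with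
  | zero => simp
  | add S T hS hT =>
    rw [Finsupp.sum_add_index' (by simp) (fun _ _ _ => add_smul _ _ _), map_add, hS, hT, map_add,
      add_smul, map_add]
  | single γ a =>
    rw [Finsupp.sum_single_index (by simp), eps_smul_npow_comp tD_comm]

/-- The variational derivatives of a time derivative. -/
lemma euler_evT (b : B) (f : CylFun Ω) :
    euler b (evT K f) = evT K (euler b f) + ∑ c, eps (tD Ω) (euler c f • symb b (K c)) := by
  rw [euler_apply, symb_evT, map_add, eps_coef (commute_evT K), map_sum]
  congr 1
  exact Finset.sum_congr rfl fun c _ => eps_sum_smul_npow _ _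

end Evolution

/-- A center for homotopies on a jet space: the jet of a section. -/
structure JetCenter (Ω : Opens (JIdx n B → ℝ)) extends Center Ω where
  w_inl : ∀ a, w (.inl a) = coord Ω (.inl a)
  pd_w : ∀ c k, pd (.inr c) (w k) = 0
  tD_w : ∀ i b α, tD Ω i (w (.inr (b, α))) = w (.inr (b, α + Pi.single i 1))

namespace JetCenter

variable (C : JetCenter Ω)

/-- The difference to the center. -/
def diff (b : B) : CylFun Ω := coord Ω (.inr (b, 0)) - C.w (.inr (b, 0))

lemma tpow_diff (b : B) (α : Fin n → ℕ) :
    tpow (tD Ω) α (C.diff b) = coord Ω (.inr (b, α)) - C.w (.inr (b, α)) := by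
  induction α using multiIndex_induction with
  | h0 => rw [tpow, npow_zero]; rfl
  | hs α i ih => rw [tpow_add_single tD_comm, ih, map_sub, tD_coord, C.tD_w]

/-- The center is the jet of a section, so D_i raises exponents in l u + (1 - l) w on both summands
alike, and the homotopy respects D_i. -/
lemma tD_hop (i : Fin n) (p : ℕ) (f : CylFun Ω) :
    tD Ω i (C.hop p f) = C.hop p (tD Ω i f) := by
  refine C.vf_hop (fun k => ?_) p f
  rcases k with a | ⟨b, α⟩
  · rw [C.w_inl, vf_coord, ← add_mul, add_sub_cancel, one_mul]
    rcases a with _ | j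
    · simp [dxField]
    · simp only [dxField]
      split_ifs <;> simp
  · have := C.tD_w i b α
    rw [tD] at this
    rw [this]
    rfl

lemma commute_hop (p : ℕ) (i : Fin n) :
    Commute (C.hop p : Module.End ℝ (CylFun Ω)) (dEnd (tD Ω) i) :=
  LinearMap.ext fun f => (C.tD_hop i p f).symm

lemma symb_hop (b : B) (p : ℕ) (f : CylFun Ω) :
    symb b (C.hop p f) = coef (C.hop (p + 1)) (symb b f) :=
  Finsupp.ext fun α => by
    rw [symb_apply, C.pd_hop (C.pd_w _), coef_apply, symb_apply]

variable [Fintype B]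

lemma sum_hop_eq {f : CylFun Ω} {Γ : Finset (Fin n → ℕ)}
    (hΓ : ∀ b : B, ∀ γ ∉ Γ, pd (.inr (b, γ)) f = 0) (p : ℕ) :
    ∑ k ∈ Finset.univ.disjSum (Finset.univ ×ˢ Γ), (coord Ω k - C.w k) * C.hop p (pd k f) =
      ∑ b, act (tD Ω) (C.diff b) (coef (C.hop p) (symb b f)) := by
  rw [Finset.sum_disjSum, Finset.sum_product]
  simp only [C.w_inl, sub_self, zero_mul, Finset.sum_const_zero, zero_add]
  refine Finset.sum_congr rfl fun b _ => ?_
  rw [symb_eq_sum (hΓ b), map_sum, map_sum]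
  refine Finset.sum_congr rfl fun γ _ => ?_
  rw [coef_single, act_single, C.tpow_diff, mul_comm]

lemma notMem_disjSum {f : CylFun Ω} {Γ : Finset (Fin n → ℕ)}
    (hΓ : ∀ b : B, ∀ γ ∉ Γ, pd (.inr (b, γ)) f = 0) :
    ∀ k ∉ (Finset.univ.disjSum (Finset.univ ×ˢ Γ) : Finset (JIdx n B)), pd k f = 0 := by
  rintro (a | ⟨b, γ⟩) h
  · simp at h
  · exact hΓ b γ fun hγ => h (by simpa using hγ)

/-- The function along the center. -/
abbrev base : CylFun Ω →ₐ[ℝ] CylFun Ω := pull C.w C.center_mem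

lemma sum_act_hop_zero (f : CylFun Ω) :
    ∑ b, act (tD Ω) (C.diff b) (coef (C.hop 0) (symb b f)) = f - C.base f := by
  obtain ⟨Γ, hΓ⟩ := exists_multiIndices f
  rw [← C.sum_hop_eq hΓ]
  exact C.sum_hop_zero (notMem_disjSum hΓ)

/-- The homotopy formula with weight l, in terms of linearizations. It recovers f with no remainder
along the center, which is what reconstructing a density from its variational derivatives requires.
-/
lemma hop_add_sum_act_hop (f : CylFun Ω) :
    C.hop 0 f + ∑ b, act (tD Ω) (C.diff b) (coef (C.hop 1) (symb b f)) = f := by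
  obtain ⟨Γ, hΓ⟩ := exists_multiIndices f
  rw [← C.sum_hop_eq hΓ]
  simpa using C.sum_hop_succ (notMem_disjSum hΓ) 0

/-- A function with vanishing variational derivatives is a divergence, up to its values along the
center. -/
lemma exists_eq_base_add_div {f : CylFun Ω} (hf : ∀ b, euler b f = 0) :
    ∃ θ : Fin n → CylFun Ω, f = C.base f + ∑ i, tD Ω i (θ i) := by
  -- The difference of f and its value along the center is the averaged linearization applied to u_b
  -- - w_b. Integration by parts leaves the average of E_b f, which is zero, and these boundary
  -- terms.
  refine ⟨fun i => ∑ b, coact (tD Ω) (C.diff b)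
    (divPart i (toDiv (tD Ω) (coef (C.hop 0) (symb b f)))), ?_⟩
  simp only [map_sum]
  rw [Finset.sum_comm, ← sub_eq_iff_eq_add', ← C.sum_act_hop_zero]
  refine Finset.sum_congr rfl fun b _ => ?_
  have h : eps (tD Ω) (coef (C.hop 0) (symb b f)) = 0 := by
    rw [eps_coef (C.commute_hop 0), ← euler_apply, hf, map_zero]
  rw [act_eq_eps_mul_add tD_comm, h, zero_mul, zero_add]

/-- A divergence-free vector is a divergence of an antisymmetric matrix, up to its values along
the center. -/
lemma exists_eq_base_add_antisymm {Δ : Fin n → CylFun Ω}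
    (hΔ : ∀ b : B, symb b (∑ i, tD Ω i (Δ i)) = 0) :
    ∃ ψ : Fin n → Fin n → CylFun Ω, (∀ i j, ψ i j = -ψ j i) ∧
      ∀ i, Δ i = C.base (Δ i) + ∑ j, tD Ω j (ψ i j) := by
  -- With derivatives on the left, the averaged linearizations of the Δ_i are polynomials P_i in the
  -- D_i with Σ D_i P_i = 0: a Koszul cycle.
  have h1 : ∀ b : B, ∑ i, shift i (toDiv (tD Ω) (coef (C.hop 0) (symb b (Δ i)))) = 0 := by
    intro b
    have h2 : ∀ i, shift i (toDiv (tD Ω) (coef (C.hop 0) (symb b (Δ i)))) =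
        toDiv (tD Ω) (coef (C.hop 0) (symb b (tD Ω i (Δ i)))) := by
      intro i
      rw [← toDiv_comp tD_comm, symb_tD, Sym.comp]
      congr 1
      rw [LinearMap.add_apply, LinearMap.add_apply, map_add]
      congr 1
      · exact LinearMap.congr_fun (commute_shift_coef i (C.hop 0)).eq _
      · exact (LinearMap.congr_fun (commute_coef (C.commute_hop 0 i)).eq _).symm
    rw [Finset.sum_congr rfl fun i _ => h2 i, ← map_sum, ← map_sum, ← map_sum, hΔ, map_zero,
      map_zero]
  choose S hS1 hS2 using fun b : B => exists_antisymm_of_sum_shift_eq_zero _ (h1 b)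
  refine ⟨fun i j => ∑ b, coact (tD Ω) (C.diff b) (S b i j), fun i j => ?_, fun i => ?_⟩
  · rw [← Finset.sum_neg_distrib]
    exact Finset.sum_congr rfl fun b _ => by rw [hS1 b i j, map_neg]
  · simp only [map_sum]
    rw [Finset.sum_comm, ← sub_eq_iff_eq_add', ← C.sum_act_hop_zero]
    refine Finset.sum_congr rfl fun b _ => ?_
    rw [act_eq_coact tD_comm, hS2 b i, map_sum]
    exact Finset.sum_congr rfl fun j _ => coact_shift tD_comm _ _ _

omit [Fintype B] in
-- (v S)* 1 = S* v.
lemma eps_smul_eq_act_star (v : CylFun Ω) (S : Sym n (CylFun Ω)) :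
    eps (tD Ω) (v • S) = act (tD Ω) v (Sym.star (tD Ω) S) := by
  induction S using Finsupp.induction_linear with
  | zero => simp
  | add S T hS hT => simp only [smul_add, map_add, hS, hT]
  | single γ a =>
    rw [Finsupp.smul_single, eps, lift_single, Sym.star, lift_single]
    have := map_npow (T := fun i => (-1 : ℝ) • comp (tD Ω) i)
      (T' := fun i => (-1 : ℝ) • dEnd (tD Ω) i)
      ((act (tD Ω) v).restrictScalars ℝ : Sym n (CylFun Ω) →ₗ[ℝ] CylFun Ω)
      (fun i x => by
        rw [LinearMap.smul_apply, map_smul, LinearMap.smul_apply]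
        exact congrArg _ (act_comp tD_comm v i x)) γ (Finsupp.single 0 a)
    simp only [LinearMap.restrictScalars_apply] at this
    rw [Finsupp.lsingle_apply, this, act_single, tpow, npow_zero, smul_eq_mul, mul_comm]
    rfl

omit [Fintype B] in
lemma star_coef_hop (p : ℕ) (S : Sym n (CylFun Ω)) :
    Sym.star (tD Ω) (coef (C.hop p) S) = coef (C.hop p) (Sym.star (tD Ω) S) :=
  lift_coef (fun j => (commute_neg ((commute_shift_coef j (C.hop p)).add_left
    (commute_coef (C.commute_hop p j).symm))).symm) (fun a => by simp [coef_single]) S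

omit [Fintype B] in
lemma symb_diff (b c : B) :
    symb b (C.diff c) = if b = c then Finsupp.single 0 1 else 0 := by
  refine Finsupp.ext fun α => ?_
  rw [symb_apply, diff, ← vf_single, map_sub, vf_single, vf_single, C.pd_w, sub_zero, pd_coord]
  by_cases hb : b = c
  · subst hb
    simp [Finsupp.single_apply, eq_comm]
  · simp [hb]

omit [Fintype B] in
lemma symb_mul (b : B) (f g : CylFun Ω) : symb b (f * g) = f • symb b g + g • symb b f :=
  Finsupp.ext fun α => by
    rw [symb_apply, pd_mul, Finsupp.add_apply, Finsupp.smul_apply, Finsupp.smul_apply,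
      symb_apply, symb_apply, smul_eq_mul, smul_eq_mul]

include C in
/-- A self-adjoint family is a family of variational derivatives. -/
lemma exists_euler_eq {Q : B → CylFun Ω}
    (hQ : ∀ b c, Sym.star (tD Ω) (symb b (Q c)) = symb c (Q b)) :
    ∃ Φ : CylFun Ω, ∀ b, euler b Φ = Q b := by
  -- The density Σ (u_c - w_c) ∫ Q_c(h_l) dl. In its E_b, `hQ` replaces the adjoint linearizations
  -- of the Q_c in u_b by linearizations of Q_b in u_c, and the sum is the integral of d/dl (l
  -- Q_b(h_l)).
  refine ⟨∑ c, C.diff c * C.hop 0 (Q c), fun b => ?_⟩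
  have h : ∀ c, euler b (C.diff c * C.hop 0 (Q c)) =
      (if b = c then C.hop 0 (Q c) else 0) +
        act (tD Ω) (C.diff c) (coef (C.hop 1) (symb c (Q b))) := by
    intro c
    rw [euler_apply, symb_mul, map_add, add_comm, C.symb_hop, eps_smul_eq_act_star (C.diff c),
      C.star_coef_hop, hQ, C.symb_diff]
    congr 1
    split_ifs
    · rw [Finsupp.smul_single, eps, lift_single, npow_zero]
      simp
    · simp
  rw [map_sum, Finset.sum_congr rfl fun c _ => h c, Finset.sum_add_distrib, Finset.sum_ite_eq,
    if_pos (Finset.mem_univ b)]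
  exact C.hop_add_sum_act_hop (Q b)

end JetCenter

end Jets

end CK

end

/-! ### Poincaré lemmas in finitely many variables -/

open scoped ContDiff

noncomputable section

namespace CK

open TopologicalSpace CylFun CK.Sym

section Poincare

variable {J : Type} [DecidableEq J] [Fintype J] {Ω : Opens (J → ℝ)}
  (C : Center Ω) (hC : ∀ c k, pd c (C.w k) = 0)
include hC

omit [Fintype J] in
lemma pd_coord_sub_mul (c k : J) (f : CylFun Ω) (p : ℕ) :
    pd c ((coord Ω k - C.w k) * C.hop p f) =
      (coord Ω k - C.w k) * C.hop (p + 1) (pd c f) + if c = k then C.hop p f else 0 := by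
  rw [pd_mul, C.pd_hop (hC c)]
  congr 1
  rw [← vf_single, map_sub, vf_single, vf_single, hC, pd_coord, sub_zero]
  split_ifs <;> simp

/-- The Poincaré lemma for forms of top degree. -/
lemma exists_eq_sum_pd [Nonempty J] (f : CylFun Ω) : ∃ V : J → CylFun Ω, f = ∑ j, pd j (V j) := by
  obtain ⟨d, hd⟩ := Nat.exists_eq_succ_of_ne_zero (Fintype.card_ne_zero (α := J))
  -- There are d + 1 coordinates, so the diagonal terms contribute d + 1 times `hop d f`, the factor
  -- in `sum_hop_succ`.
  refine ⟨fun j => (coord Ω j - C.w j) * C.hop d f, ?_⟩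
  have h := C.sum_hop_succ (f := f) (S := Finset.univ) (by simp) d
  conv_lhs => rw [← h]
  simp only [pd_coord_sub_mul C hC, if_true, Finset.sum_add_distrib, Finset.sum_const,
    Finset.card_univ, hd]
  rw [add_comm, ← Nat.cast_smul_eq_nsmul ℝ]
  push_cast
  rfl

/-- The Poincaré lemma for forms of degree one less than the top degree. -/
lemma exists_antisymm_of_sum_pd_eq_zero (hJ : 2 ≤ Fintype.card J) {V : J → CylFun Ω}
    (hV : ∑ j, pd j (V j) = 0) :
    ∃ ψ : J → J → CylFun Ω, (∀ j k, ψ j k = -ψ k j) ∧ ∀ j, V j = ∑ k, pd k (ψ j k) := by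
  obtain ⟨d, hd⟩ := Nat.exists_eq_add_of_le' hJ
  -- There are d + 2 coordinates: of the d + 2 diagonal terms the second summand cancels one, which
  -- leaves the factor d + 1 of `sum_hop_succ`.
  refine ⟨fun j k => (coord Ω k - C.w k) * C.hop d (V j) - (coord Ω j - C.w j) * C.hop d (V k),
    fun j k => (neg_sub _ _).symm, fun j => ?_⟩
  have h := C.sum_hop_succ (f := V j) (S := Finset.univ) (by simp) d
  have e : ∀ k, pd k ((coord Ω k - C.w k) * C.hop d (V j) - (coord Ω j - C.w j) * C.hop d (V k)) =
      (coord Ω k - C.w k) * C.hop (d + 1) (pd k (V j)) + C.hop d (V j) -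
        ((coord Ω j - C.w j) * C.hop (d + 1) (pd k (V k)) +
          if k = j then C.hop d (V k) else 0) := by
    intro k
    rw [← vf_single, map_sub, vf_single, vf_single, pd_coord_sub_mul C hC, pd_coord_sub_mul C hC,
      if_pos rfl]
  have h0 : ∑ k, C.hop (d + 1) (pd k (V k)) = 0 := by rw [← map_sum, hV, map_zero]
  rw [Finset.sum_congr rfl fun k _ => e k, Finset.sum_sub_distrib, Finset.sum_add_distrib,
    Finset.sum_add_distrib, ← Finset.mul_sum, h0, mul_zero, zero_add,
    Finset.sum_ite_eq', if_pos (Finset.mem_univ j), Finset.sum_const, Finset.card_univ, hd,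
    ← Nat.cast_smul_eq_nsmul ℝ]
  conv_lhs => rw [← h]
  push_cast
  simp only [add_smul, one_smul, two_smul]
  abel

end Poincare

/-! ### Sections of the jet space and functions of (t, x) -/

section Base

variable {n : ℕ} {B : Type} [DecidableEq B]

/-- A section of the jet space over an open set of the base. -/
structure JetSection (Ω : Opens (JIdx n B → ℝ)) (Ω₀ : Opens (Option (Fin n) → ℝ)) where
  proj_mem : ∀ z : Ω, (fun a => z.1 (.inl a)) ∈ Ω₀
  surj : ∀ y : Ω₀, ∃ z : Ω, (fun a => z.1 (.inl a)) = y.1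
  /-- the components of the section -/
  σ : B × (Fin n → ℕ) → CylFun Ω₀
  pd_σ : ∀ i b α, pd (some i) (σ (b, α)) = σ (b, α + Pi.single i 1)
  segment : ∀ z : Ω, ∀ l ∈ Set.Icc (0 : ℝ) 1,
    (Sum.elim (fun a => z.1 (.inl a))
      fun c => l * z.1 (.inr c) + (1 - l) * σ c ⟨_, proj_mem z⟩ : JIdx n B → ℝ) ∈ Ω

namespace JetSection

variable {Ω : Opens (JIdx n B → ℝ)} {Ω₀ : Opens (Option (Fin n) → ℝ)} (s : JetSection Ω Ω₀)

include s in
omit [DecidableEq B] in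
lemma coord_mem (z : Ω) : (fun a => coord Ω (.inl a) z) ∈ Ω₀ := s.proj_mem z

/-- Functions on the base as functions on the jet space. -/
def up : CylFun Ω₀ →ₐ[ℝ] CylFun Ω := pull (fun a => coord Ω (.inl a)) s.coord_mem

lemma vf_up {V : JIdx n B → CylFun Ω} {a : Option (Fin n)}
    (hV : ∀ c, V (.inl c) = if c = a then 1 else 0) (h : CylFun Ω₀) :
    vf V (s.up h) = s.up (pd a h) := by
  rw [← vf_single]
  refine vf_pull _ _ (fun c => ?_) h
  rw [vf_coord, hV, Pi.single_apply]
  split_ifs <;> simp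

lemma tD_up (i : Fin n) (h : CylFun Ω₀) : tD Ω i (s.up h) = s.up (pd (some i) h) := by
  refine s.vf_up (fun c => ?_) h
  rcases c with _ | c <;> simp [dxField]

lemma evT_up (K : B → CylFun Ω) (h : CylFun Ω₀) : evT K (s.up h) = s.up (pd none h) := by
  refine s.vf_up (fun c => ?_) h
  rcases c with _ | c <;> simp [evField]

lemma pd_inr_up (c : B × (Fin n → ℕ)) (h : CylFun Ω₀) : pd (.inr c) (s.up h) = 0 := by
  obtain ⟨S, hS⟩ := h.exists_finset_pd
  rw [up, pd_pull_eq_sum _ _ _ hS]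
  simp [pd_coord]

lemma symb_up (b : B) (h : CylFun Ω₀) : symb b (s.up h) = 0 :=
  Finsupp.ext fun α => by rw [symb_apply, pd_inr_up]; rfl

/-- The components of the center of the homotopy to the section. -/
def center : JIdx n B → CylFun Ω
  | .inl a => coord Ω (.inl a)
  | .inr c => s.up (s.σ c)

/-- The center of the homotopy to the section. -/
def toCenter : JetCenter Ω where
  w := s.center
  segment z l hl := by
    convert s.segment z l hl using 2 with k
    rcases k with a | c
    · change l * z.1 (.inl a) + (1 - l) * z.1 (.inl a) = z.1 (.inl a)
      ring
    · rfl
  w_inl _ := rfl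
  pd_w c k := by
    rcases k with a | k
    · simp [center, pd_coord]
    · exact s.pd_inr_up c _
  tD_w i b α := by
    rw [center, tD_up, s.pd_σ]
    rfl

/-- The components of the section. -/
def comp : JIdx n B → CylFun Ω₀
  | .inl a => coord Ω₀ a
  | .inr c => s.σ c

omit [DecidableEq B] in
-- The point of the section over y is the end l = 0 of the segment from any point of the domain over
-- y.
lemma comp_mem (y : Ω₀) : (fun k => s.comp k y) ∈ Ω := by
  obtain ⟨z, hz⟩ := s.surj y
  convert s.segment z 0 (by simp) using 2 with k
  rcases k with a | c
  · exact (congrFun hz a).symm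
  · have : (⟨_, s.proj_mem z⟩ : Ω₀) = y := Subtype.ext hz
    simp only [Sum.elim_inr, zero_mul, zero_add, sub_zero, one_mul, this]
    rfl

/-- The pullback along the section. -/
def down : CylFun Ω →ₐ[ℝ] CylFun Ω₀ := pull s.comp s.comp_mem

lemma base_eq (f : CylFun Ω) : s.toCenter.base f = s.up (s.down f) := by
  refine CylFun.ext fun z => ?_
  change f _ = f _
  congr 2
  funext k
  rcases k with a | c <;> rfl

lemma pd_down (i : Fin n) (f : CylFun Ω) : pd (some i) (s.down f) = s.down (tD Ω i f) := by
  rw [← vf_single]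
  refine vf_pull _ _ (fun k => ?_) f
  rw [vf_single]
  rcases k with a | ⟨b, α⟩
  · rw [comp, pd_coord]
    rcases a with _ | j
    · simp [dxField]
    · simp only [dxField, Option.some.injEq, eq_comm (a := i)]
      split_ifs <;> simp
  · exact s.pd_σ i b α

omit [DecidableEq B] in
lemma down_up (h : CylFun Ω₀) : s.down (s.up h) = h := rfl

variable [Fintype B] (K : B → CylFun Ω) (C₀ : Center Ω₀) (hC₀ : ∀ c k, pd c (C₀.w k) = 0)
include hC₀

/-- A function with vanishing variational derivatives is a divergence in space-time. -/
lemma exists_eq_evT_add_div {f : CylFun Ω} (hf : ∀ b, euler b f = 0) :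
    ∃ (a : CylFun Ω₀) (θ : Fin n → CylFun Ω),
      f = evT K (s.up a) + ∑ i, tD Ω i (θ i) := by
  obtain ⟨θ, hθ⟩ := s.toCenter.exists_eq_base_add_div hf
  -- The remainder is a function of (t, x), hence a space-time divergence on the base; on functions
  -- lifted from there, 𝒟_t and D_i are the partial derivatives for every K.
  obtain ⟨V, hV⟩ := exists_eq_sum_pd C₀ hC₀ (s.down f)
  refine ⟨V none, fun i => s.up (V (some i)) + θ i, ?_⟩
  rw [s.base_eq, hV, Fintype.sum_option, map_add, map_sum] at hθ
  simp only [map_add, Finset.sum_add_distrib, tD_up, evT_up]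
  rw [← add_assoc]
  exact hθ

include s in
/-- A conservation law whose density has vanishing variational derivatives is trivial. -/
lemma exists_trivial (hn : 1 ≤ n) {Φt : CylFun Ω} {Φ : Fin n → CylFun Ω}
    (hΦ : evT K Φt + ∑ i, tD Ω i (Φ i) = 0) (he : ∀ b, euler b Φt = 0) :
    ∃ (θ : Fin n → CylFun Ω) (ψ : Fin n → Fin n → CylFun Ω), (∀ i j, ψ i j = -ψ j i) ∧
      Φt = ∑ i, tD Ω i (θ i) ∧ ∀ i, Φ i = -evT K (θ i) + ∑ j, tD Ω j (ψ i j) := by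
  obtain ⟨θ, hθ⟩ := s.toCenter.exists_eq_base_add_div he
  set a := s.down Φt with ha
  rw [s.base_eq, ← ha] at hθ
  -- Once θ is moved from the density to the flux, the divergence of the flux depends on (t, x)
  -- only, so linearizations do not see it.
  have h1 : ∑ i, tD Ω i (Φ i + evT K (θ i)) = -s.up (pd none a) := by
    rw [hθ, map_add, evT_up, map_sum] at hΦ
    simp only [map_add, Finset.sum_add_distrib]
    simp only [evT_tD] at hΦ
    linear_combination hΦ
  obtain ⟨ψ, hψ1, hψ2⟩ := s.toCenter.exists_eq_base_add_antisymm
    (Δ := fun i => Φ i + evT K (θ i)) fun b => by rw [h1, map_neg, symb_up, neg_zero]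
  -- Along the section, the remaining density and flux form a divergence-free field on the base,
  -- which has dimension n + 1 ≥ 2.
  let V : Option (Fin n) → CylFun Ω₀ := fun o => o.elim a fun i => s.down (Φ i + evT K (θ i))
  have hV : ∑ o, pd o (V o) = 0 := by
    rw [Fintype.sum_option]
    have : ∀ i, pd (some i) (V (some i)) = s.down (tD Ω i (Φ i + evT K (θ i))) := fun i =>
      s.pd_down i _
    rw [Finset.sum_congr rfl fun i _ => this i, ← map_sum, h1, map_neg, down_up]
    exact add_neg_cancel _
  obtain ⟨χ, hχ1, hχ2⟩ := exists_antisymm_of_sum_pd_eq_zero C₀ hC₀ (by simpa using hn) hV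
  have hχ0 : χ none none = 0 := by
    have := hχ1 none none
    have h2 : (2 : ℝ) • χ none none = 0 := by
      rw [two_smul]
      nth_rewrite 1 [this]
      exact neg_add_cancel _
    exact (smul_eq_zero.1 h2).resolve_left two_ne_zero
  -- The time-space entries of χ correct θ, and its space-space entries correct ψ.
  refine ⟨fun i => θ i + s.up (χ none (some i)), fun i j => s.up (χ (some i) (some j)) + ψ i j,
    fun i j => ?_, ?_, fun i => ?_⟩
  · change s.up (χ (some i) (some j)) + ψ i j = -(s.up (χ (some j) (some i)) + ψ j i)
    rw [hχ1 (some i) (some j), hψ1 i j, map_neg]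
    ring
  · have h3 := hχ2 none
    rw [Fintype.sum_option, hχ0, pd_zero, zero_add] at h3
    change a = _ at h3
    simp only [map_add, Finset.sum_add_distrib, tD_up]
    rw [← map_sum, ← h3]
    nth_rewrite 1 [hθ]
    ring
  · have h3 := hχ2 (some i)
    rw [Fintype.sum_option, hχ1 (some i) none] at h3
    change s.down (Φ i + evT K (θ i)) = _ at h3
    have h4 := hψ2 i
    simp only [s.base_eq] at h4
    rw [h3, map_add, map_sum] at h4
    simp only [map_add, Finset.sum_add_distrib, tD_up, evT_up]
    have h5 : pd none (-χ none (some i)) = -pd none (χ none (some i)) := by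
      rw [← vf_single, map_neg, vf_single]
    rw [h5, map_neg] at h4
    linear_combination h4

end JetSection

end Base

/-! ### Multipliers of the first-order system and the determining system -/

section Multiplier

variable {n N : ℕ} {Ω : Opens (JIdx n (Fin N) → ℝ)}

/-- The right-hand sides of the first-order system `∂_t u_b = u_{b+1}`, `∂_t u_{N-1} = -g`. -/
def rhs (g : CylFun Ω) (b : Fin N) : CylFun Ω :=
  if h : b.1 + 1 < N then coord Ω (.inr (⟨b.1 + 1, h⟩, 0)) else -g

/-- The total time derivative on the solution space. -/
def sT (g : CylFun Ω) : Derivation ℝ (CylFun Ω) (CylFun Ω) := evT (rhs g)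

/-- The adjoint of the linearization of `g` with respect to `u_b`. -/
def adj (g Λ : CylFun Ω) (b : ℕ) : CylFun Ω :=
  if h : b < N then eps (tD Ω) (Λ • symb ⟨b, h⟩ g) else 0

/-- The recursively defined expressions `Ω_q`. -/
def om (g Λ : CylFun Ω) : ℕ → CylFun Ω
  | 0 => Λ
  | q + 1 => -sT g (om g Λ q) + adj g Λ (N - (q + 1))

lemma symb_coord (b c : Fin N) :
    symb b (coord Ω (.inr (c, 0))) = if b = c then Finsupp.single 0 1 else 0 := by
  refine Finsupp.ext fun α => ?_
  rw [symb_apply, pd_coord]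
  by_cases h : b = c
  · subst h
    simp [Finsupp.single_apply, eq_comm]
  · simp [h]

/-- The variational derivatives of the time derivative of a density. -/
lemma euler_sT (g Φ : CylFun Ω) (q : Fin N) :
    euler q.rev (sT g Φ) = sT g (euler q.rev Φ) +
      (if h : q.1 + 1 < N then euler (Fin.rev ⟨q.1 + 1, h⟩) Φ else 0) -
      adj g (euler (Fin.rev ⟨0, q.pos⟩) Φ) (N - (q.1 + 1)) := by
  rw [sT, euler_evT, ← sT, add_sub_assoc]
  congr 1
  -- With b = N - 1 - q (`q.rev`), the only right-hand sides that can involve u_b are u_{c+1} for c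
  -- = N - 2 - q and -g for c = N - 1.
  have hterm : ∀ c : Fin N, eps (tD Ω) (euler c Φ • symb q.rev (rhs g c)) =
      (if c.1 + (q.1 + 2) = N then euler c Φ else 0) -
        (if c = Fin.rev ⟨0, q.pos⟩ then adj g (euler c Φ) (N - (q.1 + 1)) else 0) := by
    intro c
    have hq : N - (q.1 + 1) < N := by omega
    by_cases hc : c.1 + 1 < N
    · have h1 : c ≠ Fin.rev ⟨0, q.pos⟩ := fun h => by
        rw [h, Fin.val_rev] at hc
        simp only at hc
        omega
      rw [rhs, dif_pos hc, symb_coord, if_neg h1, sub_zero]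
      have h2 : q.rev = ⟨c.1 + 1, hc⟩ ↔ c.1 + (q.1 + 2) = N := by
        rw [Fin.ext_iff, Fin.val_rev]
        simp only
        omega
      by_cases h3 : c.1 + (q.1 + 2) = N
      · rw [if_pos (h2.2 h3), if_pos h3, Finsupp.smul_single, eps, lift_single, npow_zero]
        simp
      · rw [if_neg (mt h2.1 h3), if_neg h3, smul_zero, map_zero]
    · have h1 : c = Fin.rev ⟨0, q.pos⟩ := by
        rw [Fin.ext_iff, Fin.val_rev]
        simp only
        omega
      rw [rhs, dif_neg hc, if_pos h1, if_neg (by omega), zero_sub, map_neg, smul_neg, map_neg,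
        adj, dif_pos hq]
      rfl
  rw [Finset.sum_congr rfl fun c _ => hterm c, Finset.sum_sub_distrib, Finset.sum_ite_eq',
    if_pos (Finset.mem_univ _)]
  congr 1
  by_cases h : q.1 + 1 < N
  · rw [dif_pos h, Finset.sum_eq_single (Fin.rev ⟨q.1 + 1, h⟩)]
    · rw [if_pos]
      rw [Fin.val_rev]
      simp only
      omega
    · intro c _ hc
      refine if_neg fun h' => hc ?_
      rw [Fin.ext_iff, Fin.val_rev]
      simp only
      omega
    · simp
  · rw [dif_neg h]
    exact Finset.sum_eq_zero fun c _ => if_neg (by omega)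

/-- Divergences drop out, so E_b(𝒟_tΦ^t) = 0 and `euler_sT` becomes the recursion for Ω_q. At q = N
- 1 there is no next variable, and the recursion closes as Ω_N = 0. -/
lemma euler_rev_eq_om {g Λ Φt : CylFun Ω} {Φ : Fin n → CylFun Ω} (hN : 0 < N)
    (hΦ : sT g Φt + ∑ i, tD Ω i (Φ i) = 0) (hΛ : Λ = euler (Fin.rev ⟨0, hN⟩) Φt) :
    (∀ q : Fin N, euler q.rev Φt = om g Λ q) ∧ om g Λ N = 0 := by
  have hz : ∀ b, euler b (sT g Φt) = 0 := fun b => by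
    rw [eq_neg_of_add_eq_zero_left hΦ, map_neg, map_sum]
    simp [euler_tD]
  have h1 : ∀ q : ℕ, ∀ h : q < N, euler (Fin.rev ⟨q, h⟩) Φt = om g Λ q := by
    intro q
    induction q with
    | zero => intro h; exact hΛ.symm
    | succ q ih =>
      intro h
      have := euler_sT g Φt ⟨q, by omega⟩
      simp only at this
      rw [hz, dif_pos h, ih, ← hΛ] at this
      rw [om]
      linear_combination -this
  refine ⟨fun q => h1 q.1 q.2, ?_⟩
  have h := euler_sT g Φt ⟨N - 1, by omega⟩
  rw [hz, dif_neg (by simp only; omega), h1, ← hΛ] at h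
  have e : om g Λ N = om g Λ (N - 1 + 1) := by rw [Nat.sub_add_cancel hN]
  rw [e, om]
  linear_combination h

/-- The determining system, on functions on the normal jet space. -/
def Determining (g Λ : CylFun Ω) : Prop :=
  om g Λ N = 0 ∧
    ∀ j k : Fin N, Sym.star (tD Ω) (symb j.rev (om g Λ k)) = symb k.rev (om g Λ j)

lemma determining_of_conservationLaw {g Λ Φt : CylFun Ω} {Φ : Fin n → CylFun Ω} (hN : 0 < N)
    (hΦ : sT g Φt + ∑ i, tD Ω i (Φ i) = 0) (hΛ : Λ = euler (Fin.rev ⟨0, hN⟩) Φt) :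
    Determining g Λ := by
  obtain ⟨h1, h2⟩ := euler_rev_eq_om hN hΦ hΛ
  refine ⟨h2, fun j k => ?_⟩
  rw [← h1, ← h1, star_symb_euler]

variable {Ω₀ : Opens (Option (Fin n) → ℝ)} (s : JetSection Ω Ω₀) (C₀ : Center Ω₀)
  (hC₀ : ∀ c k, pd c (C₀.w k) = 0)
include s hC₀

/-- The Helmholtz conditions integrate the Ω_q to a density; by the recursion and Ω_N = 0 all
variational derivatives of its time derivative vanish. The obstruction left is a function of (t, x),
which is absorbed into the density without changing its variational derivatives. -/
lemma exists_conservationLaw {g Λ : CylFun Ω} (hN : 0 < N) (h : Determining g Λ) :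
    ∃ (Φt : CylFun Ω) (Φ : Fin n → CylFun Ω), sT g Φt + ∑ i, tD Ω i (Φ i) = 0 ∧
      Λ = euler (Fin.rev ⟨0, hN⟩) Φt := by
  obtain ⟨Φ₁, hΦ₁⟩ := s.toCenter.exists_euler_eq (Q := fun b => om g Λ b.rev) fun b c => by
    simpa using h.2 b.rev c.rev
  have h0 : euler (Fin.rev ⟨0, hN⟩) Φ₁ = Λ := by rw [hΦ₁, Fin.rev_rev]; rfl
  have hz : ∀ b, euler b (sT g Φ₁) = 0 := by
    intro b
    rw [← Fin.rev_rev b]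
    generalize b.rev = q
    rw [euler_sT, h0, hΦ₁, Fin.rev_rev]
    by_cases hq : q.1 + 1 < N
    · rw [dif_pos hq, hΦ₁, Fin.rev_rev]
      simp only [om]
      ring
    · rw [dif_neg hq]
      have e : q.1 + 1 = N := by omega
      have := (congrArg (om g Λ) e).trans h.1
      rw [om] at this
      linear_combination -this
  obtain ⟨a, θ, hθ⟩ := s.exists_eq_evT_add_div (rhs g) C₀ hC₀ hz
  refine ⟨Φ₁ - s.up a, fun i => -θ i, ?_, ?_⟩
  · rw [map_sub, hθ, sT]
    simp
  · rw [map_sub, h0, euler_apply _ (s.up a), s.symb_up, map_zero, sub_zero]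

/-- The recursion started at zero stays zero, so the vanishing of E_{N-1}Φ^t alone forces all
variational derivatives of Φ^t to vanish. -/
lemma exists_trivial_of_euler_eq_zero {g Φt : CylFun Ω} {Φ : Fin n → CylFun Ω} (hn : 1 ≤ n)
    (hN : 0 < N) (hΦ : sT g Φt + ∑ i, tD Ω i (Φ i) = 0)
    (h0 : euler (Fin.rev ⟨0, hN⟩) Φt = 0) :
    ∃ (θ : Fin n → CylFun Ω) (ψ : Fin n → Fin n → CylFun Ω), (∀ i j, ψ i j = -ψ j i) ∧
      Φt = ∑ i, tD Ω i (θ i) ∧ ∀ i, Φ i = -sT g (θ i) + ∑ j, tD Ω j (ψ i j) := by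
  obtain ⟨h1, -⟩ := euler_rev_eq_om hN hΦ h0.symm
  have hom : ∀ q, om g (0 : CylFun Ω) q = 0 := by
    intro q
    induction q with
    | zero => rfl
    | succ q ih =>
      rw [om, ih, map_zero, neg_zero, zero_add, adj]
      split_ifs <;> simp
  refine s.exists_trivial (rhs g) C₀ hC₀ hn hΦ fun b => ?_
  rw [← Fin.rev_rev b, h1, hom]

end Multiplier

end CK

end

/-! ### From functions on jets to the algebra of coordinate functions -/

open scoped ContDiff

noncomputable section

namespace CK

open Topology TopologicalSpace CylFun CK.Sym

section Restriction

variable {n : ℕ} {B : Type} (e : B → ℕ)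

/-- The coordinates of a jet in which only the `t`-derivatives of orders `e b` are kept. -/
def Jet.res (z : Jet n) : JIdx n B → ℝ :=
  Sum.elim (fun o => o.elim z.t z.x) fun c => z.u (e c.1, c.2)

variable {e}

variable (e) in
/-- A jet with given coordinates. -/
def ofRes (w : JIdx n B → ℝ) (z : Jet n) : Jet n where
  t := w (.inl none)
  x i := w (.inl (some i))
  u := Function.extend (Prod.map e id) (fun c => w (.inr c)) z.u

lemma res_ofRes (he : e.Injective) (w : JIdx n B → ℝ) (z : Jet n) :
    (ofRes e w z).res e = w := by
  funext k
  rcases k with (_ | i) | c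
  · rfl
  · rfl
  · exact (he.prodMap Function.injective_id).extend_apply (fun c => w (.inr c)) z.u c

variable (e) in
/-- The jets with coordinates in an open set. -/
def jetSet (Ω : Opens (JIdx n B → ℝ)) : Set (Jet n) := {z | z.res e ∈ Ω}

variable {Ω : Opens (JIdx n B → ℝ)}

variable (e) in
/-- The function `f` on jets is the function `a` of the kept coordinates. -/
def Rep (f : Jet n → ℝ) (a : CylFun Ω) : Prop :=
  ∀ z (h : z.res e ∈ Ω), f z = a ⟨z.res e, h⟩

variable (e) in
/-- The function on jets that is given by a function of the kept coordinates. -/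
def toJet (a : CylFun Ω) (z : Jet n) : ℝ := a.toFun (z.res e)

lemma rep_toJet (a : CylFun Ω) : Rep e (toJet e a) a := fun _ h => a.toFun_of_mem h

/-- For injective `e` every point of Ω consists of the kept coordinates of some jet, so nothing is
lost by passing to the algebra. -/
lemma Rep.ext (he : e.Injective) {f g : Jet n → ℝ} {a b : CylFun Ω} (hf : Rep e f a)
    (hg : Rep e g b) (h : ∀ z ∈ jetSet e Ω, f z = g z) : a = b := by
  refine CylFun.ext fun w => ?_
  obtain ⟨z, hz⟩ : ∃ z : Jet n, z.res e = w.1 :=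
    ⟨ofRes e w.1 ⟨0, 0, 0⟩, res_ofRes he _ _⟩
  have hm : z.res e ∈ Ω := hz ▸ w.2
  have : (⟨z.res e, hm⟩ : Ω) = w := Subtype.ext hz
  rw [← this, ← hf z hm, ← hg z hm]
  exact h z hm

lemma Rep.eq_iff (he : e.Injective) {f g : Jet n → ℝ} {a b : CylFun Ω} (hf : Rep e f a)
    (hg : Rep e g b) : (∀ z ∈ jetSet e Ω, f z = g z) ↔ a = b :=
  ⟨hf.ext he hg, fun h z hz => by rw [hf z hz, hg z hz, h]⟩

section Smooth

variable {S : Finset (Coord n)} {T : Finset (B × (Fin n → ℕ))}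
  (hST : T.image (Prod.map e id) = S)

/-- The labels in `T` and those of the independent variables. -/
abbrev withBase (T : Finset (B × (Fin n → ℕ))) : Finset (JIdx n B) := Finset.univ.disjSum T

/-- The coordinates with labels in `T`, in terms of the projection of the jet. -/
def ofProj (hST : T.image (Prod.map e id) = S) (q : ℝ × (Fin n → ℝ) × (S → ℝ)) :
    withBase T → ℝ
  | ⟨.inl none, _⟩ => q.1
  | ⟨.inl (some i), _⟩ => q.2.1 i
  | ⟨.inr c, h⟩ => q.2.2 ⟨Prod.map e id c, hST ▸ Finset.mem_image_of_mem _ (by simpa using h)⟩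

lemma exists_label (hST : T.image (Prod.map e id) = S) (c : S) :
    ∃ t ∈ T, Prod.map e id t = c.1 :=
  Finset.mem_image.1 (by rw [hST]; exact c.2)

/-- The projection of the jet in terms of the coordinates with labels in `T`. -/
def toProj (hST : T.image (Prod.map e id) = S)
    (y : withBase T → ℝ) : ℝ × (Fin n → ℝ) × (S → ℝ) :=
  (y ⟨.inl none, by simp⟩, fun i => y ⟨.inl (some i), by simp⟩,
    fun c => y ⟨.inr (exists_label hST c).choose,
      by simpa using (exists_label hST c).choose_spec.1⟩)

lemma toProj_ofProj (q : ℝ × (Fin n → ℝ) × (S → ℝ)) : toProj hST (ofProj hST q) = q := by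
  refine Prod.ext rfl (Prod.ext (funext fun i => rfl) (funext fun c => ?_))
  exact congrArg q.2.2 (Subtype.ext (exists_label hST c).choose_spec.2)

lemma ofProj_proj (z : Jet n) :
    ofProj hST (Jet.proj S z) = (withBase T).restrict (z.res e) := by
  funext k
  rcases k with ⟨(_ | i) | c, h⟩ <;> rfl

lemma toProj_restrict (z : Jet n) :
    toProj hST ((withBase T).restrict (z.res e)) = Jet.proj S z := by
  rw [← ofProj_proj hST, toProj_ofProj]

lemma contDiff_ofProj : ContDiff ℝ ∞ (ofProj hST) := by
  refine contDiff_pi.2 fun k => ?_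
  rcases k with ⟨(_ | i) | c, h⟩
  · exact contDiff_fst
  · exact (contDiff_apply ℝ ℝ i).comp (contDiff_fst.comp contDiff_snd)
  · exact (contDiff_apply ℝ ℝ _).comp (contDiff_snd.comp contDiff_snd)

lemma contDiff_toProj : ContDiff ℝ ∞ (toProj hST) := by
  unfold toProj
  fun_prop

include hST in
lemma isOpen_proj_image (he : e.Injective) : IsOpen (Jet.proj S '' jetSet e Ω) := by
  have : Jet.proj S '' jetSet e Ω = ofProj hST ⁻¹'
      ((fun w : JIdx n B → ℝ => (withBase T).restrict w) '' (Ω : Set _)) := by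
    ext q
    constructor
    · rintro ⟨z, hz, rfl⟩
      exact ⟨_, hz, (ofProj_proj hST z).symm⟩
    · rintro ⟨w, hw, hq⟩
      obtain ⟨z, rfl⟩ : ∃ z : Jet n, z.res e = w :=
        ⟨ofRes e w ⟨0, 0, 0⟩, res_ofRes he _ _⟩
      refine ⟨z, hw, ?_⟩
      rw [← toProj_restrict hST, ← toProj_ofProj hST q]
      exact congrArg _ hq
  rw [this]
  exact (isOpen_restrict_image Ω _).preimage (contDiff_ofProj hST).continuous

include hST in
-- The projected domain is open, so smoothness on it is smoothness at each of its points; the rest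
-- is a smooth relabelling of finitely many coordinates.
lemma smoothIn_iff (he : e.Injective) {f : Jet n → ℝ} :
    SmoothIn (jetSet e Ω) S f ↔
      ∃ a : CylFun Ω, Rep e f a ∧ ∃ F, IsCyl a.val (withBase T) F := by
  constructor
  · rintro ⟨F, hF, hf⟩
    have hcyl : IsCyl (Ω := Ω) (fun w => F (toProj hST ((withBase T).restrict w.1)))
        (withBase T) (F ∘ toProj hST) := by
      intro w
      refine ⟨?_, rfl⟩
      obtain ⟨z, hz⟩ : ∃ z : Jet n, z.res e = w.1 :=
        ⟨ofRes e w.1 ⟨0, 0, 0⟩, res_ofRes he _ _⟩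
      refine ContDiffAt.comp _ ?_ (contDiff_toProj hST).contDiffAt
      rw [← hz, toProj_restrict]
      refine hF.contDiffAt ((isOpen_proj_image hST he).mem_nhds ⟨z, ?_, rfl⟩)
      change z.res e ∈ Ω
      exact hz ▸ w.2
    refine ⟨⟨_, _, _, hcyl⟩, fun z h => ?_, _, hcyl⟩
    rw [hf z h, ← toProj_restrict hST]
    rfl
  · rintro ⟨a, ha, F, hF⟩
    refine ⟨F ∘ ofProj hST, ?_, fun z hz => ?_⟩
    · rintro _ ⟨z, hz, rfl⟩
      refine (ContDiffAt.comp _ ?_ (contDiff_ofProj hST).contDiffAt).contDiffWithinAt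
      rw [ofProj_proj hST]
      exact (hF ⟨_, hz⟩).1
    · rw [ha z hz, Function.comp_apply, ofProj_proj hST]
      exact (hF ⟨_, hz⟩).2

end Smooth

variable {f f' : Jet n → ℝ} {a a' : CylFun Ω}

lemma Rep.add (h : Rep e f a) (h' : Rep e f' a') : Rep e (fun z => f z + f' z) (a + a') :=
  fun z hz => congrArg₂ (· + ·) (h z hz) (h' z hz)

lemma Rep.sub (h : Rep e f a) (h' : Rep e f' a') : Rep e (fun z => f z - f' z) (a - a') :=
  fun z hz => congrArg₂ (· - ·) (h z hz) (h' z hz)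

lemma Rep.mul (h : Rep e f a) (h' : Rep e f' a') : Rep e (fun z => f z * f' z) (a * a') :=
  fun z hz => congrArg₂ (· * ·) (h z hz) (h' z hz)

lemma Rep.const_mul (c : ℝ) (h : Rep e f a) : Rep e (fun z => c * f z) (c • a) :=
  fun z hz => congrArg (c * ·) (h z hz)

lemma Rep.neg (h : Rep e f a) : Rep e (fun z => -f z) (-a) :=
  fun z hz => congrArg (-·) (h z hz)

lemma rep_zero : Rep e (fun _ => 0) (0 : CylFun Ω) := fun _ _ => rfl

lemma Rep.sum {ι : Type*} {s : Finset ι} {f : ι → Jet n → ℝ} {a : ι → CylFun Ω}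
    (h : ∀ i ∈ s, Rep e (f i) (a i)) : Rep e (fun z => ∑ i ∈ s, f i z) (∑ i ∈ s, a i) :=
  fun z hz => by
    rw [CylFun.sum_apply]
    exact Finset.sum_congr rfl fun i hi => h i hi z hz

end Restriction

/-! ### Total derivatives on the full jet space -/

section Full

variable {n : ℕ} {Ω : Opens (JIdx n ℕ → ℝ)} {f : Jet n → ℝ} {a : CylFun Ω}

lemma Rep.pd_of_update (h : Rep id f a) {k : JIdx n ℕ} {γ : ℝ → Jet n} {z : Jet n}
    (hz : z.res id ∈ Ω) (hγ : ∀ s, (γ s).res id = Function.update (z.res id) k s) :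
    deriv (fun s => f (γ s)) (z.res id k) = pd k a ⟨z.res id, hz⟩ := by
  refine ((hasDerivAt_pd a k ⟨z.res id, hz⟩).congr_of_eventuallyEq ?_).deriv
  filter_upwards [eventually_update_mem ⟨z.res id, hz⟩ k] with s hs
  rw [← hγ s] at hs ⊢
  rw [h _ hs, toFun_of_mem a hs]

lemma Rep.pdT (h : Rep id f a) : Rep id (pdT f) (pd (.inl none) a) := fun z hz =>
  h.pd_of_update (k := (.inl none)) (γ := fun s => { z with t := s }) hz fun s => by
    funext k
    rcases k with (_ | i) | c <;> simp [Jet.res]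

lemma Rep.pdX (h : Rep id f a) (i : Fin n) : Rep id (pdX i f) (pd (.inl (some i)) a) := fun z hz =>
  h.pd_of_update (k := (.inl (some i))) (γ := fun s => { z with x := Function.update z.x i s }) hz fun s => by
    funext k
    rcases k with (_ | j) | c <;> simp [Jet.res, Function.update_apply]

lemma Rep.pdU (h : Rep id f a) (c : Coord n) : Rep id (pdU c f) (pd (.inr c) a) := fun z hz =>
  h.pd_of_update (k := (.inr c)) (γ := fun s => { z with u := Function.update z.u c s }) hz fun s => by
    funext k
    rcases k with (_ | i) | c' <;> simp [Jet.res, Function.update_apply]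

/-- A derivation as a sum over all coordinates. -/
lemma vf_apply_eq_finsum (V : JIdx n ℕ → CylFun Ω) (a : CylFun Ω) (w : Ω) :
    vf V a w = ∑ o, V (.inl o) w * pd (.inl o) a w +
      ∑ᶠ c, V (.inr c) w * pd (.inr c) a w := by
  obtain ⟨Γ, hΓ⟩ := a.exists_finset_pd
  rw [vf_eq_sum V (S := Finset.univ.disjSum Γ.toRight)]
  · rw [CylFun.sum_apply, Finset.sum_disjSum, finsum_eq_sum_of_support_subset (s := Γ.toRight)]
    · simp only [CylFun.mul_apply, mul_comm]
    · intro c hc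
      by_contra h
      refine hc ?_
      change V (.inr c) w * pd (.inr c) a w = 0
      rw [hΓ (.inr c) (by simpa using h)]
      exact mul_zero _
  · rintro (o | c) h
    · simp at h
    · exact hΓ _ (by simpa using h)

lemma Rep.dx (h : Rep id f a) (i : Fin n) : Rep id (Dx i f) (tD Ω i a) := fun z hz => by
  rw [Dx, tD, vf_apply_eq_finsum, Fintype.sum_option, Finset.sum_eq_single i, h.pdX i z hz]
  · simp only [dxField, if_true, CylFun.one_apply, CylFun.zero_apply, zero_mul, zero_add, one_mul]
    congr 1
    exact finsum_congr fun c => congrArg _ (h.pdU c z hz)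
  · intro j _ hj
    simp [dxField, hj, CylFun.zero_apply]
  · simp

variable (Ω) in
/-- The total derivative `D_t`. -/
def tT : Derivation ℝ (CylFun Ω) (CylFun Ω) := evT fun b => coord Ω (.inr (b + 1, 0))

lemma Rep.vf_of {V : JIdx n ℕ → CylFun Ω} (h : Rep id f a) (h0 : V (.inl none) = 1)
    (h1 : ∀ i, V (.inl (some i)) = 0) {v : Coord n → Jet n → ℝ}
    (hv : ∀ c, Rep id (v c) (V (.inr c))) :
    Rep id (fun z => CK.pdT f z + ∑ᶠ c, v c z * CK.pdU c f z) (vf V a) := fun z hz => by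
  rw [vf_apply_eq_finsum, Fintype.sum_option]
  simp only [h0, h1, CylFun.one_apply, CylFun.zero_apply, zero_mul, one_mul,
    Finset.sum_const_zero, add_zero]
  rw [h.pdT z hz]
  congr 1
  exact finsum_congr fun c => by rw [h.pdU c z hz, hv c z hz]

lemma rep_coord (c : Coord n) : Rep id (fun z : Jet n => z.u c) (coord Ω (.inr c)) :=
  fun _ _ => rfl

lemma Rep.dt (h : Rep id f a) : Rep id (Dt f) (tT Ω a) :=
  h.vf_of rfl (fun _ => rfl) (v := fun c z => z.u (c.1 + 1, c.2)) fun c => by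
    rw [evField, tpow_coord]
    exact rep_coord _

lemma Rep.iterate {P : (Jet n → ℝ) → Jet n → ℝ} {Q : CylFun Ω → CylFun Ω}
    (hP : ∀ {f a}, Rep id f a → Rep id (P f) (Q a)) (h : Rep id f a) (k : ℕ) :
    Rep id (P^[k] f) (Q^[k] a) := by
  induction k with
  | zero => exact h
  | succ k ih =>
    rw [Function.iterate_succ_apply', Function.iterate_succ_apply']
    exact hP ih

lemma Rep.dxPow (h : Rep id f a) (α : Fin n → ℕ) :
    Rep id (DxPow α f) (tpow (tD Ω) α a) := by
  have : ∀ l : List (Fin n), Rep id (l.foldr (fun i h => (Dx i)^[α i] h) f)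
      ((l.map fun i => dEnd (tD Ω) i ^ α i).prod a) := by
    intro l
    induction l with
    | nil => exact h
    | cons i l ih =>
      rw [List.map_cons, List.prod_cons, Module.End.mul_apply, Module.End.pow_apply]
      exact ih.iterate (fun h => h.dx i) _
  exact this _

end Full

end CK

end

/-! ### Normal functions and the solution space -/

open scoped ContDiff

noncomputable section

namespace CK

open Topology TopologicalSpace CylFun CK.Sym

section Normal

variable {n N : ℕ}

/-- The labels of the normal coordinates among all labels. -/
def incl : JIdx n (Fin N) → JIdx n ℕ := Sum.map id (Prod.map Fin.val id)

lemma res_incl (z : Jet n) : (fun k : JIdx n (Fin N) => z.res id (incl k)) = z.res Fin.val := by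
  funext k
  rcases k with o | c <;> rfl

variable (Ω : Opens (JIdx n (Fin N) → ℝ))

/-- The points of the jet space with normal coordinates in `Ω`. -/
def full : Opens (JIdx n ℕ → ℝ) :=
  ⟨{w | (fun k => w (incl k)) ∈ Ω}, Ω.2.preimage (by fun_prop)⟩

variable {Ω}

lemma mem_full {z : Jet n} : z.res id ∈ full Ω ↔ z.res Fin.val ∈ Ω := by
  rw [← res_incl]
  rfl

/-- Normal functions as functions on the jet space. -/
def ofNormal : CylFun Ω →ₐ[ℝ] CylFun (full Ω) :=
  pull (fun k => coord (full Ω) (incl k)) fun z => z.2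

lemma ofNormal_apply (a : CylFun Ω) (z : Jet n) (h : z.res Fin.val ∈ Ω) :
    ofNormal a ⟨z.res id, mem_full.2 h⟩ = a ⟨z.res Fin.val, h⟩ :=
  congrArg a.val (Subtype.ext (res_incl z))

lemma rep_full {f : Jet n → ℝ} {a : CylFun Ω} : Rep id f (ofNormal a) ↔ Rep Fin.val f a :=
  ⟨fun h z hz => (h z (mem_full.2 hz)).trans (ofNormal_apply a z hz),
    fun h z hz => (h z (mem_full.1 hz)).trans (ofNormal_apply a z (mem_full.1 hz)).symm⟩

lemma incl_injective : Function.Injective (incl : JIdx n (Fin N) → JIdx n ℕ) :=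
  Function.injective_id.sumMap (Fin.val_injective.prodMap Function.injective_id)

lemma pd_incl_ofNormal (k : JIdx n (Fin N)) (a : CylFun Ω) :
    pd (incl k) (ofNormal a) = ofNormal (pd k a) := by
  rw [← vf_single, ← vf_single k]
  refine vf_pull _ _ (fun j => ?_) a
  rw [vf_single, pd_coord, Pi.single_apply]
  by_cases h : j = k
  · rw [if_pos h, if_pos (congrArg incl h.symm), map_one]
  · rw [if_neg h, if_neg fun h' => h (incl_injective h'.symm), map_zero]

lemma pd_ofNormal (b : Fin N) (α : Fin n → ℕ) (a : CylFun Ω) :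
    pd (.inr (b.1, α)) (ofNormal a) = ofNormal (pd (.inr (b, α)) a) :=
  pd_incl_ofNormal (.inr (b, α)) a

lemma tD_ofNormal (i : Fin n) (a : CylFun Ω) :
    tD (full Ω) i (ofNormal a) = ofNormal (tD Ω i a) := by
  refine vf_pull _ _ (fun j => ?_) a
  rw [vf_coord]
  rcases j with (_ | j) | ⟨b, α⟩
  · exact (map_zero _).symm
  · simp only [incl, Sum.map_inl, id, dxField]
    split_ifs
    · exact (map_one _).symm
    · exact (map_zero _).symm
  · rfl

lemma tpow_ofNormal (α : Fin n → ℕ) (a : CylFun Ω) :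
    tpow (tD (full Ω)) α (ofNormal a) = ofNormal (tpow (tD Ω) α a) :=
  (map_npow (T := dEnd (tD Ω)) (T' := dEnd (tD (full Ω))) ofNormal.toLinearMap
    (fun i a => (tD_ofNormal i a).symm) α a).symm

variable {f : Jet n → ℝ} {a : CylFun Ω}

lemma Rep.dx_normal (h : Rep Fin.val f a) (i : Fin n) : Rep Fin.val (Dx i f) (tD Ω i a) := by
  rw [← rep_full, ← tD_ofNormal]
  exact (rep_full.2 h).dx i

lemma Rep.dxPow_normal (h : Rep Fin.val f a) (α : Fin n → ℕ) :
    Rep Fin.val (DxPow α f) (tpow (tD Ω) α a) := by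
  rw [← rep_full, ← tpow_ofNormal]
  exact (rep_full.2 h).dxPow α

lemma Rep.pdU_normal (h : Rep Fin.val f a) (b : Fin N) (α : Fin n → ℕ) :
    Rep Fin.val (CK.pdU (b.1, α) f) (pd (.inr (b, α)) a) := by
  rw [← rep_full, ← pd_ofNormal]
  exact (rep_full.2 h).pdU _

/-- The components of the total time derivative on the solution space. -/
def solField (γ : CylFun Ω) : JIdx n ℕ → CylFun (full Ω)
  | .inl none => 1
  | .inl (some _) => 0
  | .inr (b, α) => if b + 1 < N then coord (full Ω) (.inr (b + 1, α))
      else if b + 1 = N then -ofNormal (tpow (tD Ω) α γ) else 0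

lemma tpow_rhs (γ : CylFun Ω) (b : Fin N) (α : Fin n → ℕ) :
    tpow (tD Ω) α (rhs γ b) =
      if h : b.1 + 1 < N then coord Ω (.inr (⟨b.1 + 1, h⟩, α)) else -tpow (tD Ω) α γ := by
  rw [rhs]
  split_ifs with h
  · exact tpow_coord _ _
  · exact map_neg _ _

lemma vf_solField_ofNormal (γ a : CylFun Ω) :
    vf (solField γ) (ofNormal a) = ofNormal (sT γ a) := by
  refine vf_pull _ _ (fun j => ?_) a
  rw [vf_coord]
  rcases j with (_ | j) | ⟨b, α⟩
  · exact (map_one _).symm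
  · exact (map_zero _).symm
  · rw [evField, tpow_rhs]
    change (if b.1 + 1 < N then coord (full Ω) (.inr (b.1 + 1, α))
      else if b.1 + 1 = N then -ofNormal (tpow (tD Ω) α γ) else 0) = _
    by_cases h : b.1 + 1 < N
    · rw [if_pos h, dif_pos h]
      rfl
    · rw [if_neg h, dif_neg h, if_pos (by omega), ← map_neg]
      rfl

lemma Rep.solDt {g : Jet n → ℝ} {γ : CylFun Ω} (hg : Rep Fin.val g γ) (h : Rep Fin.val f a) :
    Rep Fin.val (solDt N g f) (sT γ a) := by
  rw [← rep_full, ← vf_solField_ofNormal]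
  refine (rep_full.2 h).vf_of rfl (fun _ => rfl) (v := fun c z =>
    if c.1 + 1 < N then z.u (c.1 + 1, c.2)
      else if c.1 + 1 = N then -(DxPow c.2 g z) else 0) fun c => ?_
  rw [solField]
  split_ifs
  · exact rep_coord _
  · exact (rep_full.2 (hg.dxPow_normal c.2)).neg
  · exact rep_zero

lemma vf_ofNormal_eq_sum (V : JIdx n ℕ → CylFun (full Ω)) {S : Finset (JIdx n (Fin N))}
    (hS : ∀ k ∉ S, pd k a = 0) :
    vf V (ofNormal a) = ∑ k ∈ S, ofNormal (pd k a) * V (incl k) :=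
  (vf_pull_eq_sum _ _ V hS).trans (Finset.sum_congr rfl fun k _ => by rw [vf_coord]; rfl)

/-- The left-hand side `∂_t^N u + g` of the equation. -/
def lhs (γ : CylFun Ω) : CylFun (full Ω) := coord (full Ω) (.inr (N, 0)) + ofNormal γ

lemma Rep.eqn {g : Jet n → ℝ} {γ : CylFun Ω} (hg : Rep Fin.val g γ) :
    Rep id (eqn N g) (lhs γ) :=
  (rep_coord (N, 0)).add (rep_full.2 hg)

lemma tpow_lhs (γ : CylFun Ω) (α : Fin n → ℕ) :
    tpow (tD (full Ω)) α (lhs γ) =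
      coord (full Ω) (.inr (N, α)) + ofNormal (tpow (tD Ω) α γ) := by
  rw [lhs, map_add, tpow_coord, tpow_ofNormal]

/-- The total time derivative and the one on the solution space differ by a combination of the
differential consequences of the equation. -/
lemma tT_ofNormal (hN : 0 < N) (γ a : CylFun Ω) :
    tT (full Ω) (ofNormal a) = ofNormal (sT γ a) +
      act (tD (full Ω)) (lhs γ) (symb (N - 1) (ofNormal a)) := by
  obtain ⟨Γ, hΓ⟩ := exists_multiIndices a
  have hS : ∀ k ∉ (Finset.univ.disjSum (Finset.univ ×ˢ Γ) : Finset (JIdx n (Fin N))),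
      pd k a = 0 := by
    rintro (o | ⟨b, γ⟩) h
    · simp at h
    · exact hΓ b γ fun hγ => h (by simpa using hγ)
  let b₀ : Fin N := ⟨N - 1, by omega⟩
  have h1 : symb (N - 1) (ofNormal a) =
      ∑ α ∈ Γ, Finsupp.single α (ofNormal (pd (.inr (b₀, α)) a)) := by
    rw [symb_eq_sum (Γ := Γ)]
    · exact Finset.sum_congr rfl fun α _ => congrArg _ (pd_ofNormal b₀ α a)
    · intro α hα
      rw [pd_ofNormal b₀ α a, hΓ b₀ α hα, map_zero]
  rw [h1, map_sum, ← vf_solField_ofNormal, tT, evT, vf_ofNormal_eq_sum _ hS,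
    vf_ofNormal_eq_sum _ hS]
  simp only [Finset.sum_disjSum, Finset.sum_product, act_single, add_assoc]
  congr 1
  · refine Finset.sum_congr rfl fun o _ => ?_
    rcases o with _ | o <;> rfl
  · have h2 : ∀ b α, evField (fun b => coord (full Ω) (.inr (b + 1, 0))) (incl (.inr (b, α))) =
        solField γ (incl (.inr (b, α))) +
          if b = b₀ then tpow (tD (full Ω)) α (lhs γ) else 0 := by
      intro b α
      change tpow (tD (full Ω)) α (coord (full Ω) (.inr (b.1 + 1, 0))) =
        (if b.1 + 1 < N then coord (full Ω) (.inr (b.1 + 1, α))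
          else if b.1 + 1 = N then -ofNormal (tpow (tD Ω) α γ) else 0) + _
      rw [tpow_coord, tpow_lhs]
      by_cases h : b = b₀
      · have e : b.1 + 1 = N := by rw [h]; simp only [b₀]; omega
        rw [if_neg (by omega), if_pos e, if_pos h, e]
        ring
      · have e : b.1 + 1 < N := by
          by_contra h'
          exact h (Fin.ext (by simp only [b₀]; omega))
        rw [if_pos e, if_neg h, add_zero]
    simp only [h2, mul_add, Finset.sum_add_distrib]
    congr 1
    rw [Finset.sum_eq_single b₀]
    · simp
    · intro b _ hb
      simp [hb]
    · simp

/-- The components of the embedding of the solution space. -/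
def solEmb (γ : CylFun Ω) : JIdx n ℕ → CylFun Ω
  | .inl o => coord Ω (.inl o)
  | .inr (b, α) => if h : b < N then coord Ω (.inr (⟨b, h⟩, α))
      else -(sT γ)^[b - N] (tpow (tD Ω) α γ)

lemma solEmb_incl (γ : CylFun Ω) (k : JIdx n (Fin N)) : solEmb γ (incl k) = coord Ω k := by
  rcases k with o | ⟨b, α⟩
  · rfl
  · exact dif_pos b.2

lemma solEmb_mem (γ : CylFun Ω) (y : Ω) : (fun k => solEmb γ k y) ∈ full Ω := by
  have : (fun k => solEmb γ (incl k) y) = y.1 := funext fun k => by rw [solEmb_incl]; rfl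
  change (fun k => solEmb γ (incl k) y) ∈ Ω
  rw [this]
  exact y.2

/-- The restriction to the solution space. -/
def toSol (γ : CylFun Ω) : CylFun (full Ω) →ₐ[ℝ] CylFun Ω := pull (solEmb γ) (solEmb_mem γ)

lemma toSol_ofNormal (γ a : CylFun Ω) : toSol γ (ofNormal a) = a := by
  refine CylFun.ext fun y => congrArg a.val (Subtype.ext (funext fun k => ?_))
  change solEmb γ (incl k) y = _
  rw [solEmb_incl]
  rfl

lemma tD_sT_iterate (γ a : CylFun Ω) (i : Fin n) (k : ℕ) :
    tD Ω i ((sT γ)^[k] a) = (sT γ)^[k] (tD Ω i a) := by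
  induction k generalizing a with
  | zero => rfl
  | succ k ih => 
    rw [Function.iterate_succ_apply, Function.iterate_succ_apply, ih, sT, evT_tD]

lemma tD_toSol (γ : CylFun Ω) (i : Fin n) (a : CylFun (full Ω)) :
    tD Ω i (toSol γ a) = toSol γ (tD (full Ω) i a) := by
  refine vf_pull _ _ (fun k => ?_) a
  rcases k with (_ | k) | ⟨b, α⟩
  · simp [solEmb, dxField, vf_coord]
  · simp only [solEmb, dxField, vf_coord]
    split_ifs <;> simp
  · change tD Ω i _ = pull _ _ (coord (full Ω) _)
    rw [pull_coord, solEmb, solEmb]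
    split_ifs with h
    · exact tD_coord _ _ _
    · rw [map_neg, tD_sT_iterate, tpow_add_single tD_comm]

/-- D_t is tangent to the solution space and restricts to 𝒟_t: on u_{N-1,α} by the equation, beyond
it by the choice of `solEmb`. Together with `tD_toSol` this makes all differential consequences of G
restrict to zero. -/
lemma sT_toSol (γ : CylFun Ω) (a : CylFun (full Ω)) :
    sT γ (toSol γ a) = toSol γ (tT (full Ω) a) := by
  refine vf_pull _ _ (fun k => ?_) a
  rcases k with (_ | k) | ⟨b, α⟩
  · simp [solEmb, evField, vf_coord]
  · simp [solEmb, evField, vf_coord]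
  · rw [evField, tpow_coord, pull_coord]
    change sT γ _ = _
    rw [solEmb, solEmb]
    by_cases h : b < N
    · rw [dif_pos h, sT, evT, vf_coord, evField, tpow_rhs]
      by_cases h' : b + 1 < N
      · rw [dif_pos h', dif_pos h']
      · have e : b + 1 - N = 0 := by omega
        rw [dif_neg h', dif_neg h', e]
        rfl
    · rw [dif_neg h, dif_neg (by omega), map_neg, ← Function.iterate_succ_apply' (sT γ),
        ← Nat.succ_sub (by omega : N ≤ b)]

lemma toSol_lhs (γ : CylFun Ω) : toSol γ (lhs γ) = 0 := by
  rw [lhs, map_add, toSol_ofNormal, toSol, pull_coord, solEmb, dif_neg (lt_irrefl N), tpow,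
    npow_zero, Nat.sub_self]
  exact neg_add_cancel _

lemma toSol_consequence (γ : CylFun Ω) (b : ℕ) (α : Fin n → ℕ) :
    toSol γ ((tT (full Ω))^[b] (tpow (tD (full Ω)) α (lhs γ))) = 0 := by
  induction b with
  | zero =>
    have := map_npow (T := dEnd (tD (full Ω))) (T' := dEnd (tD Ω)) (toSol γ).toLinearMap
      (fun i a => (tD_toSol γ i a).symm) α (lhs γ)
    refine this.trans ?_
    change npow _ _ (toSol γ (lhs γ)) = 0
    rw [toSol_lhs, map_zero]
  | succ b ih => rw [Function.iterate_succ_apply', ← sT_toSol, ih, map_zero]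

variable {g : Jet n → ℝ} {γ : CylFun Ω}

lemma Rep.consequence (hg : Rep Fin.val g γ) (b : ℕ) (α : Fin n → ℕ) :
    Rep id (Dt^[b] (DxPow α (CK.eqn N g)))
      ((tT (full Ω))^[b] (tpow (tD (full Ω)) α (lhs γ))) :=
  (hg.eqn.dxPow α).iterate (fun h => h.dt) b

/-- Every point of the normal jet space extends to a solution jet. -/
lemma exists_solutionJet (hg : Rep Fin.val g γ) (y : Ω) :
    ∃ z ∈ solutionJets N g (jetSet Fin.val Ω), z.res Fin.val = y.1 := by
  let w : JIdx n ℕ → ℝ := fun k => solEmb γ k y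
  let z : Jet n := ofRes id w ⟨0, 0, 0⟩
  have hz : z.res id = w := res_ofRes Function.injective_id _ _
  have hy : z.res Fin.val = y.1 := by
    rw [← res_incl, hz]
    exact funext fun k => by simp only [w]; rw [solEmb_incl]; rfl
  have hm : z.res Fin.val ∈ Ω := hy ▸ y.2
  refine ⟨z, ⟨hm, fun b α => ?_⟩, hy⟩
  rw [hg.consequence b α z (mem_full.2 hm)]
  have h : (⟨z.res id, mem_full.2 hm⟩ : full Ω) = ⟨w, solEmb_mem γ y⟩ := Subtype.ext hz
  rw [h]
  exact congrArg (fun a : CylFun Ω => a y) (toSol_consequence γ b α)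

/-- A normal function vanishes on the solution jets if and only if it vanishes. -/
lemma eq_zero_iff_solutionJets (hg : Rep Fin.val g γ) :
    a = 0 ↔ ∀ z (h : z ∈ solutionJets N g (jetSet Fin.val Ω)), a ⟨z.res Fin.val, h.1⟩ = 0 := by
  refine ⟨fun h z _ => by rw [h]; rfl, fun h => CylFun.ext fun y => ?_⟩
  obtain ⟨z, hz, e⟩ := exists_solutionJet hg y
  have : (⟨z.res Fin.val, hz.1⟩ : Ω) = y := Subtype.ext e
  rw [← this]
  exact h z hz

/-- The terms by which D_t exceeds 𝒟_t are multiples of the D^α G, which vanish on solution jets. -/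
lemma Rep.dt_of_mem (hN : 0 < N) (hg : Rep Fin.val g γ) (h : Rep Fin.val f a) {z : Jet n}
    (hz : z ∈ solutionJets N g (jetSet Fin.val Ω)) :
    Dt f z = sT γ a ⟨z.res Fin.val, hz.1⟩ := by
  rw [(rep_full.2 h).dt z (mem_full.2 hz.1), tT_ofNormal hN γ a, CylFun.add_apply,
    ofNormal_apply _ _ hz.1, act, Finsupp.linearCombination_apply, Finsupp.sum,
    CylFun.sum_apply, Finset.sum_eq_zero, add_zero]
  intro α _
  rw [smul_eq_mul, CylFun.mul_apply]
  have := hg.consequence 0 α z (mem_full.2 hz.1)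
  rw [hz.2 0 α] at this
  exact mul_eq_zero_of_right _ this.symm

end Normal

end CK

end

/-! ### Jet domains: openness, star center and section -/

open scoped ContDiff

noncomputable section

namespace CK

open Topology TopologicalSpace CylFun CK.Sym

section Domain

variable {n N : ℕ}

variable (n N) in
/-- The labels of the normal coordinates of order at most `k`. -/
def normalLabels (k : ℕ) : Finset (Fin N × (Fin n → ℕ)) :=
  (Finset.univ ×ˢ multiIndices n k).filter fun c => c.1.1 + len c.2 ≤ k

lemma mem_normalLabels {k : ℕ} {c : Fin N × (Fin n → ℕ)} :
    c ∈ normalLabels n N k ↔ c.1.1 + len c.2 ≤ k := by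
  simp only [normalLabels, Finset.mem_filter, Finset.mem_product, Finset.mem_univ, true_and,
    mem_multiIndices]
  omega

lemma image_normalLabels (k : ℕ) :
    (normalLabels n N k).image (Prod.map Fin.val id) = normalCoords n N k := by
  ext c
  simp only [Finset.mem_image, mem_normalLabels, normalCoords, Finset.mem_filter,
    Finset.mem_product, Finset.mem_range, mem_multiIndices]
  constructor
  · rintro ⟨c', h, rfl⟩
    have := c'.1.2
    simp only [Prod.map_fst, Prod.map_snd, id]
    omega
  · rintro ⟨⟨h1, h2⟩, h3⟩
    exact ⟨(⟨c.1, h1⟩, c.2), h3, rfl⟩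

variable {Ω : Opens (JIdx n (Fin N) → ℝ)}

lemma isNormal_iff {k : ℕ} {f : Jet n → ℝ} :
    IsNormal N k (jetSet Fin.val Ω) f ↔
      ∃ a : CylFun Ω, Rep Fin.val f a ∧ ∃ F, IsCyl a.val (withBase (normalLabels n N k)) F :=
  smoothIn_iff (image_normalLabels k) Fin.val_injective

lemma exists_isNormal {f : Jet n → ℝ} {a : CylFun Ω} (h : Rep Fin.val f a) :
    ∃ k₀, ∀ k ≥ k₀, IsNormal N k (jetSet Fin.val Ω) f := by
  obtain ⟨S, F, hF⟩ := a.isCyl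
  refine ⟨S.toRight.sup fun c => c.1.1 + len c.2, fun k hk =>
    isNormal_iff.2 ⟨a, h, _, hF.mono fun j hj => ?_⟩⟩
  rcases j with o | c
  · simp
  · refine Finset.inr_mem_disjSum.2 (mem_normalLabels.2 (le_trans ?_ hk))
    exact Finset.le_sup (f := fun c : Fin N × (Fin n → ℕ) => c.1.1 + len c.2)
      (Finset.mem_toRight.2 hj)

lemma jetSet_full : jetSet id (full Ω) = jetSet Fin.val Ω := Set.ext fun _ => mem_full

lemma isDiffFun_of_rep {f : Jet n → ℝ} {a : CylFun (full Ω)} (h : Rep id f a) :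
    IsDiffFun (jetSet Fin.val Ω) f := by
  obtain ⟨S, F, hF⟩ := a.isCyl
  refine ⟨S.toRight.image (Prod.map id id), ?_⟩
  rw [← jetSet_full]
  refine (smoothIn_iff (T := S.toRight) rfl Function.injective_id).2
    ⟨a, h, _, hF.mono fun j hj => ?_⟩
  rcases j with o | c
  · simp
  · exact Finset.inr_mem_disjSum.2 (Finset.mem_toRight.2 hj)

lemma IsJetDomain.exists_opens {D : Set (Jet n)} (hD : IsJetDomain N D) :
    ∃ Ω : Opens (JIdx n (Fin N) → ℝ), D = jetSet Fin.val Ω := by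
  obtain ⟨k, O, hO, rfl⟩ := hD.isOpen
  refine ⟨⟨{w | toProj (image_normalLabels k) ((withBase (normalLabels n N k)).restrict w) ∈ O},
    hO.preimage ((contDiff_toProj _).continuous.comp
      (continuous_pi fun j => continuous_apply j.1))⟩, ?_⟩
  ext z
  change _ ↔ toProj _ _ ∈ O
  rw [toProj_restrict]
  rfl

variable (Ω) in
/-- The values of the independent variables. -/
def baseOpens : Opens (Option (Fin n) → ℝ) :=
  ⟨(fun w o => w (.inl o)) '' (Ω : Set (JIdx n (Fin N) → ℝ)), by
    have h : IsOpenMap fun (w : JIdx n (Fin N) → ℝ) (o : Option (Fin n)) => w (.inl o) :=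
      isOpenMap_fst.comp (Homeomorph.sumArrowHomeomorphProdArrow (X := ℝ)).isOpenMap
    exact h _ Ω.2⟩

lemma mem_baseOpens {y : Option (Fin n) → ℝ} :
    y ∈ baseOpens Ω ↔ (y none, fun i => y (some i)) ∈ Jet.base '' jetSet Fin.val Ω := by
  constructor
  · rintro ⟨w, hw, rfl⟩
    refine ⟨ofRes Fin.val w ⟨0, 0, 0⟩, ?_, rfl⟩
    change _ ∈ Ω
    rw [res_ofRes Fin.val_injective]
    exact hw
  · rintro ⟨z, hz, h⟩
    refine ⟨_, hz, funext fun o => ?_⟩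
    rcases o with _ | i
    · exact congrArg Prod.fst h
    · exact congrFun (congrArg Prod.snd h) i

/-- The star center of the base, taken as constant functions. -/
lemma exists_center (hD : IsJetDomain N (jetSet Fin.val Ω)) :
    ∃ C : Center (baseOpens Ω), ∀ c k, pd c (C.w k) = 0 := by
  obtain ⟨b, -, hs⟩ := hD.base_star
  refine ⟨⟨fun k => algebraMap ℝ _ (k.elim b.1 b.2), fun z l hl => ?_⟩, fun c k => ?_⟩
  · have := hs (mem_baseOpens.1 z.2) (sub_nonneg.2 hl.2) hl.1 (by ring)
    rw [mem_baseOpens]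
    convert this using 1
    refine Prod.ext ?_ (funext fun i => ?_)
    · change l * z.1 none + (1 - l) * b.1 = (1 - l) * b.1 + l * z.1 none
      ring
    · change l * z.1 (some i) + (1 - l) * b.2 i = (1 - l) * b.2 i + l * z.1 (some i)
      ring
  · rw [← vf_single]
    exact Derivation.map_algebraMap _ _

lemma base_mem (z : full Ω) : (fun o => coord (full Ω) (.inl o) z) ∈ baseOpens Ω :=
  ⟨_, z.2, rfl⟩

/-- Functions of the independent variables as functions on the jet space. -/
def ofBase : CylFun (baseOpens Ω) →ₐ[ℝ] CylFun (full Ω) :=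
  pull (fun o => coord (full Ω) (.inl o)) base_mem

lemma vf_ofBase {V : JIdx n ℕ → CylFun (full Ω)} {o : Option (Fin n)}
    (hV : ∀ c, V (.inl c) = if c = o then 1 else 0) (h : CylFun (baseOpens Ω)) :
    vf V (ofBase h) = ofBase (pd o h) := by
  rw [← vf_single]
  refine vf_pull _ _ (fun c => ?_) h
  rw [vf_coord, hV, Pi.single_apply]
  split_ifs <;> simp

lemma tT_ofBase (h : CylFun (baseOpens Ω)) : tT (full Ω) (ofBase h) = ofBase (pd none h) :=
  vf_ofBase (fun c => by rcases c with _ | c <;> simp [evField]) h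

lemma tD_ofBase (i : Fin n) (h : CylFun (baseOpens Ω)) :
    tD (full Ω) i (ofBase h) = ofBase (pd (some i) h) :=
  vf_ofBase (fun c => by rcases c with _ | c <;> simp [dxField]) h

variable (Ω) in
/-- The partial derivatives with respect to `x^i` on the base. -/
def baseD (i : Fin n) : Derivation ℝ (CylFun (baseOpens Ω)) (CylFun (baseOpens Ω)) :=
  vf (Pi.single (some i) 1)

lemma baseD_apply (i : Fin n) (h : CylFun (baseOpens Ω)) : baseD Ω i h = pd (some i) h :=
  vf_single _ _

lemma commute_baseD (i j : Fin n) : Commute (dEnd (baseD Ω) i) (dEnd (baseD Ω) j) :=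
  LinearMap.ext fun h => by
    change baseD Ω i (baseD Ω j h) = baseD Ω j (baseD Ω i h)
    simp only [baseD_apply, pd_comm]

/-- On functions of (t, x) total derivatives are partial derivatives, so the jet of such a function
again has components on the base; these are the components of the section. -/
lemma consequence_ofBase (b : ℕ) (α : Fin n → ℕ) (h : CylFun (baseOpens Ω)) :
    (tT (full Ω))^[b] (tpow (tD (full Ω)) α (ofBase h)) =
      ofBase ((pd none)^[b] (tpow (baseD Ω) α h)) := by
  have h1 : tpow (tD (full Ω)) α (ofBase h) = ofBase (tpow (baseD Ω) α h) :=
    (map_npow (T := dEnd (baseD Ω)) (T' := dEnd (tD (full Ω))) ofBase.toLinearMap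
      (fun i a => (congrArg ofBase (baseD_apply i a)).trans (tD_ofBase i a).symm) α h).symm
  rw [h1]
  induction b with
  | zero => rfl
  | succ b ih => rw [Function.iterate_succ_apply', ih, tT_ofBase, Function.iterate_succ_apply']

lemma pd_iterate (b : ℕ) (c d : Option (Fin n)) (h : CylFun (baseOpens Ω)) :
    pd c ((pd d)^[b] h) = (pd d)^[b] (pd c h) := by
  induction b generalizing h with
  | zero => rfl
  | succ b ih => rw [Function.iterate_succ_apply, ih, pd_comm, ← Function.iterate_succ_apply]

lemma exists_rep_ofBase {w : Jet n → ℝ} (hw : SmoothIn (jetSet Fin.val Ω) ∅ w) :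
    ∃ h : CylFun (baseOpens Ω), Rep id w (ofBase h) := by
  obtain ⟨F, hF, hf⟩ := hw
  let φ : (↥(Finset.univ : Finset (Option (Fin n))) → ℝ) →
      ℝ × (Fin n → ℝ) × ((∅ : Finset (Coord n)) → ℝ) := fun y =>
    (y ⟨none, Finset.mem_univ _⟩, fun i => y ⟨some i, Finset.mem_univ _⟩, fun c => isEmptyElim c)
  have hφ : ContDiff ℝ ∞ φ := by
    refine (contDiff_apply ℝ ℝ _).prodMk ((contDiff_pi.2 fun _ => contDiff_apply ℝ ℝ _).prodMk
      contDiff_const)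
  have hcyl : IsCyl (Ω := baseOpens Ω) (fun y => F (φ (Finset.univ.restrict y.1)))
      Finset.univ (F ∘ φ) := by
    intro y
    refine ⟨ContDiffAt.comp _ ?_ hφ.contDiffAt, rfl⟩
    obtain ⟨z, hz, h⟩ := mem_baseOpens.1 y.2
    have e : φ (Finset.univ.restrict y.1) = Jet.proj ∅ z := by
      refine Prod.ext ?_ (Prod.ext (funext fun i => ?_) (Subsingleton.elim _ _))
      · exact (congrArg Prod.fst h).symm
      · exact (congrFun (congrArg Prod.snd h) i).symm
    rw [e]
    exact hF.contDiffAt ((isOpen_proj_image (T := (∅ : Finset (Fin N × (Fin n → ℕ)))) rfl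
      Fin.val_injective).mem_nhds ⟨z, hz, rfl⟩)
  refine ⟨⟨_, _, _, hcyl⟩, fun z hz => ?_⟩
  rw [hf z (mem_full.1 hz)]
  change F _ = F _
  exact congrArg F (Prod.ext rfl (Prod.ext rfl (Subsingleton.elim _ _)))

lemma exists_jetSection (hD : IsJetDomain N (jetSet Fin.val Ω)) :
    Nonempty (JetSection Ω (baseOpens Ω)) := by
  obtain ⟨w, hw, hs⟩ := hD.fiber_star
  obtain ⟨h, hh⟩ := exists_rep_ofBase hw
  refine ⟨⟨fun z => ⟨_, z.2, rfl⟩, fun y => ?_,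
    fun c => (pd none)^[c.1] (tpow (baseD Ω) c.2 h), fun i b α => ?_, fun z l hl => ?_⟩⟩
  · obtain ⟨w, hw, h⟩ := y.2
    exact ⟨⟨w, hw⟩, h⟩
  · rw [pd_iterate, tpow_add_single commute_baseD, baseD_apply]
  · obtain ⟨y, hy⟩ := z
    obtain ⟨ζ, rfl⟩ : ∃ ζ : Jet n, ζ.res Fin.val = y :=
      ⟨ofRes Fin.val y ⟨0, 0, 0⟩, res_ofRes Fin.val_injective _ _⟩
    have key := hs ζ hy l hl
    change Jet.res Fin.val _ ∈ Ω at key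
    convert key using 1
    funext k
    rcases k with (_ | i) | c
    · rfl
    · rfl
    · change _ = l * ζ.u (c.1, c.2) + (1 - l) * Dt^[c.1] (DxPow c.2 w) ζ
      rw [((hh.dxPow c.2).iterate (fun h => h.dt) c.1) ζ (mem_full.2 hy), consequence_ofBase]
      rfl

end Domain

end CK

end

/-! ### Orders, and the determining system in components -/

open scoped ContDiff

noncomputable section

namespace CK

open Topology TopologicalSpace CylFun CK.Sym

namespace Sym

variable {n : ℕ} {A : Type*} [CommRing A]

/-- A symbol of degree at most `r`. -/
def DegLE (r : ℕ) (S : Sym n A) : Prop := ∀ α, r < len α → S α = 0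

lemma DegLE.mono {r r' : ℕ} {S : Sym n A} (h : DegLE r S) (hr : r ≤ r') : DegLE r' S :=
  fun α hα => h α (by omega)

lemma DegLE.add {r : ℕ} {S S' : Sym n A} (h : DegLE r S) (h' : DegLE r S') : DegLE r (S + S') :=
  fun α hα => by rw [Finsupp.add_apply, h α hα, h' α hα, add_zero]

lemma DegLE.smul {R : Type*} [SMulZeroClass R A] {r : ℕ} {S : Sym n A} (c : R) (h : DegLE r S) :
    DegLE r (c • S) :=
  fun α hα => by rw [Finsupp.smul_apply, h α hα, smul_zero]

lemma DegLE.sum {ι : Type*} {s : Finset ι} {r : ℕ} {S : ι → Sym n A}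
    (h : ∀ i ∈ s, DegLE r (S i)) : DegLE r (∑ i ∈ s, S i) :=
  fun α hα => by
    rw [Finsupp.finsetSum_apply]
    exact Finset.sum_eq_zero fun i hi => h i hi α hα

variable [Algebra ℝ A] {D : Fin n → Derivation ℝ A A}

lemma DegLE.coef {r : ℕ} {S : Sym n A} (T : Module.End ℝ A) (h : DegLE r S) :
    DegLE r (coef T S) :=
  fun α hα => by rw [coef_apply, h α hα, map_zero]

lemma DegLE.comp {r : ℕ} {S : Sym n A} (h : DegLE r S) (i : Fin n) :
    DegLE (r + 1) (comp D i S) := by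
  refine DegLE.add (fun α hα => ?_) ((h.coef _).mono (by omega))
  by_cases h0 : α i = 0
  · exact shift_apply_of_eq_zero i S α h0
  · obtain ⟨β, rfl⟩ := exists_eq_add_single h0
    rw [len_add, len_single] at hα
    rw [shift_apply_add, h β (by omega)]

lemma DegLE.npow_comp (hD : ∀ i j, Commute (dEnd D i) (dEnd D j)) {r : ℕ} {S : Sym n A}
    (h : DegLE r S) (γ : Fin n → ℕ) :
    DegLE (r + len γ) (npow (Sym.comp D) γ S) := by
  induction γ using multiIndex_induction with
  | h0 => rw [npow_zero, len_zero]; exact h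
  | hs γ i ih =>
    rw [npow_add_single (commute_comp hD), len_add, len_single]
    exact ih.comp i

lemma star_star (hD : ∀ i j, Commute (dEnd D i) (dEnd D j)) (S : Sym n A) :
    Sym.star D (Sym.star D S) = S := by
  have h0 : ∀ a : A, Sym.star D (Finsupp.single 0 a) = Finsupp.single 0 a := fun a => by
    rw [Sym.star, lift_single, npow_zero]
    rfl
  induction S using Finsupp.induction_linear with
  | zero => simp
  | add S T hS hT => rw [map_add, map_add, hS, hT]
  | single α a =>
    induction α using multiIndex_induction with
    | h0 => rw [h0, h0]
    | hs α i ih => rw [← shift_single, star_shift hD, map_neg, star_comp hD, ih, neg_neg]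

lemma DegLE.star_apply_eq_zero (hD : ∀ i j, Commute (dEnd D i) (dEnd D j)) {r : ℕ} {S : Sym n A}
    (h : DegLE r S) {α : Fin n → ℕ} (hα : r < len α) : Sym.star D S α = 0 := by
  rw [star_apply_of_bounded hD (h.mono hα.le) le_rfl]
  refine Finset.sum_eq_zero fun β _ => ?_
  rw [h (α + β) (by rw [len_add]; omega), map_zero, smul_zero, smul_zero]

/-- Splitting off β = 0 and multiplying by (-1)^|α| brings one component of an adjointness relation
into the form (3). -/
lemma DegLE.star_apply_eq_iff (hD : ∀ i j, Commute (dEnd D i) (dEnd D j)) {r : ℕ} {S : Sym n A}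
    (h : DegLE r S) {α : Fin n → ℕ} (hα : len α ≤ r) (a : A) :
    Sym.star D S α = a ↔ S α - (-1 : ℝ) ^ len α • a =
      ∑ β ∈ (multiIndices n (r - len α)).erase 0,
        ((-1 : ℝ) ^ (len β + 1) * (multiChoose (α + β) β : ℝ)) • tpow D β (S (α + β)) := by
  rw [star_apply_of_bounded hD h hα, ← Finset.add_sum_erase _ _
    (mem_multiIndices.2 (by rw [len_zero]; omega) : (0 : Fin n → ℕ) ∈ _)]
  set s := (multiIndices n (r - len α)).erase 0
  have h1 : (multiChoose (α + 0) 0 : ℝ) = 1 := by simp [multiChoose]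
  have h2 : ∑ β ∈ s, (-1 : ℝ) ^ (len α + len β) • (multiChoose (α + β) β : ℝ) •
      tpow D β (S (α + β)) = -((-1 : ℝ) ^ len α • ∑ β ∈ s,
        ((-1 : ℝ) ^ (len β + 1) * (multiChoose (α + β) β : ℝ)) • tpow D β (S (α + β))) := by
    rw [Finset.smul_sum, ← Finset.sum_neg_distrib]
    refine Finset.sum_congr rfl fun β _ => ?_
    rw [smul_smul, smul_smul, ← neg_smul]
    congr 1
    ring
  rw [h2, h1, len_zero, one_smul, add_zero, add_zero, tpow, npow_zero]
  set X := ∑ β ∈ s, ((-1 : ℝ) ^ (len β + 1) * (multiChoose (α + β) β : ℝ)) • tpow D β (S (α + β))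
  have h3 : ((-1 : ℝ) ^ len α) * (-1) ^ len α = 1 := by rw [← mul_pow]; simp
  have h4 : ∀ x : A, (-1 : ℝ) ^ len α • (-1 : ℝ) ^ len α • x = x := fun x => by
    rw [smul_smul, h3, one_smul]
  change (-1 : ℝ) ^ len α • S α + -((-1 : ℝ) ^ len α • X) = a ↔ _
  rw [← sub_eq_add_neg, ← smul_sub]
  constructor
  · intro h
    rw [← h, h4]
    abel
  · intro h
    rw [← h, sub_sub_cancel, h4]

/-- A family of symbols that is adjoint symmetric up to its order is so altogether. -/
lemma star_eq_of_forall_le (hD : ∀ i j, Commute (dEnd D i) (dEnd D j)) {N : ℕ} {r : ℕ → ℕ}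
    (hr : Monotone r) {P : Fin N → Fin N → Sym n A} (hP : ∀ j k : Fin N, DegLE (r k) (P j k))
    (h : ∀ j k : Fin N, ∀ α, len α ≤ r k → Sym.star D (P j k) α = P k j α) (j k : Fin N) :
    Sym.star D (P j k) = P k j := by
  -- For j ≤ k both sides vanish at exponents longer than `r k`, because r j ≤ r k. For j ≥ k one
  -- takes the adjoint of the relation for (k, j).
  have key : ∀ j k : Fin N, j ≤ k → Sym.star D (P j k) = P k j := by
    intro j k hjk
    refine Finsupp.ext fun α => ?_
    rcases le_or_gt (len α) (r k) with hα | hα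
    · exact h j k α hα
    · rw [(hP j k).star_apply_eq_zero hD hα, hP k j α ((hr hjk).trans_lt hα)]
  rcases le_total j k with hjk | hjk
  · exact key j k hjk
  · rw [← key k j hjk, star_star hD]

end Sym

section Orders

variable {n N : ℕ} {Ω : Opens (JIdx n (Fin N) → ℝ)}

/-- A function that depends on no derivatives with respect to `x` of order higher than `r`. -/
def XOrderLE (r : ℕ) (a : CylFun Ω) : Prop := ∀ b, DegLE r (symb b a)

variable {r r' : ℕ} {a a' : CylFun Ω}

lemma XOrderLE.mono (h : XOrderLE r a) (hr : r ≤ r') : XOrderLE r' a := fun b => (h b).mono hr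

lemma XOrderLE.add (h : XOrderLE r a) (h' : XOrderLE r a') : XOrderLE r (a + a') := fun b => by
  rw [map_add]
  exact (h b).add (h' b)

lemma XOrderLE.smul (c : ℝ) (h : XOrderLE r a) : XOrderLE r (c • a) := fun b => by
  rw [map_smul]
  exact (h b).smul c

lemma XOrderLE.neg (h : XOrderLE r a) : XOrderLE r (-a) := by
  rw [← neg_one_smul ℝ]
  exact h.smul _

lemma XOrderLE.sum {ι : Type*} {s : Finset ι} {a : ι → CylFun Ω}
    (h : ∀ i ∈ s, XOrderLE r (a i)) : XOrderLE r (∑ i ∈ s, a i) := fun b => by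
  rw [map_sum]
  exact DegLE.sum fun i hi => h i hi b

lemma XOrderLE.mul (h : XOrderLE r a) (h' : XOrderLE r a') : XOrderLE r (a * a') := fun b => by
  rw [JetCenter.symb_mul]
  exact ((h' b).smul a).add ((h b).smul a')

lemma XOrderLE.pd (h : XOrderLE r a) (k : JIdx n (Fin N)) : XOrderLE r (pd k a) :=
  fun b α hα => by
    rw [symb_apply, pd_comm, ← symb_apply, h b α hα, pd_zero]

lemma XOrderLE.tpow (h : XOrderLE r a) (γ : Fin n → ℕ) : XOrderLE (r + len γ) (tpow (tD Ω) γ a) :=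
  fun b => by
    rw [symb_tpow]
    exact (h b).npow_comp tD_comm γ

lemma xOrderLE_of_isCyl {F} (h : IsCyl a.val (withBase (normalLabels n N r)) F) :
    XOrderLE r a := fun b α hα => by
  rw [symb_apply]
  refine pd_eq_zero h fun h' => ?_
  have := mem_normalLabels.1 (Finset.inr_mem_disjSum.1 h')
  simp only at this
  omega

variable {g Λ : CylFun Ω} {m p : ℕ}

/-- 𝒟_t replaces u_{c,γ} by D^γ K_c, which has order at most |γ| + m. -/
lemma XOrderLE.sT (hg : XOrderLE m g) (h : XOrderLE r a) : XOrderLE (r + m) (sT g a) := fun b => by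
  rw [CK.sT, symb_evT]
  refine (((h b).coef _).mono (by omega)).add (DegLE.sum fun c _ => DegLE.sum fun γ hγ => ?_)
  refine DegLE.smul _ ?_
  have h1 : len γ ≤ r := by
    by_contra h'
    exact (Finsupp.mem_support_iff.1 hγ) (h c γ (by omega))
  have h2 : DegLE m (symb b (rhs g c)) := by
    rw [rhs]
    split_ifs
    · rw [symb_coord]
      split_ifs
      · intro α hα
        refine Finsupp.single_eq_of_ne fun h0 => ?_
        rw [h0, len_zero] at hα
        omega
      · exact fun _ _ => rfl
    · exact hg.neg b
  exact (h2.npow_comp tD_comm γ).mono (by omega)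

lemma adj_eq_sum (hg : XOrderLE m g) (b : Fin N) :
    adj g Λ b = ∑ α ∈ multiIndices n m,
      (-1 : ℝ) ^ len α • tpow (tD Ω) α (pd (.inr (b, α)) g * Λ) := by
  rw [adj, dif_pos b.2, Fin.eta, symb_eq_sum (Γ := multiIndices n m), Finset.smul_sum, map_sum]
  · refine Finset.sum_congr rfl fun α _ => ?_
    rw [Finsupp.smul_single, eps_single tD_comm, smul_eq_mul, mul_comm]
  · intro α hα
    exact hg b α (by rw [mem_multiIndices] at hα; omega)

/-- Each step costs one 𝒟_t and hence m orders; the start max p m leaves room for the products of Λ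
with derivatives of g. This is the bound p' of (3). -/
lemma XOrderLE.om (hg : XOrderLE m g) (h : XOrderLE p Λ) (q : ℕ) :
    XOrderLE (max p m + m * q) (om g Λ q) := by
  induction q with
  | zero => exact h.mono (by omega)
  | succ q ih =>
    rw [CK.om]
    refine ((hg.sT ih).neg.mono (by rw [mul_add]; omega)).add ?_
    by_cases hb : N - (q + 1) < N
    · have := adj_eq_sum (Λ := Λ) hg ⟨_, hb⟩
      rw [this]
      refine XOrderLE.sum fun α hα => ((((hg.pd _).mono (le_max_right p m)).mul
        (h.mono (le_max_left p m))).tpow α).smul _ |>.mono ?_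
      rw [mem_multiIndices] at hα
      rw [mul_add]
      omega
    · rw [adj, dif_neg hb]
      intro b α _
      rw [map_zero]
      rfl

/-- Unrolls the recursion into the closed formula that defines Ω_q in the statement. -/
lemma om_eq_sum (g Λ : CylFun Ω) (q : ℕ) :
    om g Λ q = (-1 : ℝ) ^ q • (sT g)^[q] Λ +
      ∑ k ∈ Finset.Icc 1 q, (-1 : ℝ) ^ (q - k) • (sT g)^[q - k] (adj g Λ (N - k)) := by
  induction q with
  | zero => simp [om]
  | succ q ih =>
    rw [om, ih, Finset.sum_Icc_succ_top (by omega), Nat.sub_self, pow_zero, one_smul, ← add_assoc]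
    change _ + adj g Λ _ = _ + adj g Λ _
    congr 1
    rw [map_add, map_sum, Derivation.map_smul, neg_add, ← Finset.sum_neg_distrib,
      ← Function.iterate_succ_apply' (sT g), pow_succ, mul_neg_one, neg_smul]
    congr 1
    refine Finset.sum_congr rfl fun k hk => ?_
    have := (Finset.mem_Icc.1 hk).2
    rw [Derivation.map_smul, ← Function.iterate_succ_apply' (sT g), ← neg_smul, Nat.succ_sub this, pow_succ,
      mul_neg_one]

end Orders

/-! ### Translation of the determining system -/

section Translation

variable {n N m : ℕ} {Ω : Opens (JIdx n (Fin N) → ℝ)} {g f Λ : Jet n → ℝ} {γ a l : CylFun Ω}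

lemma Rep.restrictedEuler (hN : 0 < N) (h : Rep Fin.val f a) :
    Rep Fin.val (restrictedEuler N f) (euler (Fin.rev ⟨0, hN⟩) a) := fun z hz => by
  obtain ⟨Γ, hΓ⟩ := exists_multiIndices a
  have e : N - 1 = (Fin.rev ⟨0, hN⟩ : Fin N).1 := by rw [Fin.val_rev]
  have h1 : ∀ α, DxPow α (CK.pdU (N - 1, α) f) z =
      tpow (tD Ω) α (pd (.inr (Fin.rev ⟨0, hN⟩, α)) a) ⟨z.res Fin.val, hz⟩ := fun α => by
    rw [e]
    exact (h.pdU_normal _ α).dxPow_normal α z hz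
  rw [CK.restrictedEuler, euler_eq_sum (hΓ _), CylFun.sum_apply,
    finsum_eq_sum_of_support_subset (s := Γ)]
  · refine Finset.sum_congr rfl fun α _ => ?_
    rw [npow_neg tD_comm, LinearMap.smul_apply, CylFun.smul_apply, h1]
  · intro α hα
    by_contra h'
    refine hα ?_
    change _ * _ = (0 : ℝ)
    rw [h1, hΓ _ α h', map_zero, CylFun.zero_apply, mul_zero]

lemma Rep.adjLin (hg : Rep Fin.val g γ) (hγ : XOrderLE m γ) (hΛ : Rep Fin.val Λ l) (b : Fin N) :
    Rep Fin.val (adjLin m g b Λ) (adj γ l b) := by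
  rw [adj_eq_sum hγ]
  exact Rep.sum fun α _ => (((hg.pdU_normal b α).mul hΛ).dxPow_normal α).const_mul _

lemma Rep.solDt_iterate (hg : Rep Fin.val g γ) (h : Rep Fin.val f a) (k : ℕ) :
    Rep Fin.val ((CK.solDt N g)^[k] f) ((sT γ)^[k] a) := by
  induction k with
  | zero => exact h
  | succ k ih =>
    rw [Function.iterate_succ_apply', Function.iterate_succ_apply']
    exact hg.solDt ih

lemma Rep.omega (hg : Rep Fin.val g γ) (hγ : XOrderLE m γ) (hΛ : Rep Fin.val Λ l) {q : ℕ}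
    (hq : q ≤ N) : Rep Fin.val (Omega N m g Λ q) (om γ l q) := by
  rw [om_eq_sum]
  refine ((hg.solDt_iterate hΛ q).const_mul _).add (Rep.sum fun k hk => ?_)
  have := Finset.mem_Icc.1 hk
  have hb : N - k < N := by omega
  exact (hg.solDt_iterate (hg.adjLin hγ hΛ ⟨N - k, hb⟩) _).const_mul _

/-- The determining system in terms of functions on the normal jet space. -/
lemma determiningSystem_iff {p : ℕ} (hg : Rep Fin.val g γ) (hγ : XOrderLE m γ)
    (hΛ : Rep Fin.val Λ l) (hl : XOrderLE p l) :
    DeterminingSystem N m p g (jetSet Fin.val Ω) Λ ↔ Determining γ l := by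
  have h1 : (∀ z ∈ jetSet Fin.val Ω, Omega N m g Λ N z = 0) ↔ om γ l N = 0 :=
    (hg.omega hγ hΛ le_rfl).eq_iff Fin.val_injective rep_zero
  have hP : ∀ j k : Fin N, DegLE (max p m + m * k) (symb j.rev (om γ l k)) := fun j k =>
    hγ.om hl k _
  have h2 : ∀ j k : Fin N, ∀ α ∈ multiIndices n (max p m + m * k),
      (∀ z ∈ jetSet Fin.val Ω, pdU (N - 1 - j, α) (Omega N m g Λ k) z
          - (-1 : ℝ) ^ len α * pdU (N - 1 - k, α) (Omega N m g Λ j) z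
        = ∑ β ∈ (multiIndices n (max p m + m * k - len α)).erase 0,
          (-1 : ℝ) ^ (len β + 1) * (multiChoose (α + β) β : ℝ) *
            DxPow β (pdU (N - 1 - j, α + β) (Omega N m g Λ k)) z) ↔
      Sym.star (tD Ω) (symb j.rev (om γ l k)) α = symb k.rev (om γ l j) α := by
    intro j k α hα
    have e : ∀ i : Fin N, N - 1 - i = i.rev.1 := fun i => by rw [Fin.val_rev]; omega
    have ho : ∀ i : Fin N, Rep Fin.val (Omega N m g Λ i) (om γ l i) := fun i =>
      hg.omega hγ hΛ i.2.le
    rw [(hP j k).star_apply_eq_iff tD_comm (mem_multiIndices.1 hα), e, e]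
    exact (((ho k).pdU_normal j.rev α).sub (((ho j).pdU_normal k.rev α).const_mul _)).eq_iff
      Fin.val_injective
      (Rep.sum fun β _ => (((ho k).pdU_normal j.rev (α + β)).dxPow_normal β).const_mul _)
  rw [DeterminingSystem, Determining, h1]
  refine and_congr_right fun _ => ⟨fun h => ?_, fun h j hj k hk α hα => ?_⟩
  · refine star_eq_of_forall_le tD_comm (r := fun k => max p m + m * k)
      (fun k k' hk => by simp only; gcongr) hP fun j k α hα => ?_
    exact (h2 j k α (mem_multiIndices.2 hα)).1 (h j j.2 k k.2 α (mem_multiIndices.2 hα))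
  · exact (h2 ⟨j, hj⟩ ⟨k, hk⟩ α hα).2 (by rw [h])

end Translation

end CK

end

/-! ### Conservation laws, multipliers and triviality on jets -/

open scoped ContDiff

noncomputable section

namespace CK

open Topology TopologicalSpace CylFun CK.Sym

section Laws

variable {n N : ℕ} {Ω : Opens (JIdx n (Fin N) → ℝ)} {g Λ Φt : Jet n → ℝ} {Φ : Fin n → Jet n → ℝ}
  {γ l φt : CylFun Ω} {φ : Fin n → CylFun Ω}

lemma euler_ofNormal (b : Fin N) (a : CylFun Ω) :
    euler b.1 (ofNormal a) = ofNormal (euler b a) := by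
  obtain ⟨Γ, hΓ⟩ := exists_multiIndices a
  rw [euler_eq_sum (hΓ b), euler_eq_sum (Γ := Γ), map_sum]
  · refine Finset.sum_congr rfl fun α _ => ?_
    rw [pd_ofNormal, npow_neg tD_comm, npow_neg tD_comm, LinearMap.smul_apply,
      LinearMap.smul_apply, tpow_ofNormal, map_smul]
  · intro α hα
    rw [pd_ofNormal, hΓ b α hα, map_zero]

lemma isProportional_act (hg : Rep Fin.val g γ) (S : Sym n (CylFun (full Ω))) :
    IsProportional N g (jetSet Fin.val Ω) (toJet id (act (tD (full Ω)) (lhs γ) S)) := by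
  refine ⟨{0} ×ˢ S.support, fun c => toJet id (S c.2), fun c => isDiffFun_of_rep (rep_toJet _),
    fun z hz => ?_⟩
  rw [rep_toJet _ z (mem_full.2 hz), act, Finsupp.linearCombination_apply, Finsupp.sum,
    CylFun.sum_apply, Finset.sum_product, Finset.sum_singleton]
  refine Finset.sum_congr rfl fun α _ => ?_
  have h := rep_toJet (e := id) (S α) z (mem_full.2 hz)
  rw [hg.consequence 0 α z (mem_full.2 hz)]
  change _ = toJet id (S α) z * _
  rw [h]
  rfl

/-- On solution jets D_t acts on normal functions as 𝒟_t, and these jets cover the normal jet space.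
-/
lemma conservationLaw_iff (hN : 0 < N) (hg : Rep Fin.val g γ) (ht : Rep Fin.val Φt φt)
    (hx : ∀ i, Rep Fin.val (Φ i) (φ i)) :
    (∀ z ∈ solutionJets N g (jetSet Fin.val Ω), Dt Φt z + ∑ i, Dx i (Φ i) z = 0) ↔
      sT γ φt + ∑ i, tD Ω i (φ i) = 0 := by
  rw [eq_zero_iff_solutionJets hg]
  refine forall₂_congr fun z hz => ?_
  rw [hg.dt_of_mem hN ht hz, CylFun.add_apply, CylFun.sum_apply,
    Finset.sum_congr rfl fun i _ => (hx i).dx_normal i z hz.1]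

/-- D_tΦ^t - 𝒟_tΦ^t is the linearization of Φ^t in u_{N-1} applied to G; by parts it is E_{N-1}(Φ^t)
G plus the divergence of Γ. -/
lemma isMultiplierOf (hN : 0 < N) (hg : Rep Fin.val g γ) (hΛ : Rep Fin.val Λ l)
    (ht : Rep Fin.val Φt φt) (hx : ∀ i, Rep Fin.val (Φ i) (φ i))
    (h : sT γ φt + ∑ i, tD Ω i (φ i) = 0) (hl : l = euler (Fin.rev ⟨0, hN⟩) φt) :
    IsMultiplierOf N g (jetSet Fin.val Ω) Λ Φt Φ := by
  refine ⟨fun z hz => by rw [hΛ z hz, hl, ht.restrictedEuler hN z hz], ?_⟩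
  let B : Fin n → Sym n (CylFun (full Ω)) := fun i =>
    divPart i (toDiv (tD (full Ω)) (symb (N - 1) (ofNormal φt)))
  refine ⟨fun i => toJet id (coact (tD (full Ω)) (lhs γ) (B i)), fun i => ?_, ?_⟩
  · change IsProportional _ _ _ (toJet id (coact (tD (full Ω)) (lhs γ) (B i)))
    -- Rewriting Γ^i as an operator acting on G exhibits it as a combination of the D^α G.
    rw [coact_eq_act tD_comm]
    exact isProportional_act hg _
  · rw [← jetSet_full]
    refine ((hg.eqn.mul (rep_full.2 hΛ)).eq_iff Function.injective_id
      ((rep_full.2 ht).dt.add (Rep.sum fun i _ =>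
        ((rep_full.2 (hx i)).sub (rep_toJet _)).dx i))).2 ?_
    have e : N - 1 = (Fin.rev ⟨0, hN⟩ : Fin N).1 := by rw [Fin.val_rev]
    have h1 : eps (tD (full Ω)) (symb (N - 1) (ofNormal φt)) = ofNormal l := by
      rw [← euler_apply, e, euler_ofNormal, ← hl]
    have h2 := congrArg ofNormal h
    simp only [map_add, map_sum, ← tD_ofNormal, map_zero] at h2
    rw [tT_ofNormal hN γ, act_eq_eps_mul_add tD_comm, h1]
    simp only [map_sub, Finset.sum_sub_distrib, B]
    linear_combination -h2

lemma isTrivial (hN : 0 < N) (hg : Rep Fin.val g γ) (ht : Rep Fin.val Φt φt)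
    (hx : ∀ i, Rep Fin.val (Φ i) (φ i)) {θ : Fin n → CylFun Ω} {ψ : Fin n → Fin n → CylFun Ω}
    (hψ : ∀ i j, ψ i j = -ψ j i) (h : φt = ∑ i, tD Ω i (θ i))
    (h' : ∀ i, φ i = -sT γ (θ i) + ∑ j, tD Ω j (ψ i j)) :
    IsTrivial N g (jetSet Fin.val Ω) Φt Φ := by
  choose k hk using fun i => exists_isNormal (rep_toJet (e := Fin.val) (θ i))
  choose k' hk' using fun c : Fin n × Fin n =>
    exists_isNormal (rep_toJet (e := Fin.val) (ψ c.1 c.2))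
  refine ⟨max (Finset.univ.sup k) (Finset.univ.sup k'), fun i => toJet Fin.val (θ i),
    fun i j => toJet Fin.val (ψ i j),
    fun i => hk i _ (le_max_of_le_left (Finset.le_sup (Finset.mem_univ i))),
    fun i j => hk' (i, j) _ (le_max_of_le_right (Finset.le_sup (Finset.mem_univ (i, j)))),
    fun i j => ?_, fun z hz => ⟨?_, fun i => ?_⟩⟩
  · exact ((rep_toJet _).eq_iff Fin.val_injective (rep_toJet _).neg).2 (hψ i j)
  · rw [ht z hz.1, h]
    exact (Rep.sum (fun i _ => (rep_toJet (e := Fin.val) (θ i)).dx_normal i) z hz.1).symm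
  · rw [hx i z hz.1, h', hg.dt_of_mem hN (rep_toJet (e := Fin.val) (θ i)) hz, CylFun.add_apply]
    exact congrArg _
      (Rep.sum (fun j _ => (rep_toJet (e := Fin.val) (ψ i j)).dx_normal j) z hz.1).symm

/-- Triviality is required on solutions only, but both sides of the relation for the density are
normal, so it holds identically. -/
lemma IsTrivial.exists_eq_div (hg : Rep Fin.val g γ) (ht : Rep Fin.val Φt φt)
    (h : IsTrivial N g (jetSet Fin.val Ω) Φt Φ) :
    ∃ θ : Fin n → CylFun Ω, φt = ∑ i, tD Ω i (θ i) := by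
  obtain ⟨k, θ, ψ, hθ, -, -, hz⟩ := h
  choose θ' hθ' _ using fun i => isNormal_iff.1 (hθ i)
  refine ⟨θ', sub_eq_zero.1 ((eq_zero_iff_solutionJets hg).2 fun z h => ?_)⟩
  rw [CylFun.sub_apply, ← ht z h.1, (hz z h).1, sub_eq_zero]
  exact Rep.sum (fun i _ => (hθ' i).dx_normal i) z h.1

end Laws

end CK

end

/-! ### The theorem -/

theorem theorem3p3 {n N : ℕ} (hn : 1 ≤ n) (hN : 1 ≤ N)
    (D : Set (CK.Jet n)) (hD : CK.IsJetDomain N D)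
    (m : ℕ) (g : CK.Jet n → ℝ) (hg : CK.IsNormal N m D g)
    (p : ℕ) (Λ : CK.Jet n → ℝ) (hΛ : CK.IsNormal N p D Λ) :
    ((∃ (Φt : CK.Jet n → ℝ) (Φ : Fin n → CK.Jet n → ℝ),
        CK.IsConservationLaw N g D Φt Φ ∧ CK.IsMultiplierOf N g D Λ Φt Φ) ↔
      CK.DeterminingSystem N m p g D Λ) ∧
    ((∃ (Φt : CK.Jet n → ℝ) (Φ : Fin n → CK.Jet n → ℝ),
        CK.IsConservationLaw N g D Φt Φ ∧ ¬ CK.IsTrivial N g D Φt Φ ∧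
          CK.IsMultiplierOf N g D Λ Φt Φ) ↔
      CK.DeterminingSystem N m p g D Λ ∧ ∃ z ∈ D, Λ z ≠ 0) := by
  obtain ⟨Ω, rfl⟩ := hD.exists_opens
  obtain ⟨s⟩ := CK.exists_jetSection hD
  obtain ⟨C₀, hC₀⟩ := CK.exists_center hD
  obtain ⟨γ, hγ, F, hF⟩ := CK.isNormal_iff.1 hg
  obtain ⟨l, hl, F', hF'⟩ := CK.isNormal_iff.1 hΛ
  rw [CK.determiningSystem_iff hγ (CK.xOrderLE_of_isCyl hF) hl (CK.xOrderLE_of_isCyl hF')]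
  -- Conservation laws with multiplier Λ become identities in the algebra of normal functions, where
  -- the arguments above apply.
  have hsound : ∀ {Φt Φ}, CK.IsConservationLaw N g (CK.jetSet Fin.val Ω) Φt Φ →
      CK.IsMultiplierOf N g (CK.jetSet Fin.val Ω) Λ Φt Φ →
      ∃ (φt : CK.CylFun Ω) (φ : Fin n → CK.CylFun Ω), CK.Rep Fin.val Φt φt ∧
        (∀ i, CK.Rep Fin.val (Φ i) (φ i)) ∧ CK.sT γ φt + ∑ i, CK.tD Ω i (φ i) = 0 ∧
        l = CK.euler (Fin.rev ⟨0, hN⟩) φt := by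
    rintro Φt Φ ⟨⟨k, hk, hk'⟩, hz⟩ ⟨hm, -⟩
    obtain ⟨φt, ht, -⟩ := CK.isNormal_iff.1 hk
    choose φ hx _ using fun i => CK.isNormal_iff.1 (hk' i)
    exact ⟨φt, φ, ht, hx, (CK.conservationLaw_iff hN hγ ht hx).1 hz,
      (hl.eq_iff Fin.val_injective (ht.restrictedEuler hN)).1 hm⟩
  have hcomplete : CK.Determining γ l → ∃ (Φt : CK.Jet n → ℝ) (Φ : Fin n → CK.Jet n → ℝ)
      (φt : CK.CylFun Ω), CK.Rep Fin.val Φt φt ∧ l = CK.euler (Fin.rev ⟨0, hN⟩) φt ∧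
        CK.IsConservationLaw N g (CK.jetSet Fin.val Ω) Φt Φ ∧
        CK.IsMultiplierOf N g (CK.jetSet Fin.val Ω) Λ Φt Φ := by
    intro h
    obtain ⟨φt, φ, h1, h2⟩ := CK.exists_conservationLaw s C₀ hC₀ hN h
    have ht := CK.rep_toJet (e := Fin.val) φt
    have hx := fun i => CK.rep_toJet (e := Fin.val) (φ i)
    obtain ⟨k, hk⟩ := CK.exists_isNormal ht
    choose k' hk' using fun i => CK.exists_isNormal (hx i)
    exact ⟨_, _, φt, ht, h2,
      ⟨⟨max k (Finset.univ.sup k'), hk _ (le_max_left _ _), fun i =>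
        hk' i _ (le_max_of_le_right (Finset.le_sup (Finset.mem_univ i)))⟩,
        (CK.conservationLaw_iff hN hγ ht hx).2 h1⟩,
      CK.isMultiplierOf hN hγ hl ht hx h1 h2⟩
  have hdet : ∀ {Φt Φ}, CK.IsConservationLaw N g (CK.jetSet Fin.val Ω) Φt Φ →
      CK.IsMultiplierOf N g (CK.jetSet Fin.val Ω) Λ Φt Φ → CK.Determining γ l := by
    intro Φt Φ h1 h2
    obtain ⟨φt, φ, -, -, h3, h4⟩ := hsound h1 h2
    exact CK.determining_of_conservationLaw hN h3 h4
  refine ⟨⟨?_, ?_⟩, ?_, ?_⟩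
  · rintro ⟨Φt, Φ, h1, h2⟩
    exact hdet h1 h2
  · intro h
    obtain ⟨Φt, Φ, -, -, -, h1, h2⟩ := hcomplete h
    exact ⟨Φt, Φ, h1, h2⟩
  · rintro ⟨Φt, Φ, h1, h2, h3⟩
    refine ⟨hdet h1 h3, ?_⟩
    by_contra! h0
    obtain ⟨φt, φ, ht, hx, h4, h5⟩ := hsound h1 h3
    have hl0 : l = 0 := (hl.eq_iff Fin.val_injective CK.rep_zero).1 h0
    obtain ⟨θ, ψ, hψ, h6, h7⟩ :=
      CK.exists_trivial_of_euler_eq_zero s C₀ hC₀ hn hN h4 (h5.symm.trans hl0)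
    exact h2 (CK.isTrivial hN hγ ht hx hψ h6 h7)
  · rintro ⟨h, z, hz, hz0⟩
    obtain ⟨Φt, Φ, φt, ht, h3, h1, h2⟩ := hcomplete h
    refine ⟨Φt, Φ, h1, fun h4 => hz0 ?_, h2⟩
    obtain ⟨θ, hθ⟩ := h4.exists_eq_div hγ ht
    -- The density is a divergence, so its variational derivative Λ vanishes at z.
    rw [hl z hz, h3, hθ, map_sum, Finset.sum_eq_zero fun i _ => CK.euler_tD _ i _]
    rfl
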